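/- Let $n\ge 1$, let $\mu_0,\dots,\mu_n\in(0,1)$ be real numbers with sum $|\mu|$, and let $z=(z_0,\dots,z_n)\in\mathbb C^{n+1}$ have pairwise distinct entries. Let $\eta_z=(z_0-\zeta)^{-\mu_0}\cdots(z_n-\zeta)^{-\mu_n}\,d\zeta$ (a multivalued differential in $\zeta$). A relative arc of $(\mathbb C,\{z_0,\dots,z_n\})$ is a piecewise continuously differentiable path in $\mathbb C$ whose end points lie in $\{z_0,\dots,z_n\}$ and which does not meet this set elsewhere. A Lauricella function is a holomorphic function of the form $z'\mapsto\int_{\gamma_{z'}}\eta_{z'}$, defined near some tuple with pairwise distinct entries, where $\gamma_{z'}$ is a relative arc of $(\mathbb C,\{z'_0,\dots,z'_n\})$ and $\gamma_{z'}$ and the determination of $\eta_{z'}$ along it depend continuously on $z'$, or an analytic continuation of such a function in the space of tuples with pairwise distinct entries. Let $L_z$ be the complex vector space spanned by the germs at $z$ of Lauricella functions. An $L$-arc system for $z$ is an embedded, piecewise continuously differentiable oriented arc $\delta$ in the Riemann sphere from $z_0$ to $\infty$ that passes successively through $z_1,\dots,z_n$ and near $\infty$ follows the real axis in the positive direction;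 for $1\le k\le n$ let $\delta_k$ be its piece from $z_{k-1}$ to $z_k$. The differential $\eta_z$ has a determination on the complement of $\delta$ which, in a left half plane, is given by the principal values of the powers $(z_k-\zeta)^{-\mu_k}$; extend it to $\delta$ by continuity from the left. The integral of $\eta$ over $\delta_k$ with this determination, where $z$ varies in a small neighborhood and $\delta_k$ and the determination follow continuously, is denoted $\int_{\delta_k}\eta$. (i) If $|\mu|$ is not an integer $\ge 2$, then for every $L$-arc system $\delta$ for $z$ the functions $\int_{\delta_1}\eta,\dots,\int_{\delta_n}\eta$ exist and their germs at $z$ form a basis of $L_z$; in particular, $\dim_{\mathbb C} L_z=n$. (ii) For all $\mu$ as above, $L_z$ contains the constant functions if and only if $|\mu|=1$. -/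

import Mathlib

open scoped Topology
open Filter Set

namespace Lauricella

/-- `γ` is piecewise continuously differentiable on `[a, b]`: away from finitely many break points it
is `C¹`, up to the end points of every piece. -/
def PiecewiseC1On (γ : ℝ → ℂ) (a b : ℝ) : Prop :=
  ∃ s : Finset ℝ, ∀ c d : ℝ, a ≤ c → c < d → d ≤ b → (∀ x ∈ s, x ∉ Ioo c d) →
    ContDiffOn ℝ 1 γ (Icc c d)

/-- `γ`, restricted to `[0, 1]`, is a relative arc of `(ℂ, {z₀, …, zₙ})`: a piecewise
differentiable path with end points in `{z₀, …, zₙ}` that does not meet this set elsewhere. -/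
structure IsRelativeArc {n : ℕ} (z : Fin (n + 1) → ℂ) (γ : ℝ → ℂ) : Prop where
  piecewise : PiecewiseC1On γ 0 1
  source : γ 0 ∈ range z
  target : γ 1 ∈ range z
  interior : ∀ t ∈ Ioo (0 : ℝ) 1, γ t ∉ range z

/-- The value of the Lauricella integrand `∏ₖ (zₖ - ζ) ^ (-μₖ)` that belongs to the choice
`ℓₖ` of the logarithms of `zₖ - ζ`. -/
noncomputable def integrand {n : ℕ} (μ : Fin (n + 1) → ℝ) (ℓ : Fin (n + 1) → ℂ) : ℂ :=
  Complex.exp (-∑ k, (μ k : ℂ) * ℓ k)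

/-- `I` is the integral of `ψ(t) dζ` along the path `ζ = γ(t)`, `0 < t < 1`, as an improper integral
at both ends (where the Lauricella integrand is singular). -/
def HasArcIntegral (γ ψ : ℝ → ℂ) (I : ℂ) : Prop :=
  Tendsto (fun p : ℝ × ℝ => ∫ t in p.1..p.2, ψ t * deriv γ t) (𝓝[>] 0 ×ˢ 𝓝[<] 1) (𝓝 I)

/-- Near `z`, the function `f` is `w ↦ ∫_{Γ w} η_w`, where the relative arcs `Γ w` of
`(ℂ, {w₀, …, wₙ})` and the determinations of `η_w` along them (given by logarithms `ℓₖ w` of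
`wₖ - Γ w`) depend continuously on `w`, and for `w = z` are the arc `γ` and the determination `ψ`. -/
def IsArcIntegral {n : ℕ} (μ : Fin (n + 1) → ℝ) (z : Fin (n + 1) → ℂ) (γ ψ : ℝ → ℂ)
    (f : (Fin (n + 1) → ℂ) → ℂ) : Prop :=
  ∃ (N : Set (Fin (n + 1) → ℂ)) (Γ : (Fin (n + 1) → ℂ) → ℝ → ℂ)
    (ℓ : Fin (n + 1) → (Fin (n + 1) → ℂ) → ℝ → ℂ),
    N ∈ 𝓝 z ∧
    ContinuousOn (fun p : (Fin (n + 1) → ℂ) × ℝ => Γ p.1 p.2) (N ×ˢ Icc 0 1) ∧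
    (∀ k, ContinuousOn (fun p : (Fin (n + 1) → ℂ) × ℝ => ℓ k p.1 p.2) (N ×ˢ Ioo 0 1)) ∧
    (∀ w ∈ N, IsRelativeArc w (Γ w)) ∧
    (∀ w ∈ N, ∀ k, ∀ t ∈ Ioo (0 : ℝ) 1, Complex.exp (ℓ k w t) = w k - Γ w t) ∧
    (∀ t ∈ Icc (0 : ℝ) 1, Γ z t = γ t) ∧
    (∀ t ∈ Ioo (0 : ℝ) 1, integrand μ (fun k => ℓ k z t) = ψ t) ∧
    (∀ w ∈ N, HasArcIntegral (Γ w) (fun t => integrand μ (fun k => ℓ k w t)) (f w))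

/-- The germ of `f` at `z` is the analytic continuation of the germ of `f₀` at `z₀` along a path in
the space of tuples with pairwise distinct entries. -/
def IsAnalyticContinuation {n : ℕ} (z₀ : Fin (n + 1) → ℂ) (f₀ : (Fin (n + 1) → ℂ) → ℂ)
    (z : Fin (n + 1) → ℂ) (f : (Fin (n + 1) → ℂ) → ℂ) : Prop :=
  ∃ (p : unitInterval → Fin (n + 1) → ℂ) (F : unitInterval → (Fin (n + 1) → ℂ) → ℂ),
    Continuous p ∧ p 0 = z₀ ∧ p 1 = z ∧ (∀ t, Function.Injective (p t)) ∧
    (∀ t, AnalyticAt ℂ (F t) (p t)) ∧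
    (∀ t, ∀ᶠ s in 𝓝 t, F s =ᶠ[𝓝 (p s)] F t) ∧
    F 0 =ᶠ[𝓝 z₀] f₀ ∧ F 1 =ᶠ[𝓝 z] f

/-- `f` is, near `z`, a Lauricella function: an analytic continuation (possibly along a constant
path) of an integral of the Lauricella differential along a relative arc. -/
def IsLauricellaAt {n : ℕ} (μ : Fin (n + 1) → ℝ) (z : Fin (n + 1) → ℂ)
    (f : (Fin (n + 1) → ℂ) → ℂ) : Prop :=
  ∃ (z₀ : Fin (n + 1) → ℂ) (γ ψ : ℝ → ℂ) (f₀ : (Fin (n + 1) → ℂ) → ℂ),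
    IsArcIntegral μ z₀ γ ψ f₀ ∧ IsAnalyticContinuation z₀ f₀ z f

/-- The space `L_z`: the complex vector space of germs at `z` spanned by the germs of Lauricella
functions. -/
noncomputable def germSpace {n : ℕ} (μ : Fin (n + 1) → ℝ) (z : Fin (n + 1) → ℂ) :
    Submodule ℂ (Germ (𝓝 z) ℂ) :=
  Submodule.span ℂ {g | ∃ f : (Fin (n + 1) → ℂ) → ℂ, IsLauricellaAt μ z f ∧ (f : Germ (𝓝 z) ℂ) = g}

/-- `δ`, restricted to `[0, ∞)`, is an `L`-arc system for `z`: an embedded piecewise differentiable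
arc in the Riemann sphere from `z₀` to `∞` that passes successively through `z₁, …, zₙ`
(parametrized such that it passes `zₖ` at time `k`) and near `∞` follows the real axis in the
positive direction. -/
structure IsLArcSystem {n : ℕ} (z : Fin (n + 1) → ℂ) (δ : ℝ → ℂ) : Prop where
  piecewise : ∀ T : ℝ, PiecewiseC1On δ 0 T
  injOn : InjOn δ (Ici 0)
  passes : ∀ k : Fin (n + 1), δ ((k : ℕ) : ℝ) = z k
  real : ∀ᶠ t in atTop, (δ t).im = 0
  tendsto : Tendsto (fun t => (δ t).re) atTop atTop

/-- `E` is, on the complement of the support of `δ`, the determination of the Lauricella integrand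
that is the natural one (with principal arguments) on a left half plane. -/
def IsCutDetermination {n : ℕ} (μ : Fin (n + 1) → ℝ) (z : Fin (n + 1) → ℂ) (δ : ℝ → ℂ)
    (E : ℂ → ℂ) : Prop :=
  ∃ L : Fin (n + 1) → ℂ → ℂ,
    (∀ k, ContinuousOn (L k) (δ '' Ici 0)ᶜ) ∧
    (∀ k, ∀ ζ ∈ (δ '' Ici 0)ᶜ, Complex.exp (L k ζ) = z k - ζ) ∧
    (∃ R : ℝ, ∀ k, ∀ ζ : ℂ, ζ.re < R → L k ζ = Complex.log (z k - ζ)) ∧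
    (∀ ζ ∈ (δ '' Ici 0)ᶜ, E ζ = integrand μ (fun k => L k ζ))

/-- The `k`-th piece of `δ`, from `δ k` to `δ (k + 1)`, parametrized by `[0, 1]`. -/
def piece (δ : ℝ → ℂ) (k : ℕ) : ℝ → ℂ := fun t => δ (k + t)

/-- `ψ` is the determination of the Lauricella integrand along (the interior of) the `k`-th piece of
`δ` that extends the determination on the complement of `δ` continuously from the left: at every
point where `δ` is smooth with a nonzero velocity it is the limit from the left normal direction. -/
def IsLeftDetermination {n : ℕ} (μ : Fin (n + 1) → ℝ) (z : Fin (n + 1) → ℂ) (δ : ℝ → ℂ) (k : ℕ)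
    (ψ : ℝ → ℂ) : Prop :=
  (∃ ℓ : Fin (n + 1) → ℝ → ℂ,
    (∀ j, ContinuousOn (ℓ j) (Ioo 0 1)) ∧
    (∀ j, ∀ t ∈ Ioo (0 : ℝ) 1, Complex.exp (ℓ j t) = z j - piece δ k t) ∧
    (∀ t ∈ Ioo (0 : ℝ) 1, ψ t = integrand μ (fun j => ℓ j t))) ∧
  ∃ E : ℂ → ℂ, IsCutDetermination μ z δ E ∧
    ∀ t ∈ Ioo (0 : ℝ) 1, ContDiffAt ℝ 1 (piece δ k) t → deriv (piece δ k) t ≠ 0 →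
      Tendsto (fun ε : ℝ => E (piece δ k t + ε * (Complex.I * deriv (piece δ k) t)))
        (𝓝[>] 0) (𝓝 (ψ t))

/-- `f` is, near `z`, the Lauricella function given by the integral of the Lauricella differential
along the `k`-th piece of `δ` (from `zₖ` to `zₖ₊₁`), with the determination prescribed by `δ`. -/
def IsPieceIntegral {n : ℕ} (μ : Fin (n + 1) → ℝ) (z : Fin (n + 1) → ℂ) (δ : ℝ → ℂ) (k : ℕ)
    (f : (Fin (n + 1) → ℂ) → ℂ) : Prop :=
  ∃ ψ : ℝ → ℂ, IsLeftDetermination μ z δ k ψ ∧ IsArcIntegral μ z (piece δ k) ψ f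

end Lauricella

/-! The proof compares `germSpace μ z` with the germs of solutions of a system of linear
differential equations (`IsSolutionAt`): translation invariance, homogeneity of degree 1 - |μ|, and
the Euler-Poisson-Darboux equations (wᵢ - wⱼ) ∂ⱼ∂ᵢf = μⱼ ∂ᵢf - μᵢ ∂ⱼf.

Upper bound. The system expresses all second derivatives by first ones: the mixed ones directly, the
pure ones by differentiating the translation equation. By Grönwall along segments, a solution is
determined near z by its value and gradient at z (`IsSolutionAt.eventually_eq_zero`). These n + 2
numbers satisfy two independent linear relations, so germs of solutions form a space of dimension at
most n. To see that arc integrals solve the system, both ends of the arc are replaced by small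
circles weighted by 1/(κ - 1), where κ is the monodromy factor (`exists_regularization`). The
resulting paths do not depend on w and avoid the points zⱼ. Hence the integrals are analytic in w
and can be differentiated under the integral sign, and exact twisted differentials integrate to zero
(`isSolutionAt_chain`). The equations survive analytic continuation, so L_z consists of germs of
solutions for every μ.

Lower bound. Suppose ∑ cₖ fₖ vanishes near z, where the fₖ are the integrals over the pieces of an
embedded arc. Its value and gradient at z say that the functions 1 and 1/(zⱼ - ζ) have vanishing
integrals against ∑ cₖ η. Exactness of d(ζ^(m+1) η) then gives (m + 1 - |μ|) ∑ cₖ ∫ ζ^m η = 0 by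
induction on m, so all moments vanish unless |μ| is an integer ≥ 2 (`sum_integral_pow_eq_zero`).
After multiplication of η by ∏ (zⱼ - ζ) the densities are integrable up to the ends. The Cauchy
transform of the resulting measure vanishes near infinity, hence on the whole complement of the arc,
because an arc does not separate the plane (`isPreconnected_compl_arc`). Its jump across the k-th
piece is a nonzero multiple of cₖ at a smooth point, so cₖ = 0 (`linearIndependent_arcIntegrals`).
Thus n independent elements of L_z span all germs of solutions.

Existence of the piece integrals needs a continuous logarithm of δ(s) - ζ off the later part of δ,
obtained by homotopy lifting, whose limit from the left is computed in
`IsLArcSystem.tendsto_log_left`. It also needs a deformation of the arc that follows the branch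
points, given by Lagrange interpolation (`exists_isArcIntegral`).

For (ii), a nonzero constant satisfies the homogeneity equation exactly when |μ| = 1. In that case
the lower bound applies and L_z is the space of all germs of solutions, which contains the
constants. -/

namespace Lauricella

/-! ### Piecewise differentiable paths and exact twisted differentials -/

/-- The logarithmic coefficient `∑ⱼ μⱼ / (wⱼ - ζ)` of the Lauricella differential. -/
noncomputable def logCoeff {n : ℕ} (μ : Fin (n + 1) → ℝ) (w : Fin (n + 1) → ℂ) (ζ : ℂ) : ℂ :=
  ∑ j, (μ j : ℂ) / (w j - ζ)

/-- A path that is continuous on `[s, e]` (in either order), differentiable off a countable set, and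
has an integrable velocity. -/
structure RegularOn (γ : ℝ → ℂ) (s e : ℝ) : Prop where
  cont : ContinuousOn γ (uIcc s e)
  diff : ∃ S : Set ℝ, S.Countable ∧ ∀ t ∈ Ioo (min s e) (max s e) \ S, DifferentiableAt ℝ γ t
  int : IntervalIntegrable (deriv γ) MeasureTheory.volume s e

/-- Continuous logarithms of `wⱼ - γ` on `[s, e]`. -/
structure IsBranchOn {n : ℕ} (w : Fin (n + 1) → ℂ) (γ : ℝ → ℂ) (ℓ : Fin (n + 1) → ℝ → ℂ)
    (s e : ℝ) : Prop where
  cont : ∀ j, ContinuousOn (ℓ j) (uIcc s e)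
  exp : ∀ j, ∀ t ∈ uIcc s e, Complex.exp (ℓ j t) = w j - γ t

theorem exists_gap_right (s : Finset ℝ) {x b : ℝ} (h : x < b) :
    ∃ d, x < d ∧ d ≤ b ∧ ∀ y ∈ s, y ∉ Ioo x d := by
  have h1 : ∀ᶠ d in 𝓝[>] x, ∀ y ∈ s, y ∉ Ioo x d := by
    rw [Filter.eventually_all_finset]
    intro y _
    rcases le_or_gt y x with hy | hy
    · exact Eventually.of_forall fun d hd => absurd hd.1 (not_lt.2 hy)
    · filter_upwards [Ioo_mem_nhdsGT hy] with d hd hyd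
      exact absurd hyd.2 (not_lt.2 hd.2.le)
  obtain ⟨d, hd, hd'⟩ := (h1.and (Ioo_mem_nhdsGT h)).exists
  exact ⟨d, hd'.1, hd'.2.le, hd⟩

theorem exists_gap_left (s : Finset ℝ) {a x : ℝ} (h : a < x) :
    ∃ c, a ≤ c ∧ c < x ∧ ∀ y ∈ s, y ∉ Ioo c x := by
  have h1 : ∀ᶠ d in 𝓝[<] x, ∀ y ∈ s, y ∉ Ioo d x := by
    rw [Filter.eventually_all_finset]
    intro y _
    rcases le_or_gt x y with hy | hy
    · exact Eventually.of_forall fun d hd => absurd hd.2 (not_lt.2 hy)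
    · filter_upwards [Ioo_mem_nhdsLT hy] with d hd hyd
      exact absurd hyd.1 (not_lt.2 hd.1.le)
  obtain ⟨d, hd, hd'⟩ := (h1.and (Ioo_mem_nhdsLT h)).exists
  exact ⟨d, hd'.1.le, hd'.2, hd⟩

theorem integrableOn_deriv_of_contDiffOn {γ : ℝ → ℂ} {c d : ℝ} (hcd : c < d)
    (h : ContDiffOn ℝ 1 γ (Icc c d)) : MeasureTheory.IntegrableOn (deriv γ) (Icc c d) := by
  rw [integrableOn_Icc_iff_integrableOn_Ioo]
  have h1 : ContinuousOn (derivWithin γ (Icc c d)) (Icc c d) :=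
    h.continuousOn_derivWithin (uniqueDiffOn_Icc hcd) le_rfl
  refine (h1.integrableOn_Icc.mono_set Ioo_subset_Icc_self).congr_fun (fun x hx => ?_)
    measurableSet_Ioo
  exact derivWithin_of_mem_nhds (Icc_mem_nhds hx.1 hx.2)

theorem PiecewiseC1On.mono {γ : ℝ → ℂ} {a b a' b' : ℝ} (h : PiecewiseC1On γ a b) (ha : a ≤ a')
    (hb : b' ≤ b) : PiecewiseC1On γ a' b' := by
  obtain ⟨s, hs⟩ := h
  exact ⟨s, fun c d hc hcd hd => hs c d (ha.trans hc) hcd (hd.trans hb)⟩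

theorem PiecewiseC1On.continuousOn {γ : ℝ → ℂ} {a b : ℝ} (h : PiecewiseC1On γ a b) (hab : a < b) :
    ContinuousOn γ (Icc a b) := by
  obtain ⟨s, hs⟩ := h
  intro x hx
  have hr : ContinuousWithinAt γ (Icc a b ∩ Ici x) x := by
    rcases hx.2.eq_or_lt with rfl | hxb
    · refine continuousWithinAt_singleton.mono fun y hy => ?_
      exact le_antisymm hy.1.2 hy.2
    · obtain ⟨d, hd1, hd2, hd3⟩ := exists_gap_right s hxb
      have h1 := (hs x d hx.1 hd1 hd2 hd3).continuousOn x (left_mem_Icc.2 hd1.le)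
      refine h1.mono_of_mem_nhdsWithin ?_
      exact mem_of_superset (nhdsWithin_mono x inter_subset_right (Icc_mem_nhdsGE hd1)) subset_rfl
  have hl : ContinuousWithinAt γ (Icc a b ∩ Iic x) x := by
    rcases hx.1.eq_or_lt with rfl | hxb
    · refine continuousWithinAt_singleton.mono fun y hy => ?_
      exact le_antisymm hy.2 hy.1.1
    · obtain ⟨d, hd1, hd2, hd3⟩ := exists_gap_left s hxb
      have h1 := (hs d x hd1 hd2 hx.2 hd3).continuousOn x (right_mem_Icc.2 hd2.le)
      refine h1.mono_of_mem_nhdsWithin ?_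
      exact mem_of_superset (nhdsWithin_mono x inter_subset_right (Icc_mem_nhdsLE hd2)) subset_rfl
  refine (hl.union hr).mono fun y hy => ?_
  rcases le_total y x with h | h
  · exact Or.inl ⟨hy, h⟩
  · exact Or.inr ⟨hy, h⟩

theorem PiecewiseC1On.contDiffAt {γ : ℝ → ℂ} {a b : ℝ} (h : PiecewiseC1On γ a b) :
    ∃ s : Finset ℝ, ∀ t ∈ Ioo a b, t ∉ s → ContDiffAt ℝ 1 γ t := by
  obtain ⟨s, hs⟩ := h
  refine ⟨s, fun t ht hts => ?_⟩
  obtain ⟨c, hc1, hc2, hc3⟩ := exists_gap_left s ht.1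
  obtain ⟨d, hd1, hd2, hd3⟩ := exists_gap_right s ht.2
  refine (hs c d hc1 (hc2.trans hd1) hd2 fun y hy hyI => ?_).contDiffAt (Icc_mem_nhds hc2 hd1)
  rcases lt_trichotomy y t with h | h | h
  · exact hc3 y hy ⟨hyI.1, h⟩
  · exact hts (h ▸ hy)
  · exact hd3 y hy ⟨h, hyI.2⟩

theorem PiecewiseC1On.integrableOn_deriv {γ : ℝ → ℂ} {a b : ℝ} (h : PiecewiseC1On γ a b) :
    MeasureTheory.IntegrableOn (deriv γ) (Icc a b) := by
  obtain ⟨s, hs⟩ := h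
  refine MeasureTheory.LocallyIntegrableOn.integrableOn_isCompact (fun x hx => ?_) isCompact_Icc
  have hr : ∃ U ∈ 𝓝[Icc a b ∩ Ici x] x, MeasureTheory.IntegrableOn (deriv γ) U := by
    rcases hx.2.eq_or_lt with rfl | hxb
    · refine ⟨{x}, mem_of_superset self_mem_nhdsWithin fun y hy => le_antisymm hy.1.2 hy.2, ?_⟩
      simp
    · obtain ⟨d, hd1, hd2, hd3⟩ := exists_gap_right s hxb
      exact ⟨Icc x d, nhdsWithin_mono x inter_subset_right (Icc_mem_nhdsGE hd1),
        integrableOn_deriv_of_contDiffOn hd1 (hs x d hx.1 hd1 hd2 hd3)⟩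
  have hl : ∃ U ∈ 𝓝[Icc a b ∩ Iic x] x, MeasureTheory.IntegrableOn (deriv γ) U := by
    rcases hx.1.eq_or_lt with rfl | hxb
    · refine ⟨{a}, mem_of_superset self_mem_nhdsWithin fun y hy => le_antisymm hy.2 hy.1.1, ?_⟩
      simp
    · obtain ⟨d, hd1, hd2, hd3⟩ := exists_gap_left s hxb
      exact ⟨Icc d x, nhdsWithin_mono x inter_subset_right (Icc_mem_nhdsLE hd2),
        integrableOn_deriv_of_contDiffOn hd2 (hs d x hd1 hd2 hx.2 hd3)⟩
  obtain ⟨U, hU, hU'⟩ := hr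
  obtain ⟨V, hV, hV'⟩ := hl
  refine ⟨V ∪ U, ?_, hV'.union hU'⟩
  have h1 := union_mem_sup hV hU
  rw [← nhdsWithin_union, ← inter_union_distrib_left, Iic_union_Ici, inter_univ] at h1
  exact h1

theorem PiecewiseC1On.regularOn {γ : ℝ → ℂ} {a b s e : ℝ} (h : PiecewiseC1On γ a b)
    (hs : s ∈ Icc a b) (he : e ∈ Icc a b) : RegularOn γ s e := by
  have hsub : uIcc s e ⊆ Icc a b := uIcc_subset_Icc hs he
  refine ⟨?_, ?_, ?_⟩
  · rcases (hs.1.trans hs.2).eq_or_lt with rfl | hab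
    · refine (continuousOn_singleton γ a).mono (hsub.trans ?_)
      simp
    · exact (h.continuousOn hab).mono hsub
  · obtain ⟨S, hS⟩ := h.contDiffAt
    refine ⟨S, S.countable_toSet, fun t ht => (hS t ?_ ht.2).differentiableAt one_ne_zero⟩
    exact ⟨(le_min hs.1 he.1).trans_lt ht.1.1, ht.1.2.trans_le (max_le hs.2 he.2)⟩
  · rw [intervalIntegrable_iff']
    exact h.integrableOn_deriv.mono_set hsub

/-- By continuity ℓ stays within distance 1 of ℓ(t), so near t it is ℓ(t) plus the principal
logarithm of g/g(t), whose argument is near 1. -/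
theorem hasDerivAt_of_exp_eq {ℓ g : ℝ → ℂ} {t : ℝ} {g' : ℂ} (hc : ContinuousAt ℓ t)
    (he : ∀ᶠ s in 𝓝 t, Complex.exp (ℓ s) = g s) (hg : HasDerivAt g g' t) :
    HasDerivAt ℓ (g' / g t) t := by
  have h0 : g t ≠ 0 := by rw [← he.self_of_nhds]; exact Complex.exp_ne_zero _
  have h1 : ∀ᶠ s in 𝓝 t, ‖ℓ s - ℓ t‖ < 1 := by
    have : Tendsto (fun s => ‖ℓ s - ℓ t‖) (𝓝 t) (𝓝 0) := by
      have := (hc.sub (continuousAt_const (y := ℓ t))).norm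
      simpa [ContinuousAt] using this
    exact this.eventually (gt_mem_nhds one_pos)
  have h2 : ℓ =ᶠ[𝓝 t] fun s => ℓ t + Complex.log (g s / g t) := by
    filter_upwards [h1, he] with s hs1 hs2
    rw [← hs2, ← he.self_of_nhds, ← Complex.exp_sub, Complex.log_exp]
    · ring
    · have := (Complex.abs_im_le_norm (ℓ s - ℓ t)).trans_lt hs1
      have := (abs_lt.1 this).1
      linarith [Real.pi_gt_three]
    · have := (Complex.abs_im_le_norm (ℓ s - ℓ t)).trans_lt hs1
      have := (abs_lt.1 this).2
      linarith [Real.pi_gt_three]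
  refine HasDerivAt.congr_of_eventuallyEq ?_ h2
  have h3 : HasDerivAt (fun s => g s / g t) (g' / g t) t := hg.div_const _
  have h4 := h3.clog_real (by rw [div_self h0]; exact Complex.one_mem_slitPlane)
  rw [div_self h0, div_one] at h4
  exact h4.const_add _

/-- The identity d(Gη) = (G' + G · `logCoeff`) η, with η standing for the multivalued factor. All
exact differentials used below have this form, with G single valued. -/
theorem hasDerivAt_integrand_mul {n : ℕ} {μ : Fin (n + 1) → ℝ} {w : Fin (n + 1) → ℂ}
    {γ : ℝ → ℂ} {ℓ : Fin (n + 1) → ℝ → ℂ} {t : ℝ} {γ' : ℂ} {G : ℂ → ℂ}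
    (hc : ∀ j, ContinuousAt (ℓ j) t)
    (he : ∀ j, ∀ᶠ s in 𝓝 t, Complex.exp (ℓ j s) = w j - γ s)
    (hγ : HasDerivAt γ γ' t) (hG : AnalyticAt ℂ G (γ t)) :
    HasDerivAt (fun s => integrand μ (fun j => ℓ j s) * G (γ s))
      (integrand μ (fun j => ℓ j t) *
        (deriv G (γ t) + G (γ t) * logCoeff μ w (γ t)) * γ') t := by
  have h1 : ∀ j, HasDerivAt (ℓ j) (-γ' / (w j - γ t)) t := fun j =>
    hasDerivAt_of_exp_eq (g := fun s => w j - γ s) (hc j) (he j) (hγ.const_sub (w j))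
  have h2 : HasDerivAt (fun s => integrand μ (fun j => ℓ j s))
      (integrand μ (fun j => ℓ j t) * (logCoeff μ w (γ t) * γ')) t := by
    have h3 : HasDerivAt (fun s => -∑ j, (μ j : ℂ) * ℓ j s)
        (-∑ j, (μ j : ℂ) * (-γ' / (w j - γ t))) t := by
      refine HasDerivAt.fun_neg (HasDerivAt.fun_sum fun j _ => ?_)
      exact (h1 j).const_mul (μ j : ℂ)
    have h4 : logCoeff μ w (γ t) * γ' = -∑ j, (μ j : ℂ) * (-γ' / (w j - γ t)) := by
      rw [logCoeff, Finset.sum_mul, ← Finset.sum_neg_distrib]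
      exact Finset.sum_congr rfl fun j _ => by ring
    rw [h4]
    simp only [integrand]
    exact h3.cexp
  have h3 : HasDerivAt (fun s => G (γ s)) (deriv G (γ t) * γ') t :=
    hG.differentiableAt.hasDerivAt.comp t hγ
  exact (h2.fun_mul h3).congr_deriv (by ring)

theorem IsBranchOn.continuousOn_integrand {n : ℕ} {μ : Fin (n + 1) → ℝ} {w : Fin (n + 1) → ℂ}
    {γ : ℝ → ℂ} {ℓ : Fin (n + 1) → ℝ → ℂ} {s e : ℝ} (h : IsBranchOn w γ ℓ s e) :
    ContinuousOn (fun t => integrand μ (fun j => ℓ j t)) (uIcc s e) := by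
  unfold integrand
  have := h.cont
  fun_prop

theorem IsBranchOn.ne {n : ℕ} {w : Fin (n + 1) → ℂ}
    {γ : ℝ → ℂ} {ℓ : Fin (n + 1) → ℝ → ℂ} {s e : ℝ} (h : IsBranchOn w γ ℓ s e) {t : ℝ}
    (ht : t ∈ uIcc s e) (j : Fin (n + 1)) : w j - γ t ≠ 0 := by
  rw [← h.exp j t ht]; exact Complex.exp_ne_zero _

theorem analyticAt_logCoeff {n : ℕ} {μ : Fin (n + 1) → ℝ} {w : Fin (n + 1) → ℂ} {u : ℂ}
    (hu : ∀ j, w j - u ≠ 0) : AnalyticAt ℂ (logCoeff μ w) u := by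
  unfold logCoeff
  refine Finset.analyticAt_fun_sum _ fun j _ => ?_
  exact analyticAt_const.div (analyticAt_const.sub analyticAt_id) (hu j)

/-- The integral of an exact twisted differential along a path. -/
theorem integral_integrand_mul_exact {n : ℕ} {μ : Fin (n + 1) → ℝ} {w : Fin (n + 1) → ℂ}
    {γ : ℝ → ℂ} {ℓ : Fin (n + 1) → ℝ → ℂ} {s e : ℝ} {G : ℂ → ℂ}
    (hγ : RegularOn γ s e) (hℓ : IsBranchOn w γ ℓ s e)
    (hG : ∀ t ∈ uIcc s e, AnalyticAt ℂ G (γ t)) :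
    ∫ t in s..e, integrand μ (fun j => ℓ j t) *
        (deriv G (γ t) + G (γ t) * logCoeff μ w (γ t)) * deriv γ t =
      integrand μ (fun j => ℓ j e) * G (γ e) - integrand μ (fun j => ℓ j s) * G (γ s) := by
  obtain ⟨S, hS, hd⟩ := hγ.diff
  have hγG : ∀ (F : ℂ → ℂ), (∀ t ∈ uIcc s e, AnalyticAt ℂ F (γ t)) →
      ContinuousOn (fun t => F (γ t)) (uIcc s e) := fun F hF t ht =>
    (hF t ht).continuousAt.comp_continuousWithinAt (hγ.cont t ht)
  refine MeasureTheory.integral_eq_of_hasDerivAt_off_countable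
    (fun t => integrand μ (fun j => ℓ j t) * G (γ t)) _ hS ?_ ?_ ?_
  · exact hℓ.continuousOn_integrand.mul (hγG G hG)
  · intro t ht
    have hm : uIcc s e ∈ 𝓝 t := Icc_mem_nhds ht.1.1 ht.1.2
    exact hasDerivAt_integrand_mul (fun j => (hℓ.cont j).continuousAt hm)
      (fun j => by filter_upwards [hm] with r hr using hℓ.exp j r hr)
      (hd t ht).hasDerivAt (hG t (mem_of_mem_nhds hm))
  · refine hγ.int.continuousOn_mul (ContinuousOn.mul hℓ.continuousOn_integrand ?_)
    refine ContinuousOn.add ?_ ?_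
    · exact hγG _ fun t ht => (hG t ht).deriv
    · exact (hγG G hG).mul (hγG _ fun t ht => analyticAt_logCoeff (hℓ.ne ht))

/-! ### Primitives at the singular ends -/

/-- The Fuchsian equation `(u - c) k' + ν k = f` has an analytic solution. -/
theorem exists_fuchs_solution {f : ℂ → ℂ} {c : ℂ} {R ν : ℝ} (hν : 0 < ν)
    (hf : AnalyticOnNhd ℂ f (Metric.ball c R)) :
    ∃ k : ℂ → ℂ, AnalyticOnNhd ℂ k (Metric.ball c R) ∧
      ∀ u ∈ Metric.ball c R, (u - c) * deriv k u + ν * k u = f u := by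
  -- The solution by the integrating factor (u - c)^ν, rescaled to the segment from c to u. It has
  -- no monodromy, and the integral converges because ν > 0.
  set k : ℂ → ℂ := fun u => ∫ s in (0 : ℝ)..1, ((s ^ (ν - 1) : ℝ) : ℂ) * f (c + s * (u - c)) with hk
  have hmem : ∀ u ∈ Metric.ball c R, ∀ s ∈ Icc (0 : ℝ) 1, c + s * (u - c) ∈ Metric.ball c R := by
    intro u hu s hs
    rw [mem_ball_iff_norm] at hu ⊢
    rw [add_sub_cancel_left, norm_mul, Complex.norm_real, Real.norm_of_nonneg hs.1]
    exact (mul_le_of_le_one_left (norm_nonneg _) hs.2).trans_lt hu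
  have hrint : IntervalIntegrable (fun s : ℝ => ((s ^ (ν - 1) : ℝ) : ℂ)) MeasureTheory.volume 0 1 :=
    have h := intervalIntegral.intervalIntegrable_rpow' (a := 0) (b := 1)
      (show -1 < ν - 1 by linarith)
    ⟨h.1.ofReal, h.2.ofReal⟩
  have hcont : ∀ F : ℂ → ℂ, AnalyticOnNhd ℂ F (Metric.ball c R) → ∀ u ∈ Metric.ball c R,
      ContinuousOn (fun s : ℝ => F (c + s * (u - c))) (uIcc 0 1) := by
    intro F hF u hu
    rw [uIcc_of_le zero_le_one]
    refine hF.continuousOn.comp (by fun_prop) fun s hs => hmem u hu s hs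
  have hderiv : ∀ u ∈ Metric.ball c R, HasDerivAt k
      (∫ s in (0 : ℝ)..1, ((s ^ (ν - 1) : ℝ) : ℂ) * (deriv f (c + s * (u - c)) * s)) u := by
    intro u hu
    obtain ⟨r, hr1, hr2⟩ := exists_between (Metric.mem_ball.1 hu)
    have hrsub : Metric.closedBall c r ⊆ Metric.ball c R := Metric.closedBall_subset_ball hr2
    obtain ⟨M, hM⟩ := (isCompact_closedBall c r).exists_bound_of_continuousOn
      (hf.deriv.continuousOn.mono hrsub)
    have hnhds : Metric.ball c r ∈ 𝓝 u := Metric.isOpen_ball.mem_nhds hr1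
    refine (intervalIntegral.hasDerivAt_integral_of_dominated_loc_of_deriv_le
      (F := fun (x : ℂ) (s : ℝ) => ((s ^ (ν - 1) : ℝ) : ℂ) * f (c + s * (x - c)))
      (F' := fun (x : ℂ) (s : ℝ) => ((s ^ (ν - 1) : ℝ) : ℂ) * (deriv f (c + s * (x - c)) * s))
      (bound := fun s => ‖((s ^ (ν - 1) : ℝ) : ℂ)‖ * M) hnhds ?_ ?_ ?_ ?_ ?_ ?_).2
    · filter_upwards [hnhds] with x hx
      exact (hrint.mul_continuousOn (hcont f hf x (Metric.ball_subset_ball hr2.le hx))).def'.1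
    · exact hrint.mul_continuousOn (hcont f hf u hu)
    · refine (hrint.mul_continuousOn ((hcont _ hf.deriv u hu).mul ?_)).def'.1
      fun_prop
    · refine MeasureTheory.ae_of_all _ fun s hs x hx => ?_
      rw [uIoc_of_le zero_le_one] at hs
      rw [norm_mul, norm_mul]
      have h1 : c + s * (x - c) ∈ Metric.closedBall c r := by
        rw [mem_closedBall_iff_norm, add_sub_cancel_left, norm_mul, Complex.norm_real,
          Real.norm_of_nonneg hs.1.le]
        exact (mul_le_of_le_one_left (norm_nonneg _) hs.2).trans (mem_ball_iff_norm.1 hx).le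
      have h2 : ‖(s : ℂ)‖ ≤ 1 := by
        rw [Complex.norm_real, Real.norm_of_nonneg hs.1.le]; exact hs.2
      exact mul_le_mul_of_nonneg_left ((mul_le_of_le_one_right (norm_nonneg _) h2).trans (hM _ h1))
        (norm_nonneg _)
    · exact hrint.norm.mul_const M
    · refine MeasureTheory.ae_of_all _ fun s hs x hx => ?_
      rw [uIoc_of_le zero_le_one] at hs
      have h1 := (hf _ (hmem x (Metric.ball_subset_ball hr2.le hx) s
        ⟨hs.1.le, hs.2⟩)).differentiableAt.hasDerivAt
      have h2 : HasDerivAt (fun x : ℂ => c + s * (x - c)) s x := by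
        simpa using (((hasDerivAt_id x).sub_const c).const_mul (s : ℂ)).const_add c
      exact (h1.comp x h2).const_mul _
  refine ⟨k, ?_, fun u hu => ?_⟩
  · refine DifferentiableOn.analyticOnNhd (fun u hu => ?_) Metric.isOpen_ball
    exact (hderiv u hu).differentiableAt.differentiableWithinAt
  rw [(hderiv u hu).deriv, hk, ← intervalIntegral.integral_const_mul,
    ← intervalIntegral.integral_const_mul, ← intervalIntegral.integral_add]
  -- The combination (u - c) k' + ν k is the integral of the derivative of s^ν f(c + s(u - c)), and
  -- the lower boundary term vanishes since ν > 0.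
  · have h1 : ∀ s ∈ Ioo (0 : ℝ) 1, HasDerivAt (fun s : ℝ => ((s ^ ν : ℝ) : ℂ) * f (c + s * (u - c)))
        ((u - c) * (((s ^ (ν - 1) : ℝ) : ℂ) * (deriv f (c + s * (u - c)) * s)) +
          ν * (((s ^ (ν - 1) : ℝ) : ℂ) * f (c + s * (u - c)))) s := by
      intro s hs
      have h2 : HasDerivAt (fun s : ℝ => ((s ^ ν : ℝ) : ℂ)) ((ν * s ^ (ν - 1) : ℝ) : ℂ) s :=
        (Real.hasDerivAt_rpow_const (Or.inl hs.1.ne')).ofReal_comp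
      have h3 : HasDerivAt (fun s : ℝ => c + s * (u - c)) (u - c) s := by
        simpa using ((Complex.ofRealCLM.hasDerivAt (x := s)).mul_const (u - c)).const_add c
      have h4 := (hf _ (hmem u hu s ⟨hs.1.le, hs.2.le⟩)).differentiableAt.hasDerivAt.comp s h3
      refine (h2.fun_mul h4).congr_deriv ?_
      have h5 : s ^ ν = s ^ (ν - 1) * s := by
        rw [← Real.rpow_add_one hs.1.ne']; congr 1; ring
      rw [h5]
      push_cast
      simp only [Function.comp]
      ring
    have h6 : ContinuousOn (fun s : ℝ => ((s ^ ν : ℝ) : ℂ) * f (c + s * (u - c))) (Icc 0 1) := by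
      have := hcont f hf u hu
      rw [uIcc_of_le zero_le_one] at this
      refine ContinuousOn.mul ?_ this
      exact Complex.continuous_ofReal.comp_continuousOn
        ((Real.continuous_rpow_const hν.le).continuousOn)
    rw [intervalIntegral.integral_eq_sub_of_hasDerivAt_of_le zero_le_one h6 h1]
    · simp [Real.zero_rpow hν.ne']
    · refine IntervalIntegrable.add (IntervalIntegrable.const_mul ?_ _)
        (IntervalIntegrable.const_mul ?_ _)
      · refine hrint.mul_continuousOn ((hcont _ hf.deriv u hu).mul ?_)
        fun_prop
      · exact hrint.mul_continuousOn (hcont f hf u hu)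
  · refine (hrint.mul_continuousOn ((hcont _ hf.deriv u hu).mul ?_)).const_mul _
    fun_prop
  · exact (hrint.mul_continuousOn (hcont f hf u hu)).const_mul _

theorem div_mem_slitPlane_of_dist_lt {a b : ℂ} (h : ‖a - b‖ < ‖b‖) : a / b ∈ Complex.slitPlane := by
  have hb : b ≠ 0 := by
    rintro rfl; simp at h; exact absurd h (not_lt.2 (norm_nonneg _))
  have h1 : a / b = 1 + (a - b) / b := by field_simp; ring
  rw [h1]
  refine Complex.mem_slitPlane_of_norm_lt_one ?_
  rw [norm_div]
  exact (div_lt_one (norm_pos_iff.2 hb)).2 h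

/-- A local primitive, vanishing at the singular point, of an analytic multiple of the Lauricella
differential. -/
theorem exists_end_primitive {n : ℕ} {μ : Fin (n + 1) → ℝ} {w : Fin (n + 1) → ℂ} (a : Fin (n + 1))
    (hμ : μ a < 1) {R : ℝ} (hR : ∀ j, j ≠ a → R ≤ ‖w j - w a‖)
    {g : ℂ → ℂ} (hg : AnalyticOnNhd ℂ g (Metric.ball (w a) R)) :
    ∃ G : ℂ → ℂ, AnalyticOnNhd ℂ G (Metric.ball (w a) R) ∧ G (w a) = 0 ∧
      ∀ u ∈ Metric.ball (w a) R, u ≠ w a → deriv G u + G u * logCoeff μ w u = g u := by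
  classical
  -- Up to a constant, the integrand is (wₐ - u)^(-μₐ) exp(-Λ), with Λ analytic on the ball. The
  -- ansatz G = (u - wₐ) k exp(Λ) turns the required equation into (u - wₐ) k' + (1 - μₐ) k =
  -- exp(-Λ) g, which is Fuchsian with ν = 1 - μₐ > 0.
  set Λ : ℂ → ℂ := fun u => ∑ j ∈ Finset.univ.erase a,
    (μ j : ℂ) * Complex.log ((w j - u) / (w j - w a)) with hΛ
  have hslit : ∀ u ∈ Metric.ball (w a) R, ∀ j, j ≠ a →
      (w j - u) / (w j - w a) ∈ Complex.slitPlane := by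
    intro u hu j hj
    refine div_mem_slitPlane_of_dist_lt ?_
    rw [sub_sub_sub_cancel_left, norm_sub_rev]
    exact (mem_ball_iff_norm.1 hu).trans_le (hR j hj)
  have hΛd : ∀ u ∈ Metric.ball (w a) R, HasDerivAt Λ
      (-∑ j ∈ Finset.univ.erase a, (μ j : ℂ) / (w j - u)) u := by
    intro u hu
    rw [← Finset.sum_neg_distrib]
    refine HasDerivAt.fun_sum fun j hj => ?_
    have hj' := Finset.ne_of_mem_erase hj
    have h1 := hslit u hu j hj'
    have h2 : HasDerivAt (fun u => (w j - u) / (w j - w a)) (-1 / (w j - w a)) u :=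
      ((hasDerivAt_id u).const_sub (w j)).div_const _
    refine ((h2.clog h1).const_mul (μ j : ℂ)).congr_deriv ?_
    have h3 := Complex.slitPlane_ne_zero h1
    have h4 : w j - u ≠ 0 := fun h => h3 (by rw [h, zero_div])
    have h5 : w j - w a ≠ 0 := fun h => h3 (by rw [h, div_zero])
    field_simp
  have hΛa : AnalyticOnNhd ℂ Λ (Metric.ball (w a) R) :=
    DifferentiableOn.analyticOnNhd
      (fun u hu => (hΛd u hu).differentiableAt.differentiableWithinAt) Metric.isOpen_ball
  obtain ⟨k, hk, hkf⟩ := exists_fuchs_solution (ν := 1 - μ a) (by linarith)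
    (hΛa.neg.cexp.mul hg)
  refine ⟨fun u => (u - w a) * (k u * Complex.exp (Λ u)), ?_, by simp, fun u hu hne => ?_⟩
  · exact (analyticOnNhd_id.sub analyticOnNhd_const).mul (hk.mul hΛa.cexp)
  · have h1 : HasDerivAt (fun u => (u - w a) * (k u * Complex.exp (Λ u)))
      (1 * (k u * Complex.exp (Λ u)) + (u - w a) * (deriv k u * Complex.exp (Λ u) +
        k u * (Complex.exp (Λ u) * -∑ j ∈ Finset.univ.erase a, (μ j : ℂ) / (w j - u)))) u :=
      ((hasDerivAt_id u).sub_const (w a)).fun_mul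
        ((hk u hu).differentiableAt.hasDerivAt.fun_mul (hΛd u hu).cexp)
    rw [h1.deriv, logCoeff, ← Finset.add_sum_erase _ _ (Finset.mem_univ a)]
    have h2 := hkf u hu
    have h3 : w a - u ≠ 0 := sub_ne_zero.2 hne.symm
    have h4 : (u - w a) * (μ a / (w a - u)) = -μ a := by field_simp; ring
    have h5 : Complex.exp (-Λ u) * Complex.exp (Λ u) = 1 := by
      rw [← Complex.exp_add]; simp
    simp only [Pi.neg_apply] at h2
    push_cast at h2
    linear_combination (Complex.exp (Λ u)) * h2 + (k u * Complex.exp (Λ u)) * h4 + g u * h5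

/-! ### Transport of the integrand and comparison of branches -/

/-- The principal value near `w = z` of the quotient of the Lauricella integrands of `w` and `z`. -/
noncomputable def transport {n : ℕ} (μ : Fin (n + 1) → ℝ) (z w : Fin (n + 1) → ℂ) (u : ℂ) : ℂ :=
  integrand μ fun j => Complex.log ((w j - u) / (z j - u))

/-- A path `c` on `[a, b]` with a density `ρ`. -/
structure TwistedPath where
  a : ℝ
  b : ℝ
  c : ℝ → ℂ
  ρ : ℝ → ℂ

/-- The integral of a function over a twisted path. -/
noncomputable def TwistedPath.integral (P : TwistedPath) (g : ℂ → ℂ) : ℂ :=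
  ∫ t in P.a..P.b, P.ρ t * g (P.c t)

/-- The path is continuous, has an integrable density, and avoids the points `zⱼ`. -/
structure TwistedPath.Avoids {n : ℕ} (P : TwistedPath) (z : Fin (n + 1) → ℂ) : Prop where
  le : P.a ≤ P.b
  cont : ContinuousOn P.c (uIcc P.a P.b)
  int : IntervalIntegrable P.ρ MeasureTheory.volume P.a P.b
  ne : ∀ j, ∀ t ∈ uIcc P.a P.b, z j - P.c t ≠ 0

theorem integrand_add {n : ℕ} (μ : Fin (n + 1) → ℝ) (ℓ ℓ' : Fin (n + 1) → ℂ) :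
    integrand μ (fun j => ℓ j + ℓ' j) = integrand μ ℓ * integrand μ ℓ' := by
  rw [integrand, integrand, integrand, ← Complex.exp_add, ← neg_add, ← Finset.sum_add_distrib]
  simp only [mul_add]

theorem integrand_ne_zero {n : ℕ} (μ : Fin (n + 1) → ℝ) (ℓ : Fin (n + 1) → ℂ) :
    integrand μ ℓ ≠ 0 := Complex.exp_ne_zero _

theorem norm_integrand {n : ℕ} (μ : Fin (n + 1) → ℝ) {ℓ x : Fin (n + 1) → ℂ}
    (h : ∀ j, Complex.exp (ℓ j) = x j) : ‖integrand μ ℓ‖ = ∏ j, ‖x j‖ ^ (-μ j) := by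
  rw [integrand, Complex.norm_exp, Complex.neg_re, Complex.re_sum, ← Finset.sum_neg_distrib,
    Real.exp_sum]
  refine Finset.prod_congr rfl fun j _ => ?_
  rw [← h j, Complex.norm_exp, ← Real.exp_mul, Complex.re_ofReal_mul]
  ring_nf

theorem transport_self {n : ℕ} (μ : Fin (n + 1) → ℝ) {z : Fin (n + 1) → ℂ} {u : ℂ}
    (h : ∀ j, z j - u ≠ 0) : transport μ z z u = 1 := by
  simp [transport, integrand, div_self (h _)]

theorem eq_of_exp_eq_of_abs_im_lt {x y : ℂ} (h : Complex.exp x = Complex.exp y)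
    (hi : |(x - y).im| < 2 * Real.pi) : x = y := by
  obtain ⟨k, hk⟩ := Complex.exp_eq_exp_iff_exists_int.1 h
  have h1 : (x - y).im = k * (2 * Real.pi) := by
    rw [hk]; simp
  rw [h1, abs_mul, abs_of_pos Real.two_pi_pos] at hi
  have h2 : |(k : ℝ)| < 1 := by
    by_contra h3
    rw [not_lt] at h3
    nlinarith [Real.two_pi_pos]
  have h3 : k = 0 := by
    have : |k| < 1 := by exact_mod_cast h2
    exact Int.abs_lt_one_iff.1 this
  rw [hk, h3]; simp

/-- If `a` is closer to `b` than `b` is to the origin, then the argument of `a / b` is less than a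
right angle. -/
theorem abs_im_log_div_lt {a b : ℂ} (h : ‖a - b‖ < ‖b‖) :
    |(Complex.log (a / b)).im| < Real.pi / 2 := by
  have hb : b ≠ 0 := by
    rintro rfl; simp at h; exact absurd h (not_lt.2 (norm_nonneg _))
  rw [Complex.log_im, Complex.abs_arg_lt_pi_div_two_iff]
  left
  have h1 : ‖a / b - 1‖ < 1 := by
    rw [div_sub_one hb, norm_div]
    exact (div_lt_one (norm_pos_iff.2 hb)).2 h
  have h2 := (Complex.abs_re_le_norm (a / b - 1)).trans_lt h1
  rw [Complex.sub_re, Complex.one_re] at h2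
  linarith [(abs_lt.1 h2).1]

theorem ne_zero_of_dist_lt {a b : ℂ} (h : ‖a - b‖ < ‖b‖) : a ≠ 0 ∧ b ≠ 0 := by
  constructor
  · rintro rfl; simp at h
  · rintro rfl; simp at h; exact absurd h (not_lt.2 (norm_nonneg _))

/-- The principal logarithm has imaginary part below π/2 and the two given logarithms differ by less
than 1, so the two sides differ by less than 2π. This identifies a nearby branch with the
transported one. -/
theorem eq_add_log_div {x y ξ η : ℂ} (hξ : Complex.exp ξ = x) (hη : Complex.exp η = y)
    (hd : ‖y - x‖ < ‖x‖) (h : ‖η - ξ‖ < 1) : η = ξ + Complex.log (y / x) := by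
  obtain ⟨b1, b2⟩ := ne_zero_of_dist_lt hd
  refine eq_of_exp_eq_of_abs_im_lt ?_ ?_
  · rw [Complex.exp_add, Complex.exp_log (div_ne_zero b1 b2), hξ, hη]
    field_simp
  · have c1 := abs_im_log_div_lt hd
    have c3 := (Complex.abs_im_le_norm (η - ξ)).trans_lt h
    have c4 := Real.pi_gt_three
    simp only [Complex.sub_im, Complex.add_im] at c3 ⊢
    rw [abs_lt] at c1 c3 ⊢
    constructor <;> linarith

/-- The zero of G at wₐ improves the singularity |wₐ - γ|^(-μₐ) to |wₐ - γ|^(1 - μₐ), with positive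
exponent; the other factors stay bounded as wₐ is approached. -/
theorem tendsto_integrand_mul_zero {n : ℕ} {μ : Fin (n + 1) → ℝ} {w : Fin (n + 1) → ℂ}
    (hw : Function.Injective w) {a : Fin (n + 1)} (hμ : μ a < 1) {γ : ℝ → ℂ}
    {ℓ : Fin (n + 1) → ℝ → ℂ} {l : Filter ℝ} (hγ : Tendsto γ l (𝓝 (w a)))
    (hexp : ∀ j, ∀ᶠ t in l, Complex.exp (ℓ j t) = w j - γ t) {G : ℂ → ℂ}
    (hG : DifferentiableAt ℂ G (w a)) (h0 : G (w a) = 0) :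
    Tendsto (fun t => integrand μ (fun j => ℓ j t) * G (γ t)) l (𝓝 0) := by
  classical
  have hds : Tendsto (fun t => dslope G (w a) (γ t)) l (𝓝 (dslope G (w a) (w a))) :=
    (continuousAt_dslope_same.2 hG).tendsto.comp hγ
  have h1 : Tendsto (fun t => ‖w a - γ t‖ ^ (1 - μ a)) l (𝓝 0) := by
    have h2 : Tendsto (fun t => ‖w a - γ t‖) l (𝓝 0) := by
      have := (tendsto_const_nhds (x := w a)).sub hγ
      simpa using this.norm
    have h3 := ((Real.continuous_rpow_const (by linarith : 0 ≤ 1 - μ a)).tendsto 0).comp h2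
    rw [Real.zero_rpow (by linarith)] at h3
    exact h3
  have h2 : Tendsto (fun t => ∏ j ∈ Finset.univ.erase a, ‖w j - γ t‖ ^ (-μ j)) l
      (𝓝 (∏ j ∈ Finset.univ.erase a, ‖w j - w a‖ ^ (-μ j))) := by
    refine tendsto_finsetProd _ fun j hj => ?_
    have h4 : ‖w j - w a‖ ≠ 0 := by
      rw [norm_ne_zero_iff, sub_ne_zero]
      exact hw.ne (Finset.ne_of_mem_erase hj)
    exact ((Real.continuousAt_rpow_const _ _ (Or.inl h4)).tendsto).comp (hγ.const_sub (w j)).norm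
  have h5 := (h1.mul h2).mul hds.norm
  rw [zero_mul, zero_mul] at h5
  refine squeeze_zero_norm' ?_ h5
  filter_upwards [eventually_all.2 hexp] with t ht
  have h6 : G (γ t) = (γ t - w a) * dslope G (w a) (γ t) := by
    have := sub_smul_dslope G (w a) (γ t)
    rw [h0, sub_zero, smul_eq_mul] at this
    exact this.symm
  have h7 : 0 < ‖w a - γ t‖ := by
    rw [← ht a]; exact norm_pos_iff.2 (Complex.exp_ne_zero _)
  rw [norm_mul, norm_integrand μ ht, ← Finset.mul_prod_erase _ _ (Finset.mem_univ a), h6, norm_mul,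
    norm_sub_rev (γ t), sub_eq_add_neg 1, Real.rpow_add h7, Real.rpow_one]
  refine le_of_eq ?_
  ring

theorem hasDerivAt_integrand_log_mul {n : ℕ} {μ : Fin (n + 1) → ℝ} {w c d : Fin (n + 1) → ℂ}
    {u : ℂ} (h : ∀ j, ‖(w j - u) - d j‖ < ‖d j‖) {G : ℂ → ℂ} (hG : AnalyticAt ℂ G u) :
    HasDerivAt (fun u => integrand μ (fun j => c j + Complex.log ((w j - u) / d j)) * G u)
      (integrand μ (fun j => c j + Complex.log ((w j - u) / d j)) *
        (deriv G u + G u * logCoeff μ w u)) u := by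
  have h1 : ∀ j, HasDerivAt (fun u => c j + Complex.log ((w j - u) / d j)) (-1 / (w j - u)) u := by
    intro j
    obtain ⟨hn1, hn2⟩ := ne_zero_of_dist_lt (h j)
    have h2 : HasDerivAt (fun u => (w j - u) / d j) (-1 / d j) u :=
      ((hasDerivAt_id u).const_sub (w j)).div_const _
    refine ((h2.clog (div_mem_slitPlane_of_dist_lt (h j))).const_add (c j)).congr_deriv ?_
    field_simp
  have h3 : HasDerivAt (fun u => -∑ j, (μ j : ℂ) * (c j + Complex.log ((w j - u) / d j)))
      (-∑ j, (μ j : ℂ) * (-1 / (w j - u))) u := by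
    refine HasDerivAt.fun_neg (HasDerivAt.fun_sum fun j _ => ?_)
    exact (h1 j).const_mul (μ j : ℂ)
  have h4 : -∑ j, (μ j : ℂ) * (-1 / (w j - u)) = logCoeff μ w u := by
    rw [logCoeff, ← Finset.sum_neg_distrib]
    exact Finset.sum_congr rfl fun j _ => by ring
  rw [h4] at h3
  simp only [integrand]
  refine (h3.cexp.fun_mul hG.differentiableAt.hasDerivAt).congr_deriv ?_
  ring

/-! ### Regularization of arc integrals -/

/-- A loop around `zₐ` with the weight that turns the twisted integral over the loop into the
improper integral from `zₐ` to its base point. -/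
theorem exists_loop {n : ℕ} {μ : Fin (n + 1) → ℝ} {z c : Fin (n + 1) → ℂ} {a : Fin (n + 1)}
    (hμ : μ a ∈ Ioo (0 : ℝ) 1) {p : ℂ} (hc : ∀ j, Complex.exp (c j) = z j - p)
    (hsep : ∀ j, j ≠ a → 4 * ‖p - z a‖ ≤ ‖z j - z a‖) :
    ∃ P : TwistedPath, P.Avoids z ∧ (∀ t, ‖P.c t - z a‖ = ‖p - z a‖) ∧
      ∀ w : Fin (n + 1) → ℂ, (∀ j, ‖w j - z j‖ < ‖p - z a‖) →
        ∀ G : ℂ → ℂ, (∀ t ∈ uIcc P.a P.b, AnalyticAt ℂ G (P.c t)) →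
          P.integral (fun u => transport μ z w u * (deriv G u + G u * logCoeff μ w u)) =
            integrand μ c * transport μ z w p * G p := by
  classical
  set r := ‖p - z a‖ with hr
  have hrpos : 0 < r := by
    rw [hr, norm_sub_rev, ← hc a]; exact norm_pos_iff.2 (Complex.exp_ne_zero _)
  set C : ℝ → ℂ := fun θ => z a + (p - z a) * Complex.exp (θ * Complex.I) with hC
  have hCn : ∀ θ, ‖C θ - z a‖ = r := by
    intro θ
    simp [hC, hr, Complex.norm_exp_ofReal_mul_I]
  have hCd : ∀ θ : ℝ, HasDerivAt C ((p - z a) * (Complex.exp (θ * Complex.I) * Complex.I)) θ := by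
    intro θ
    have h1 : HasDerivAt (fun θ : ℝ => (θ : ℂ) * Complex.I) Complex.I θ := by
      simpa using (Complex.ofRealCLM.hasDerivAt (x := θ)).mul_const Complex.I
    exact (h1.cexp.const_mul (p - z a)).const_add (z a)
  have hCc : Continuous C := by fun_prop
  have hCder : deriv C = fun θ : ℝ => (p - z a) * (Complex.exp (θ * Complex.I) * Complex.I) :=
    funext fun θ => (hCd θ).deriv
  have hCreg : RegularOn C 0 (2 * Real.pi) := by
    refine ⟨hCc.continuousOn, ⟨∅, countable_empty, fun t _ => (hCd t).differentiableAt⟩, ?_⟩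
    rw [hCder]
    exact Continuous.intervalIntegrable (by fun_prop) _ _
  have hC0 : C 0 = p := by simp [hC]
  have hC1 : C (2 * Real.pi) = p := by simp [hC]
  -- distances on the circle
  have hdist : ∀ j, j ≠ a → ∀ θ, ‖(z j - C θ) - (z j - p)‖ < ‖z j - p‖ := by
    intro j hj θ
    have h1 : ‖(z j - C θ) - (z j - p)‖ ≤ 2 * r := by
      have : (z j - C θ) - (z j - p) = (p - z a) - (C θ - z a) := by ring
      rw [this]
      refine (norm_sub_le _ _).trans ?_
      rw [hCn]; linarith
    have h2 : 3 * r ≤ ‖z j - p‖ := by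
      have h3 := norm_sub_norm_le (z j - z a) (p - z a)
      rw [sub_sub_sub_cancel_right] at h3
      have := hsep j hj
      linarith
    linarith
  have hfar : ∀ j θ, r ≤ ‖z j - C θ‖ := by
    intro j θ
    rcases eq_or_ne j a with rfl | hj
    · rw [norm_sub_rev, hCn]
    · have h3 := norm_sub_norm_le (z j - z a) (C θ - z a)
      rw [sub_sub_sub_cancel_right, hCn] at h3
      have := hsep j hj
      linarith
  -- Only the logarithm of index a winds around the circle. For j ≠ a the point moves by at most 2r
  -- while ‖zⱼ - p‖ ≥ 3r, so a principal logarithm of the quotient suffices and returns to its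
  -- initial value.
  set m : Fin (n + 1) → ℝ → ℂ := fun j θ =>
    if j = a then c a + θ * Complex.I else c j + Complex.log ((z j - C θ) / (z j - p)) with hm
  have hmexp : ∀ j θ, Complex.exp (m j θ) = z j - C θ := by
    intro j θ
    simp only [hm]
    split_ifs with hj
    · subst hj
      rw [Complex.exp_add, hc]; simp [hC]; ring
    · obtain ⟨h1, h2⟩ := ne_zero_of_dist_lt (hdist j hj θ)
      rw [Complex.exp_add, Complex.exp_log (div_ne_zero h1 h2), hc]
      field_simp
  have hmc : ∀ j, Continuous (m j) := by
    intro j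
    simp only [hm]
    split_ifs with hj
    · fun_prop
    · refine continuous_const.add (Continuous.clog (by fun_prop) fun θ => ?_)
      exact div_mem_slitPlane_of_dist_lt (hdist j hj θ)
  have hm0 : (fun j => m j 0) = c := by
    funext j
    simp only [hm]
    split_ifs with hj
    · subst hj; simp
    · have h2 := (ne_zero_of_dist_lt (hdist j hj 0)).2
      rw [hC0, div_self h2]; simp
  -- The monodromy factor of one turn around zₐ. An exact differential integrates over the loop to
  -- (κ - 1) times its boundary value at p, so the density carries the weight (κ - 1)⁻¹; κ ≠ 1
  -- because 0 < μₐ < 1.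
  set κ : ℂ := Complex.exp (-(μ a * (2 * Real.pi * Complex.I))) with hκ
  have hκ1 : κ - 1 ≠ 0 := by
    rw [sub_ne_zero]
    intro h
    obtain ⟨k, hk⟩ := Complex.exp_eq_one_iff.1 h
    have h1 : (-(μ a) : ℂ) = k := by
      have h2 : (2 * Real.pi * Complex.I : ℂ) ≠ 0 := Complex.two_pi_I_ne_zero
      apply mul_right_cancel₀ h2
      rw [← hk]; ring
    have h3 : -(μ a) = (k : ℝ) := by exact_mod_cast h1
    have h4 : (-1 : ℝ) < k := by rw [← h3]; linarith [hμ.2]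
    have h5 : (k : ℝ) < 0 := by rw [← h3]; linarith [hμ.1]
    have h6 : -1 < k := by exact_mod_cast h4
    have h7 : k < 0 := by exact_mod_cast h5
    omega
  have hm1 : integrand μ (fun j => m j (2 * Real.pi)) = κ * integrand μ c := by
    have h1 : (fun j => m j (2 * Real.pi)) =
        fun j => (if j = a then 2 * Real.pi * Complex.I else 0) + c j := by
      funext j
      simp only [hm]
      split_ifs with hj
      · subst hj; push_cast; ring
      · have h2 := (ne_zero_of_dist_lt (hdist j hj 0)).2
        rw [hC1, div_self h2]; simp
    rw [h1, integrand_add]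
    congr 1
    rw [integrand, hκ]
    congr 2
    simp
  refine ⟨⟨0, 2 * Real.pi, C, fun θ => (κ - 1)⁻¹ * (integrand μ (fun j => m j θ) * deriv C θ)⟩,
    ⟨Real.two_pi_pos.le, hCc.continuousOn, ?_, ?_⟩, hCn, ?_⟩
  · refine Continuous.intervalIntegrable ?_ _ _
    simp only [hCder]
    unfold integrand
    fun_prop
  · intro j t _ h
    have := hfar j t
    rw [h, norm_zero] at this
    linarith
  · intro w hw G hG
    have hd2 : ∀ j θ, ‖(w j - C θ) - (z j - C θ)‖ < ‖z j - C θ‖ := by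
      intro j θ
      rw [sub_sub_sub_cancel_right]
      exact (hw j).trans_le (hfar j θ)
    have hbr : IsBranchOn w C (fun j θ => m j θ + Complex.log ((w j - C θ) / (z j - C θ)))
        0 (2 * Real.pi) := by
      constructor
      · intro j
        refine Continuous.continuousOn ((hmc j).add (Continuous.clog ?_ fun θ => ?_))
        · exact (continuous_const.sub hCc).div (continuous_const.sub hCc)
            fun θ => (ne_zero_of_dist_lt (hd2 j θ)).2
        · exact div_mem_slitPlane_of_dist_lt (hd2 j θ)
      · intro j θ _
        obtain ⟨h1, h2⟩ := ne_zero_of_dist_lt (hd2 j θ)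
        rw [Complex.exp_add, Complex.exp_log (div_ne_zero h1 h2), hmexp]
        field_simp
    have key := integral_integrand_mul_exact (μ := μ) (G := G) hCreg hbr hG
    have hint : ∀ θ, integrand μ (fun j => m j θ + Complex.log ((w j - C θ) / (z j - C θ))) =
        integrand μ (fun j => m j θ) * transport μ z w (C θ) := fun θ => integrand_add _ _ _
    simp only [hint] at key
    rw [hm1, hm0, hC0, hC1] at key
    simp only [TwistedPath.integral]
    have h9 : ∫ θ in (0 : ℝ)..2 * Real.pi,
        (κ - 1)⁻¹ * (integrand μ (fun j => m j θ) * deriv C θ) *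
          (transport μ z w (C θ) * (deriv G (C θ) + G (C θ) * logCoeff μ w (C θ))) =
        (κ - 1)⁻¹ * ∫ θ in (0 : ℝ)..2 * Real.pi,
          integrand μ (fun j => m j θ) * transport μ z w (C θ) *
            (deriv G (C θ) + G (C θ) * logCoeff μ w (C θ)) * deriv C θ := by
      rw [← intervalIntegral.integral_const_mul]
      congr 1
      funext θ
      ring
    rw [h9, key]
    field_simp

theorem primitive_sub_eq {f P Q : ℂ → ℂ} {U : Set ℂ} (hU : Convex ℝ U)
    (hP : ∀ u ∈ U, HasDerivAt P (f u) u) (hQ : ∀ u ∈ U, HasDerivAt Q (f u) u) {x y : ℂ}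
    (hx : x ∈ U) (hy : y ∈ U) : P x - P y = Q x - Q y := by
  have h : ∀ u ∈ U, HasDerivWithinAt (fun v => P v - Q v) 0 U u := fun u hu => by
    simpa using ((hP u hu).fun_sub (hQ u hu)).hasDerivWithinAt
  have := hU.norm_image_sub_le_of_norm_hasDerivWithin_le (C := 0) h (by simp) hy hx
  rw [zero_mul, norm_le_zero_iff] at this
  linear_combination this

/-- A homotopy invariance statement with the boundary terms retained. The w-integrand, in the branch
prescribed by ℓ₀ at time t, is holomorphic on the ball around γ₀(t), and V(t) is the increment of a
primitive there from γ₀(t) to γ₁(t). The derivative of V is the difference of the two integrands.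
The last clause permits any other primitive for evaluating V, which is needed at the end points,
where primitives of the form integrand times G are available. -/
theorem exists_homotopy_potential {n : ℕ} {μ : Fin (n + 1) → ℝ} {z w : Fin (n + 1) → ℂ}
    {t₀ t₁ m : ℝ} (h01 : t₀ ≤ t₁) {γ₀ γ₁ : ℝ → ℂ} {ℓ₀ ℓ₁ : Fin (n + 1) → ℝ → ℂ}
    (hγ₀ : RegularOn γ₀ t₀ t₁) (hγ₁ : RegularOn γ₁ t₀ t₁)
    (hb₀ : IsBranchOn z γ₀ ℓ₀ t₀ t₁) (hb₁ : IsBranchOn w γ₁ ℓ₁ t₀ t₁)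
    (hfar : ∀ t ∈ Icc t₀ t₁, ∀ j, 2 * m ≤ ‖z j - γ₀ t‖) (hw : ∀ j, ‖w j - z j‖ < m)
    (hγ : ∀ t ∈ Icc t₀ t₁, ‖γ₁ t - γ₀ t‖ < m) (hℓ : ∀ j, ∀ t ∈ Icc t₀ t₁, ‖ℓ₁ j t - ℓ₀ j t‖ < 1)
    {g : ℂ → ℂ} (hg : Differentiable ℂ g) :
    ∃ V : ℝ → ℂ,
      (∫ t in t₀..t₁, integrand μ (fun j => ℓ₁ j t) * g (γ₁ t) * deriv γ₁ t) -
        (∫ t in t₀..t₁, integrand μ (fun j => ℓ₀ j t) * deriv γ₀ t *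
          (transport μ z w (γ₀ t) * g (γ₀ t))) = V t₁ - V t₀ ∧
      ∀ t ∈ Icc t₀ t₁, ∀ Ψ : ℂ → ℂ, (∀ u ∈ Metric.ball (γ₀ t) m, HasDerivAt Ψ
        (integrand μ (fun j => ℓ₀ j t + Complex.log ((w j - u) / (z j - γ₀ t))) * g u) u) →
          V t = Ψ (γ₁ t) - Ψ (γ₀ t) := by
  have hm : 0 < m := (norm_nonneg _).trans_lt (hw 0)
  set E : ℝ → ℂ → ℂ := fun t u =>
    integrand μ (fun j => ℓ₀ j t + Complex.log ((w j - u) / (z j - γ₀ t))) with hE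
  have hlt : ∀ t ∈ Icc t₀ t₁, ∀ u ∈ Metric.ball (γ₀ t) m, ∀ j,
      ‖(w j - u) - (z j - γ₀ t)‖ < ‖z j - γ₀ t‖ := by
    intro t ht u hu j
    rw [mem_ball_iff_norm] at hu
    have h1 : (w j - u) - (z j - γ₀ t) = (w j - z j) - (u - γ₀ t) := by ring
    rw [h1]
    refine (norm_sub_le _ _).trans_lt ?_
    linarith [hfar t ht j, hw j]
  have hprim : ∀ t, ∃ P : ℂ → ℂ, t ∈ Icc t₀ t₁ →
      ∀ u ∈ Metric.ball (γ₀ t) m, HasDerivAt P (E t u * g u) u := by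
    intro t
    by_cases ht : t ∈ Icc t₀ t₁
    · have h1 : DifferentiableOn ℂ (fun u => E t u * g u) (Metric.ball (γ₀ t) m) := by
        intro u hu
        exact (hasDerivAt_integrand_log_mul (hlt t ht u hu)
          (hg.analyticAt u)).differentiableAt.differentiableWithinAt
      obtain ⟨P, hP⟩ := h1.isExactOn_ball
      exact ⟨P, fun _ => hP⟩
    · exact ⟨0, fun h => absurd h ht⟩
  choose P hP using hprim
  have hγ₀c : ContinuousOn γ₀ (Icc t₀ t₁) := by simpa [uIcc_of_le h01] using hγ₀.cont
  have hγ₁c : ContinuousOn γ₁ (Icc t₀ t₁) := by simpa [uIcc_of_le h01] using hγ₁.cont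
  -- The primitives P s are chosen independently for different s. On overlapping balls the
  -- integrands agree for s near t, so the increments agree although the primitives may differ by
  -- constants; near t one fixed primitive can therefore be used.
  have hV : ∀ t ∈ Icc t₀ t₁, ∀ᶠ s in 𝓝[Icc t₀ t₁] t,
      P s (γ₁ s) - P s (γ₀ s) = P t (γ₁ s) - P t (γ₀ s) := by
    intro t ht
    have e1 : ∀ᶠ s in 𝓝[Icc t₀ t₁] t, γ₀ s ∈ Metric.ball (γ₀ t) m :=
      (hγ₀c t ht).eventually (Metric.ball_mem_nhds _ hm)
    have e2 : ∀ᶠ s in 𝓝[Icc t₀ t₁] t, γ₁ s ∈ Metric.ball (γ₀ t) m :=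
      (hγ₁c t ht).eventually (Metric.isOpen_ball.mem_nhds (mem_ball_iff_norm.2 (hγ t ht)))
    have e3 : ∀ j, ∀ᶠ s in 𝓝[Icc t₀ t₁] t, ‖ℓ₀ j s - ℓ₀ j t‖ < 1 := by
      intro j
      have h1 := hb₀.cont j
      rw [uIcc_of_le h01] at h1
      have h2 := (h1 t ht).eventually (Metric.ball_mem_nhds _ one_pos)
      filter_upwards [h2] with s hs using mem_ball_iff_norm.1 hs
    filter_upwards [e1, e2, eventually_all.2 e3, self_mem_nhdsWithin] with s h1 h2 h3 hs
    have hEE : ∀ u ∈ Metric.ball (γ₀ s) m ∩ Metric.ball (γ₀ t) m, E s u = E t u := by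
      intro u hu
      simp only [hE]
      congr 1
      funext j
      obtain ⟨a1, a2⟩ := ne_zero_of_dist_lt (hlt s hs u hu.1 j)
      obtain ⟨b1, b2⟩ := ne_zero_of_dist_lt (hlt t ht u hu.2 j)
      refine eq_of_exp_eq_of_abs_im_lt ?_ ?_
      · rw [Complex.exp_add, Complex.exp_add, Complex.exp_log (div_ne_zero a1 a2),
          Complex.exp_log (div_ne_zero b1 b2), hb₀.exp j s (by rwa [uIcc_of_le h01]),
          hb₀.exp j t (by rwa [uIcc_of_le h01])]
        field_simp
      · have c1 := abs_im_log_div_lt (hlt s hs u hu.1 j)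
        have c2 := abs_im_log_div_lt (hlt t ht u hu.2 j)
        have c3 := (Complex.abs_im_le_norm (ℓ₀ j s - ℓ₀ j t)).trans_lt (h3 j)
        have c4 := Real.pi_gt_three
        simp only [Complex.sub_im, Complex.add_im] at c3 ⊢
        rw [abs_lt] at c1 c2 c3 ⊢
        constructor <;> linarith
    refine primitive_sub_eq (f := fun u => E s u * g u)
      ((convex_ball (γ₀ s) m).inter (convex_ball (γ₀ t) m)) (fun u hu => hP s hs u hu.1)
      (fun u hu => ?_) ⟨mem_ball_iff_norm.2 (hγ s hs), h2⟩ ⟨Metric.mem_ball_self hm, h1⟩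
    rw [hEE u hu]
    exact hP t ht u hu.2
  refine ⟨fun t => P t (γ₁ t) - P t (γ₀ t), ?_, ?_⟩
  · obtain ⟨S₀, hS₀, hd₀⟩ := hγ₀.diff
    obtain ⟨S₁, hS₁, hd₁⟩ := hγ₁.diff
    rw [min_eq_left h01, max_eq_right h01] at hd₀ hd₁
    have hi₁ : IntervalIntegrable (fun t => integrand μ (fun j => ℓ₁ j t) * g (γ₁ t) * deriv γ₁ t)
        MeasureTheory.volume t₀ t₁ :=
      hγ₁.int.continuousOn_mul (hb₁.continuousOn_integrand.mul
        (hg.continuous.comp_continuousOn hγ₁.cont))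
    have hi₀ : IntervalIntegrable (fun t => integrand μ (fun j => ℓ₀ j t) * deriv γ₀ t *
          (transport μ z w (γ₀ t) * g (γ₀ t))) MeasureTheory.volume t₀ t₁ := by
      refine (hγ₀.int.continuousOn_mul hb₀.continuousOn_integrand).mul_continuousOn ?_
      refine ContinuousOn.mul ?_ (hg.continuous.comp_continuousOn hγ₀.cont)
      have h1 : ∀ j, ContinuousOn (fun t => Complex.log ((w j - γ₀ t) / (z j - γ₀ t)))
          (uIcc t₀ t₁) := by
        intro j
        refine ContinuousOn.clog ?_ fun t ht => ?_
        · refine (continuousOn_const.sub hγ₀.cont).div (continuousOn_const.sub hγ₀.cont)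
            fun t ht => hb₀.ne ht j
        · rw [uIcc_of_le h01] at ht
          exact div_mem_slitPlane_of_dist_lt (hlt t ht _ (Metric.mem_ball_self hm) j)
      unfold transport integrand
      fun_prop
    rw [← intervalIntegral.integral_sub hi₁ hi₀]
    refine MeasureTheory.integral_eq_of_hasDerivAt_off_countable_of_le
      (fun t => P t (γ₁ t) - P t (γ₀ t)) _ h01 (hS₀.union hS₁) ?_ ?_ (hi₁.sub hi₀)
    · intro t ht
      refine ContinuousWithinAt.congr_of_eventuallyEq ?_ (hV t ht) rfl
      refine ContinuousWithinAt.sub ?_ ?_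
      · exact (hP t ht _ (mem_ball_iff_norm.2 (hγ t ht))).continuousAt.comp_continuousWithinAt
          (hγ₁c t ht)
      · exact (hP t ht _ (Metric.mem_ball_self hm)).continuousAt.comp_continuousWithinAt
          (hγ₀c t ht)
    · intro t ht
      have ht' : t ∈ Icc t₀ t₁ := Ioo_subset_Icc_self ht.1
      have hn : 𝓝[Icc t₀ t₁] t = 𝓝 t := nhdsWithin_eq_nhds.2 (Icc_mem_nhds ht.1.1 ht.1.2)
      have h1 := hV t ht'
      rw [hn] at h1
      refine HasDerivAt.congr_of_eventuallyEq ?_ h1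
      have a1 := (hP t ht' _ (mem_ball_iff_norm.2 (hγ t ht'))).comp t
        (hd₁ t ⟨ht.1, fun h => ht.2 (Or.inr h)⟩).hasDerivAt
      have a0 := (hP t ht' _ (Metric.mem_ball_self hm)).comp t
        (hd₀ t ⟨ht.1, fun h => ht.2 (Or.inl h)⟩).hasDerivAt
      refine (a1.fun_sub a0).congr_deriv ?_
      have e1 : E t (γ₁ t) = integrand μ (fun j => ℓ₁ j t) := by
        simp only [hE]
        congr 1
        funext j
        exact (eq_add_log_div (hb₀.exp j t (by rwa [uIcc_of_le h01]))
          (hb₁.exp j t (by rwa [uIcc_of_le h01]))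
          (hlt t ht' _ (mem_ball_iff_norm.2 (hγ t ht')) j) (hℓ j t ht')).symm
      have e0 : E t (γ₀ t) = integrand μ (fun j => ℓ₀ j t) * transport μ z w (γ₀ t) :=
        integrand_add _ _ _
      rw [e1, e0]
      ring
  · intro t ht Ψ hΨ
    exact primitive_sub_eq (convex_ball (γ₀ t) m) (hP t ht) hΨ
      (mem_ball_iff_norm.2 (hγ t ht)) (Metric.mem_ball_self hm)

/-- The improper integral of the Lauricella differential along a relative arc, in terms of local
primitives at its ends. -/
theorem hasArcIntegral_of_ends {n : ℕ} {μ : Fin (n + 1) → ℝ} {w : Fin (n + 1) → ℂ}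
    (hw : Function.Injective w) (hμ : ∀ k, μ k < 1) {γ : ℝ → ℂ} {ℓ : Fin (n + 1) → ℝ → ℂ}
    (hγ : PiecewiseC1On γ 0 1) (hℓ : ∀ j, ContinuousOn (ℓ j) (Ioo 0 1))
    (hexp : ∀ j, ∀ t ∈ Ioo (0 : ℝ) 1, Complex.exp (ℓ j t) = w j - γ t) {a b : Fin (n + 1)}
    (ha : γ 0 = w a) (hb : γ 1 = w b) {t₀ t₁ R : ℝ} (h0 : 0 < t₀) (h01 : t₀ ≤ t₁) (h1 : t₁ < 1)
    (h0R : ∀ t ∈ Icc 0 t₀, γ t ∈ Metric.ball (w a) R)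
    (h1R : ∀ t ∈ Icc t₁ 1, γ t ∈ Metric.ball (w b) R)
    {g A B : ℂ → ℂ} (hg : Differentiable ℂ g)
    (hA : AnalyticOnNhd ℂ A (Metric.ball (w a) R)) (hA0 : A (w a) = 0)
    (hAg : ∀ u ∈ Metric.ball (w a) R, u ≠ w a → deriv A u + A u * logCoeff μ w u = g u)
    (hB : AnalyticOnNhd ℂ B (Metric.ball (w b) R)) (hB0 : B (w b) = 0)
    (hBg : ∀ u ∈ Metric.ball (w b) R, u ≠ w b → deriv B u + B u * logCoeff μ w u = g u) :
    HasArcIntegral γ (fun t => integrand μ (fun j => ℓ j t) * g (γ t))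
      (integrand μ (fun j => ℓ j t₀) * A (γ t₀) +
        (∫ t in t₀..t₁, integrand μ (fun j => ℓ j t) * g (γ t) * deriv γ t) -
        integrand μ (fun j => ℓ j t₁) * B (γ t₁)) := by
  have hne : ∀ j, ∀ t ∈ Ioo (0 : ℝ) 1, γ t ≠ w j := by
    intro j t ht h
    have := hexp j t ht
    rw [h, sub_self] at this
    exact Complex.exp_ne_zero _ this
  have hreg : ∀ s ∈ Ioo (0 : ℝ) 1, ∀ e ∈ Ioo (0 : ℝ) 1,
      RegularOn γ s e ∧ IsBranchOn w γ ℓ s e ∧ uIcc s e ⊆ Ioo (0 : ℝ) 1 := by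
    intro s hs e he
    have hsub : uIcc s e ⊆ Ioo (0 : ℝ) 1 := ordConnected_Ioo.uIcc_subset hs he
    exact ⟨hγ.regularOn (Ioo_subset_Icc_self hs) (Ioo_subset_Icc_self he),
      ⟨fun j => (hℓ j).mono hsub, fun j t ht => hexp j t (hsub ht)⟩, hsub⟩
  have hint : ∀ s ∈ Ioo (0 : ℝ) 1, ∀ e ∈ Ioo (0 : ℝ) 1,
      IntervalIntegrable (fun t => integrand μ (fun j => ℓ j t) * g (γ t) * deriv γ t)
        MeasureTheory.volume s e := by
    intro s hs e he
    obtain ⟨r1, r2, -⟩ := hreg s hs e he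
    exact r1.int.continuousOn_mul (r2.continuousOn_integrand.mul
      (hg.continuous.comp_continuousOn r1.cont))
  have hprim : ∀ (c : Fin (n + 1)) (G : ℂ → ℂ), AnalyticOnNhd ℂ G (Metric.ball (w c) R) →
      (∀ u ∈ Metric.ball (w c) R, u ≠ w c → deriv G u + G u * logCoeff μ w u = g u) →
      ∀ s ∈ Ioo (0 : ℝ) 1, ∀ e ∈ Ioo (0 : ℝ) 1, (∀ t ∈ uIcc s e, γ t ∈ Metric.ball (w c) R) →
      ∫ t in s..e, integrand μ (fun j => ℓ j t) * g (γ t) * deriv γ t =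
        integrand μ (fun j => ℓ j e) * G (γ e) - integrand μ (fun j => ℓ j s) * G (γ s) := by
    intro c G hG hGg s hs e he hR
    obtain ⟨r1, r2, r3⟩ := hreg s hs e he
    rw [← integral_integrand_mul_exact r1 r2 fun t ht => hG _ (hR t ht)]
    refine intervalIntegral.integral_congr fun t ht => ?_
    simp only [hGg _ (hR t ht) (hne c t (r3 ht))]
  have hcont := hγ.continuousOn zero_lt_one
  have hlim0 : Tendsto (fun s => integrand μ (fun j => ℓ j s) * A (γ s)) (𝓝[>] 0) (𝓝 0) := by
    refine tendsto_integrand_mul_zero hw (hμ a) ?_ (fun j => ?_)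
      (hA _ (Metric.mem_ball_self ?_)).differentiableAt hA0
    · have := hcont 0 (left_mem_Icc.2 zero_le_one)
      rw [ContinuousWithinAt, ha] at this
      exact this.mono_left (nhdsWithin_le_of_mem (mem_of_superset (Ioo_mem_nhdsGT zero_lt_one)
        Ioo_subset_Icc_self))
    · filter_upwards [Ioo_mem_nhdsGT (zero_lt_one (α := ℝ))] with s hs using hexp j s hs
    · exact (dist_nonneg).trans_lt (h0R 0 ⟨le_rfl, h0.le⟩)
  have hlim1 : Tendsto (fun s => integrand μ (fun j => ℓ j s) * B (γ s)) (𝓝[<] 1) (𝓝 0) := by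
    refine tendsto_integrand_mul_zero hw (hμ b) ?_ (fun j => ?_)
      (hB _ (Metric.mem_ball_self ?_)).differentiableAt hB0
    · have := hcont 1 (right_mem_Icc.2 zero_le_one)
      rw [ContinuousWithinAt, hb] at this
      exact this.mono_left (nhdsWithin_le_of_mem (mem_of_superset (Ioo_mem_nhdsLT zero_lt_one)
        Ioo_subset_Icc_self))
    · filter_upwards [Ioo_mem_nhdsLT (zero_lt_one (α := ℝ))] with s hs using hexp j s hs
    · exact (dist_nonneg).trans_lt (h1R 1 ⟨h1.le, le_rfl⟩)
  have ht₀ : t₀ ∈ Ioo (0 : ℝ) 1 := ⟨h0, h01.trans_lt h1⟩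
  have ht₁ : t₁ ∈ Ioo (0 : ℝ) 1 := ⟨h0.trans_le h01, h1⟩
  have hT : Tendsto (fun p : ℝ × ℝ =>
      (integrand μ (fun j => ℓ j t₀) * A (γ t₀) - integrand μ (fun j => ℓ j p.1) * A (γ p.1)) +
        (∫ t in t₀..t₁, integrand μ (fun j => ℓ j t) * g (γ t) * deriv γ t) +
        (integrand μ (fun j => ℓ j p.2) * B (γ p.2) - integrand μ (fun j => ℓ j t₁) * B (γ t₁)))
      (𝓝[>] 0 ×ˢ 𝓝[<] 1)
      (𝓝 ((integrand μ (fun j => ℓ j t₀) * A (γ t₀) - 0) +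
        (∫ t in t₀..t₁, integrand μ (fun j => ℓ j t) * g (γ t) * deriv γ t) +
        (0 - integrand μ (fun j => ℓ j t₁) * B (γ t₁)))) :=
    ((tendsto_const_nhds.sub (hlim0.comp tendsto_fst)).add tendsto_const_nhds).add
      ((hlim1.comp tendsto_snd).sub tendsto_const_nhds)
  rw [sub_zero, zero_sub, ← sub_eq_add_neg] at hT
  refine hT.congr' ?_
  filter_upwards [prod_mem_prod (Ioo_mem_nhdsGT h0) (Ioo_mem_nhdsLT h1)] with p hp
  have hp1 : p.1 ∈ Ioo (0 : ℝ) 1 := ⟨hp.1.1, hp.1.2.trans ht₀.2⟩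
  have hp2 : p.2 ∈ Ioo (0 : ℝ) 1 := ⟨ht₁.1.trans hp.2.1, hp.2.2⟩
  rw [← hprim a A hA hAg p.1 hp1 t₀ ht₀ ?_, ← hprim b B hB hBg t₁ ht₁ p.2 hp2 ?_]
  · rw [intervalIntegral.integral_add_adjacent_intervals (hint _ hp1 _ ht₀) (hint _ ht₀ _ ht₁),
      intervalIntegral.integral_add_adjacent_intervals (hint _ hp1 _ ht₁) (hint _ ht₁ _ hp2)]
  · intro t ht
    rw [uIcc_of_le hp.2.1.le] at ht
    exact h1R t ⟨ht.1, ht.2.trans hp.2.2.le⟩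
  · intro t ht
    rw [uIcc_of_le hp.1.2.le] at ht
    exact h0R t ⟨hp.1.1.le.trans ht.1, ht.2⟩

theorem exists_separation {n : ℕ} {z : Fin (n + 1) → ℂ} (hz : Function.Injective z) :
    ∃ d > 0, ∀ i j, i ≠ j → d ≤ ‖z i - z j‖ := by
  have h : ∀ᶠ d in 𝓝[>] (0 : ℝ), ∀ i j, i ≠ j → d ≤ ‖z i - z j‖ := by
    refine eventually_all.2 fun i => eventually_all.2 fun j => ?_
    by_cases hij : i = j
    · exact Eventually.of_forall fun d h => absurd hij h
    · have h1 : 0 < ‖z i - z j‖ := norm_pos_iff.2 (sub_ne_zero.2 (hz.ne hij))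
      filter_upwards [Ioo_mem_nhdsGT h1] with d hd _ using hd.2.le
  obtain ⟨d, hd, hd0⟩ := (h.and self_mem_nhdsWithin).exists
  exact ⟨d, hd0, hd⟩

/-- The same path with the opposite density. -/
def TwistedPath.neg (P : TwistedPath) : TwistedPath := ⟨P.a, P.b, P.c, fun t => -P.ρ t⟩

theorem TwistedPath.neg_integral (P : TwistedPath) (g : ℂ → ℂ) :
    P.neg.integral g = -P.integral g := by
  simp [TwistedPath.integral, TwistedPath.neg]

theorem TwistedPath.Avoids.neg {n : ℕ} {P : TwistedPath} {z : Fin (n + 1) → ℂ} (h : P.Avoids z) :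
    P.neg.Avoids z := ⟨h.le, h.cont, h.int.neg, h.ne⟩

theorem TwistedPath.integral_congr {P : TwistedPath} {f g : ℂ → ℂ}
    (h : ∀ t ∈ uIcc P.a P.b, f (P.c t) = g (P.c t)) : P.integral f = P.integral g :=
  intervalIntegral.integral_congr fun t ht => by simp only [h t ht]

theorem eventually_forall_close {n : ℕ} {z : Fin (n + 1) → ℂ} {N : Set (Fin (n + 1) → ℂ)}
    (hN : N ∈ 𝓝 z) {K : Set ℝ} (hK : IsCompact K) {F : (Fin (n + 1) → ℂ) → ℝ → ℂ}
    (hF : ContinuousOn (fun p : (Fin (n + 1) → ℂ) × ℝ => F p.1 p.2) (N ×ˢ K)) {ε : ℝ}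
    (hε : 0 < ε) : ∀ᶠ w in 𝓝 z, ∀ t ∈ K, ‖F w t - F z t‖ < ε := by
  obtain ⟨v, hv, hv'⟩ := hK.mem_uniformity_of_prod (f := F) hF (mem_of_mem_nhds hN)
    (Metric.dist_mem_uniformity hε)
  rw [nhdsWithin_eq_nhds.2 hN] at hv
  filter_upwards [hv] with w hw t ht
  rw [← dist_eq_norm]
  exact hv' w hw t ht

/-- Arc integrals of the Lauricella differential are integrals over fixed twisted cycles that avoid
the singular points. -/
theorem exists_regularization {n : ℕ} {μ : Fin (n + 1) → ℝ} (hμ : ∀ k, μ k ∈ Ioo (0 : ℝ) 1)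
    {z : Fin (n + 1) → ℂ} (hz : Function.Injective z) {N : Set (Fin (n + 1) → ℂ)}
    {Γ : (Fin (n + 1) → ℂ) → ℝ → ℂ} {ℓ : Fin (n + 1) → (Fin (n + 1) → ℂ) → ℝ → ℂ}
    (hN : N ∈ 𝓝 z)
    (hΓ : ContinuousOn (fun p : (Fin (n + 1) → ℂ) × ℝ => Γ p.1 p.2) (N ×ˢ Icc 0 1))
    (hℓ : ∀ k, ContinuousOn (fun p : (Fin (n + 1) → ℂ) × ℝ => ℓ k p.1 p.2) (N ×ˢ Ioo 0 1))
    (hrel : ∀ w ∈ N, IsRelativeArc w (Γ w))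
    (hexp : ∀ w ∈ N, ∀ k, ∀ t ∈ Ioo (0 : ℝ) 1, Complex.exp (ℓ k w t) = w k - Γ w t) :
    ∃ C : Fin 3 → TwistedPath, (∀ m, (C m).Avoids z) ∧
      (∀ G : ℂ → ℂ, (∀ m, ∀ t ∈ uIcc (C m).a (C m).b, AnalyticAt ℂ G ((C m).c t)) →
        ∑ m, (C m).integral (fun u => deriv G u + G u * logCoeff μ z u) = 0) ∧
      ∀ᶠ w in 𝓝 z, ∀ g : ℂ → ℂ, Differentiable ℂ g →
        HasArcIntegral (Γ w) (fun t => integrand μ (fun k => ℓ k w t) * g (Γ w t))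
          (∑ m, (C m).integral (fun u => transport μ z w u * g u)) := by
  have hzN : z ∈ N := mem_of_mem_nhds hN
  obtain ⟨d', hd', hsep'⟩ := exists_separation hz
  -- With separation 8d and displacements of the points below m ≤ d, the points wⱼ remain 6d apart,
  -- so the end primitives exist on balls of radius 6d; these contain the circles and the moved ends
  -- of the arc.
  obtain ⟨d, hd, hd8⟩ : ∃ d > 0, 8 * d ≤ d' := ⟨d' / 8, by positivity, by linarith⟩
  have hsep : ∀ i j, i ≠ j → 8 * d ≤ ‖z i - z j‖ := fun i j h => hd8.trans (hsep' i j h)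
  obtain ⟨a, ha⟩ := (hrel z hzN).source
  obtain ⟨b, hb⟩ := (hrel z hzN).target
  have hγc : ContinuousOn (Γ z) (Icc 0 1) := (hrel z hzN).piecewise.continuousOn zero_lt_one
  obtain ⟨t₀, ht₀, ht₀', hγ₀⟩ : ∃ t₀ : ℝ, 0 < t₀ ∧ t₀ ≤ 1 / 4 ∧
      ∀ t ∈ Icc 0 t₀, ‖Γ z t - z a‖ < d := by
    obtain ⟨δ, hδ, h⟩ := Metric.continuousWithinAt_iff.1 (hγc 0 (left_mem_Icc.2 zero_le_one)) d hd
    refine ⟨min (δ / 2) (1 / 4), by positivity, min_le_right _ _, fun t ht => ?_⟩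
    have h1 := ht.2.trans (min_le_left _ _)
    have h2 := ht.2.trans (min_le_right _ _)
    have h3 := h (x := t) ⟨ht.1, by linarith⟩ (by
      rw [Real.dist_eq, sub_zero, abs_of_nonneg ht.1]; linarith)
    rwa [dist_eq_norm, ← ha] at h3
  obtain ⟨t₁, ht₁, ht₁', hγ₁⟩ : ∃ t₁ : ℝ, t₁ < 1 ∧ 3 / 4 ≤ t₁ ∧
      ∀ t ∈ Icc t₁ 1, ‖Γ z t - z b‖ < d := by
    obtain ⟨δ, hδ, h⟩ := Metric.continuousWithinAt_iff.1 (hγc 1 (right_mem_Icc.2 zero_le_one)) d hd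
    have hmin : 0 < min (δ / 2) (1 / 4) := by positivity
    have hml := min_le_left (δ / 2) (1 / 4)
    have hmr := min_le_right (δ / 2) (1 / 4)
    refine ⟨1 - min (δ / 2) (1 / 4), by linarith, by linarith, fun t ht => ?_⟩
    have h3 := h (x := t) ⟨by linarith [ht.1], ht.2⟩ (by
      rw [Real.dist_eq, abs_of_nonpos (by linarith [ht.2])]; linarith [ht.1])
    rwa [dist_eq_norm, ← hb] at h3
  have h01 : t₀ ≤ t₁ := by linarith
  have hsub : Icc t₀ t₁ ⊆ Ioo (0 : ℝ) 1 := fun t ht => ⟨ht₀.trans_le ht.1, ht.2.trans_lt ht₁⟩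
  have hm₀ : t₀ ∈ Icc t₀ t₁ := ⟨le_rfl, h01⟩
  have hm₁ : t₁ ∈ Icc t₀ t₁ := ⟨h01, le_rfl⟩
  have hbr : ∀ w ∈ N, IsBranchOn w (Γ w) (fun j t => ℓ j w t) t₀ t₁ := by
    intro w hw
    rw [← uIcc_of_le h01] at hsub
    refine ⟨fun j => ?_, fun j t ht => hexp w hw j t (hsub ht)⟩
    exact (hℓ j).comp (f := fun t => (w, t)) (by fun_prop) fun t ht => ⟨hw, hsub ht⟩
  have hreg : ∀ w ∈ N, RegularOn (Γ w) t₀ t₁ := fun w hw =>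
    (hrel w hw).piecewise.regularOn (Ioo_subset_Icc_self (hsub hm₀)) (Ioo_subset_Icc_self (hsub hm₁))
  -- The margin 2m absorbs a displacement of a branch point and one of the path, each smaller than
  -- m.
  obtain ⟨m, hm, hmd, hfar⟩ : ∃ m > 0, m ≤ d ∧ ∀ t ∈ Icc t₀ t₁, ∀ j, 2 * m ≤ ‖z j - Γ z t‖ := by
    have h1 : ∀ j, ∃ c, 0 < c ∧ ∀ t ∈ Icc t₀ t₁, c ≤ ‖z j - Γ z t‖ := by
      intro j
      refine isCompact_Icc.exists_forall_le' (a := 0) ?_ fun t ht => ?_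
      · exact (continuousOn_const.sub (hγc.mono (hsub.trans Ioo_subset_Icc_self))).norm
      · rw [← hexp z hzN j t (hsub ht)]; exact norm_pos_iff.2 (Complex.exp_ne_zero _)
    choose c hc hc' using h1
    have h2 : ∀ᶠ m in 𝓝[>] (0 : ℝ), ∀ j, m < c j / 2 :=
      eventually_all.2 fun j => by
        filter_upwards [Ioo_mem_nhdsGT (half_pos (hc j))] with m hm using hm.2
    obtain ⟨m, h3, h4⟩ := (h2.and (Ioo_mem_nhdsGT hd)).exists
    exact ⟨m, h4.1, h4.2.le, fun t ht j => by linarith [h3 j, hc' j t ht]⟩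
  have hloop : ∀ (τ : ℝ) (k : Fin (n + 1)), τ ∈ Icc t₀ t₁ → ‖Γ z τ - z k‖ < d →
      ∀ j, j ≠ k → 4 * ‖Γ z τ - z k‖ ≤ ‖z j - z k‖ := by
    intro τ k _ h j hj
    linarith [hsep j k hj]
  have hda : ‖Γ z t₀ - z a‖ < d := hγ₀ t₀ ⟨ht₀.le, le_rfl⟩
  have hdb : ‖Γ z t₁ - z b‖ < d := hγ₁ t₁ ⟨le_rfl, ht₁.le⟩
  obtain ⟨P, hP1, hP2, hP3⟩ := exists_loop (hμ a)
    (fun j => hexp z hzN j t₀ (hsub hm₀)) (hloop t₀ a hm₀ hda)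
  obtain ⟨Q, hQ1, hQ2, hQ3⟩ := exists_loop (hμ b)
    (fun j => hexp z hzN j t₁ (hsub hm₁)) (hloop t₁ b hm₁ hdb)
  have hra : 0 < ‖Γ z t₀ - z a‖ := by
    rw [norm_sub_rev]; linarith [hfar t₀ hm₀ a]
  have hrb : 0 < ‖Γ z t₁ - z b‖ := by
    rw [norm_sub_rev]; linarith [hfar t₁ hm₁ b]
  set M : TwistedPath := ⟨t₀, t₁, Γ z, fun t => integrand μ (fun j => ℓ j z t) * deriv (Γ z) t⟩
    with hM
  -- The regularized cycle: a weighted circle at the start, the middle part of the arc, and a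
  -- weighted circle at the end with the opposite sign. The weights make the boundary terms of exact
  -- differentials cancel.
  refine ⟨![P, M, Q.neg], ?_, ?_, ?_⟩
  · have hMa : M.Avoids z := by
      refine ⟨h01, (hreg z hzN).cont, ?_, fun j t ht => (hbr z hzN).ne ht j⟩
      exact (hreg z hzN).int.continuousOn_mul (hbr z hzN).continuousOn_integrand
    intro m
    fin_cases m
    · exact hP1
    · exact hMa
    · exact hQ1.neg
  · intro G hG
    rw [Fin.sum_univ_three]
    simp only [Matrix.cons_val_zero, Matrix.cons_val_one, Matrix.cons_val, TwistedPath.neg_integral]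
    have hGM : ∀ t ∈ uIcc t₀ t₁, AnalyticAt ℂ G (Γ z t) := hG 1
    have eP := hP3 z (fun j => by simpa using hra) G (hG 0)
    have eQ := hQ3 z (fun j => by simpa using hrb) G (hG 2)
    have eM := integral_integrand_mul_exact (μ := μ) (hreg z hzN) (hbr z hzN) hGM
    rw [transport_self μ (fun j => (hbr z hzN).ne left_mem_uIcc j), mul_one] at eP
    rw [transport_self μ (fun j => (hbr z hzN).ne right_mem_uIcc j), mul_one] at eQ
    rw [TwistedPath.integral_congr (g := fun u => deriv G u + G u * logCoeff μ z u)
      fun t ht => by rw [transport_self μ fun j => hP1.ne j t ht, one_mul]] at eP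
    rw [TwistedPath.integral_congr (g := fun u => deriv G u + G u * logCoeff μ z u)
      fun t ht => by rw [transport_self μ fun j => hQ1.ne j t ht, one_mul]] at eQ
    have eM' : M.integral (fun u => deriv G u + G u * logCoeff μ z u) =
        ∫ t in t₀..t₁, integrand μ (fun j => ℓ j z t) *
          (deriv G (Γ z t) + G (Γ z t) * logCoeff μ z (Γ z t)) * deriv (Γ z) t := by
      refine intervalIntegral.integral_congr fun t _ => ?_
      simp only [hM]
      ring
    rw [eP, eQ, eM', eM]
    ring
  · have hball : ∀ᶠ w in 𝓝 z, ∀ j, ‖w j - z j‖ < m := by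
      filter_upwards [Metric.ball_mem_nhds z hm] with w hw j
      exact (norm_le_pi_norm (w - z) j).trans_lt (mem_ball_iff_norm.1 hw)
    have hℓz : ∀ᶠ w in 𝓝 z, ∀ j, ∀ t ∈ Icc t₀ t₁, ‖ℓ j w t - ℓ j z t‖ < 1 :=
      eventually_all.2 fun j => eventually_forall_close hN isCompact_Icc
        ((hℓ j).mono (prod_mono subset_rfl hsub)) one_pos
    filter_upwards [hN, hball, hℓz, eventually_forall_close hN isCompact_Icc hΓ hm]
      with w hwN hwz hwℓ hwΓ g hg
    have hww : ∀ i j, i ≠ j → 6 * d ≤ ‖w i - w j‖ := by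
      intro i j hij
      have h1 : z i - z j = (w i - w j) - (w i - z i) + (w j - z j) := by ring
      have h2 := hsep i j hij
      rw [h1] at h2
      have h3 := (norm_add_le ((w i - w j) - (w i - z i)) (w j - z j))
      have h4 := norm_sub_le (w i - w j) (w i - z i)
      linarith [hwz i, hwz j]
    have hwinj : Function.Injective w := by
      intro i j hij
      by_contra h
      have := hww i j h
      rw [hij, sub_self, norm_zero] at this
      linarith
    have hend : ∀ (τ : ℝ) (k k' : Fin (n + 1)), τ ∈ Icc (0 : ℝ) 1 → z k = Γ z τ →
        w k' = Γ w τ → k' = k := by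
      intro τ k k' hτ h1 h2
      by_contra h
      have h3 := hsep k' k h
      have h4 : z k' - z k = (Γ w τ - Γ z τ) - (w k' - z k') := by rw [h1, h2]; ring
      rw [h4] at h3
      have h5 := norm_sub_le (Γ w τ - Γ z τ) (w k' - z k')
      linarith [hwΓ τ hτ, hwz k']
    have hwa : Γ w 0 = w a := by
      obtain ⟨a', ha'⟩ := (hrel w hwN).source
      rw [← ha', hend 0 a a' ⟨le_rfl, zero_le_one⟩ ha ha']
    have hwb : Γ w 1 = w b := by
      obtain ⟨b', hb'⟩ := (hrel w hwN).target
      rw [← hb', hend 1 b b' ⟨zero_le_one, le_rfl⟩ hb hb']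
    obtain ⟨A, hA, hA0, hAg⟩ := exists_end_primitive (μ := μ) a (hμ a).2
      (fun j hj => hww j a hj) (hg.differentiableOn.analyticOnNhd Metric.isOpen_ball)
    obtain ⟨B, hB, hB0, hBg⟩ := exists_end_primitive (μ := μ) b (hμ b).2
      (fun j hj => hww j b hj) (hg.differentiableOn.analyticOnNhd Metric.isOpen_ball)
    have hnear : ∀ (k : Fin (n + 1)) (u : ℂ), ‖u - z k‖ < 3 * d → u ∈ Metric.ball (w k) (6 * d) := by
      intro k u hu
      rw [mem_ball_iff_norm]
      have h1 : u - w k = (u - z k) - (w k - z k) := by ring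
      rw [h1]
      have h2 := norm_sub_le (u - z k) (w k - z k)
      linarith [hwz k]
    have hI := hasArcIntegral_of_ends hwinj (fun k => (hμ k).2) (hrel w hwN).piecewise
      (ℓ := fun j t => ℓ j w t)
      (fun j => (hℓ j).comp (f := fun t => (w, t)) (by fun_prop) fun t ht => ⟨hwN, ht⟩)
      (fun j t ht => hexp w hwN j t ht) hwa hwb ht₀ h01 ht₁
      (fun t ht => hnear a _ (by
        have h1 : Γ w t - z a = (Γ w t - Γ z t) + (Γ z t - z a) := by ring
        rw [h1]
        have h2 := norm_add_le (Γ w t - Γ z t) (Γ z t - z a)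
        linarith [hwΓ t ⟨ht.1, by linarith [ht.2]⟩, hγ₀ t ht]))
      (fun t ht => hnear b _ (by
        have h1 : Γ w t - z b = (Γ w t - Γ z t) + (Γ z t - z b) := by ring
        rw [h1]
        have h2 := norm_add_le (Γ w t - Γ z t) (Γ z t - z b)
        linarith [hwΓ t ⟨by linarith [ht.1], ht.2⟩, hγ₁ t ht]))
      hg hA hA0 hAg hB hB0 hBg
    obtain ⟨V, hV1, hV2⟩ := exists_homotopy_potential (μ := μ) h01 (hreg z hzN) (hreg w hwN)
      (hbr z hzN) (hbr w hwN) hfar hwz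
      (fun t ht => hwΓ t (Ioo_subset_Icc_self (hsub ht))) hwℓ hg
    have hclose : ∀ τ ∈ Icc t₀ t₁, ∀ u ∈ Metric.ball (Γ z τ) m, ∀ j,
        ‖(w j - u) - (z j - Γ z τ)‖ < ‖z j - Γ z τ‖ := by
      intro τ hτ u hu j
      rw [mem_ball_iff_norm] at hu
      have h1 : (w j - u) - (z j - Γ z τ) = (w j - z j) - (u - Γ z τ) := by ring
      rw [h1]
      have := norm_sub_le (w j - z j) (u - Γ z τ)
      linarith [hfar τ hτ j, hwz j]
    -- The function integrand times G is a primitive on the ball of radius m, so V at either cut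
    -- time compares the w-branch at the moved point with the transported z-branch at the fixed
    -- point.
    have hVend : ∀ τ ∈ Icc t₀ t₁, ∀ (k : Fin (n + 1)) (G : ℂ → ℂ), ‖Γ z τ - z k‖ < d →
        AnalyticOnNhd ℂ G (Metric.ball (w k) (6 * d)) →
        (∀ u ∈ Metric.ball (w k) (6 * d), u ≠ w k → deriv G u + G u * logCoeff μ w u = g u) →
        V τ = integrand μ (fun j => ℓ j w τ) * G (Γ w τ) -
          integrand μ (fun j => ℓ j z τ) * transport μ z w (Γ z τ) * G (Γ z τ) := by
      intro τ hτ k G hk hG hGg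
      have h1 := hV2 τ hτ (fun u => integrand μ
        (fun j => ℓ j z τ + Complex.log ((w j - u) / (z j - Γ z τ))) * G u) (fun u hu => by
          have h2 : u ∈ Metric.ball (w k) (6 * d) := by
            refine hnear k u ?_
            have h3 : u - z k = (u - Γ z τ) + (Γ z τ - z k) := by ring
            rw [h3]
            have h4 := norm_add_le (u - Γ z τ) (Γ z τ - z k)
            linarith [mem_ball_iff_norm.1 hu]
          have h5 : u ≠ w k := by
            have := (ne_zero_of_dist_lt (hclose τ hτ u hu k)).1
            exact (sub_ne_zero.1 this).symm
          rw [← hGg u h2 h5]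
          exact hasDerivAt_integrand_log_mul (hclose τ hτ u hu) (hG u h2))
      rw [h1]
      have h6 : (fun j => ℓ j w τ) =
          fun j => ℓ j z τ + Complex.log ((w j - Γ w τ) / (z j - Γ z τ)) := by
        funext j
        exact eq_add_log_div (hexp z hzN j τ (hsub hτ)) (hexp w hwN j τ (hsub hτ))
          (hclose τ hτ _ (mem_ball_iff_norm.2 (hwΓ τ (Ioo_subset_Icc_self (hsub hτ)))) j)
          (hwℓ j τ hτ)
      rw [h6, integrand_add μ (fun j => ℓ j z τ)
        (fun j => Complex.log ((w j - Γ z τ) / (z j - Γ z τ)))]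
      rfl
    have hLoop : ∀ τ ∈ Icc t₀ t₁, ∀ (k : Fin (n + 1)) (S : TwistedPath) (G : ℂ → ℂ),
        ‖Γ z τ - z k‖ < d → (∀ t, ‖S.c t - z k‖ = ‖Γ z τ - z k‖) → 
        AnalyticOnNhd ℂ G (Metric.ball (w k) (6 * d)) →
        (∀ u ∈ Metric.ball (w k) (6 * d), u ≠ w k → deriv G u + G u * logCoeff μ w u = g u) →
        S.integral (fun u => transport μ z w u * g u) =
          S.integral (fun u => transport μ z w u * (deriv G u + G u * logCoeff μ w u)) ∧
        ∀ t, AnalyticAt ℂ G (S.c t) := by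
      intro τ hτ k S G hk hS hG hGg
      have h1 : ∀ t, S.c t ∈ Metric.ball (w k) (6 * d) := fun t =>
        hnear k _ (by rw [hS]; linarith)
      refine ⟨TwistedPath.integral_congr fun t _ => ?_, fun t => hG _ (h1 t)⟩
      rw [hGg _ (h1 t)]
      intro h2
      have h3 := hS t
      rw [h2, norm_sub_rev (Γ z τ)] at h3
      linarith [hwz k, hfar τ hτ k]
    obtain ⟨p1, p2⟩ := hLoop t₀ hm₀ a P A hda hP2 hA hAg
    obtain ⟨q1, q2⟩ := hLoop t₁ hm₁ b Q B hdb hQ2 hB hBg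
    have hmr : ∀ τ ∈ Icc t₀ t₁, ∀ k j, ‖w j - z j‖ < ‖Γ z τ - z k‖ := by
      intro τ hτ k j
      rw [norm_sub_rev (Γ z τ)]
      linarith [hwz j, hfar τ hτ k]
    rw [hP3 w (hmr t₀ hm₀ a) A fun t _ => p2 t] at p1
    rw [hQ3 w (hmr t₁ hm₁ b) B fun t _ => q2 t] at q1
    convert hI using 1
    rw [Fin.sum_univ_three]
    simp only [Matrix.cons_val_zero, Matrix.cons_val_one, Matrix.cons_val, TwistedPath.neg_integral]
    rw [p1, q1]
    have v0 := hVend t₀ hm₀ a A hda hA hAg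
    have v1 := hVend t₁ hm₁ b B hdb hB hBg
    have hMi : M.integral (fun u => transport μ z w u * g u) =
        ∫ t in t₀..t₁, integrand μ (fun j => ℓ j z t) * deriv (Γ z) t *
          (transport μ z w (Γ z t) * g (Γ z t)) := rfl
    rw [hMi]
    -- The circles contribute the boundary values of the transported branch at the fixed cut points,
    -- while `hI` has those of the w-branch at the moved ones. The corrections V t₀ and V t₁ cancel
    -- the difference of the middle integrals.
    linear_combination (-1 : ℂ) * hV1 + v0 - v1

/-! ### Analytic dependence on the branch points -/

/-- The power `x ↦ (1 + x) ^ a` is analytic at the origin of an algebra of continuous functions. -/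
theorem exists_analyticAt_one_add_cpow (X : Type*) [TopologicalSpace X] [CompactSpace X]
    [Nonempty X] (a : ℂ) : ∃ f : C(X, ℂ) → C(X, ℂ), AnalyticAt ℂ f 0 ∧
      ∀ x : C(X, ℂ), ‖x‖ < 1 → ∀ t, f x t = (1 + x t) ^ a := by
  -- The coefficients have the same norms as those of the complex binomial series, so the radius of
  -- convergence is at least 1 in this Banach algebra too; evaluation at a point then gives the
  -- usual power.
  set p := binomialSeries C(X, ℂ) a with hp
  have hr : 1 ≤ p.radius := by
    refine (binomialSeries_radius_ge_one (𝔸 := ℂ) (a := a)).trans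
      (FormalMultilinearSeries.radius_le_of_le fun n => ?_)
    rw [hp, binomialSeries, binomialSeries, FormalMultilinearSeries.ofScalars_norm,
      FormalMultilinearSeries.ofScalars_norm]
  have hpos : 0 < p.radius := zero_lt_one.trans_le hr
  refine ⟨p.sum, (p.hasFPowerSeriesOnBall hpos).analyticAt, fun x hx t => ?_⟩
  have hxe : x ∈ Metric.eball (0 : C(X, ℂ)) p.radius := by
    rw [mem_eball_zero_iff]
    refine lt_of_lt_of_le ?_ hr
    rw [← ofReal_norm, ENNReal.ofReal_lt_one]
    exact hx
  have h1 := (p.hasSum hxe).mapL (ContinuousMap.evalCLM ℂ t)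
  have hxt : x t ∈ Metric.eball (0 : ℂ) 1 := by
    rw [mem_eball_zero_iff, ← ofReal_norm, ENNReal.ofReal_lt_one]
    exact (x.norm_coe_le_norm t).trans_lt hx
  have h2 := Complex.one_add_cpow_hasFPowerSeriesOnBall_zero (a := a).hasSum hxt
  rw [zero_add] at h2
  refine h1.unique ?_
  refine h2.congr_fun fun n => ?_
  rw [hp, binomialSeries_apply, binomialSeries_apply]
  simp

/-- The integration functional of a twisted path on continuous functions of the parameter. -/
theorem exists_pathFunctional {ρ : ℝ → ℂ} {a b : ℝ} (hab : a ≤ b)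
    (hρ : IntervalIntegrable ρ MeasureTheory.volume a b) :
    ∃ Δ : C(Icc a b, ℂ) →L[ℂ] ℂ, ∀ (f : C(Icc a b, ℂ)) (g : ℝ → ℂ), (∀ t, f t = g t) →
      Δ f = ∫ t in a..b, ρ t * g t := by
  have hint : ∀ f : C(Icc a b, ℂ), IntervalIntegrable
      (fun t => ρ t * f (projIcc a b hab t)) MeasureTheory.volume a b :=
    fun f => hρ.mul_continuousOn (f.continuous.comp continuous_projIcc).continuousOn
  have hadd : ∀ f g : C(Icc a b, ℂ), ∫ t in a..b, ρ t * (f + g) (projIcc a b hab t) =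
      (∫ t in a..b, ρ t * f (projIcc a b hab t)) + ∫ t in a..b, ρ t * g (projIcc a b hab t) := by
    intro f g
    rw [← intervalIntegral.integral_add (hint f) (hint g)]
    refine intervalIntegral.integral_congr fun t _ => ?_
    simp only [ContinuousMap.add_apply]
    ring
  have hsmul : ∀ (c : ℂ) (f : C(Icc a b, ℂ)), ∫ t in a..b, ρ t * (c • f) (projIcc a b hab t) =
      c • ∫ t in a..b, ρ t * f (projIcc a b hab t) := by
    intro c f
    rw [smul_eq_mul, ← intervalIntegral.integral_const_mul]
    refine intervalIntegral.integral_congr fun t _ => ?_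
    simp only [ContinuousMap.smul_apply, smul_eq_mul]
    ring
  have hbound : ∀ f : C(Icc a b, ℂ), ‖∫ t in a..b, ρ t * f (projIcc a b hab t)‖ ≤
      |∫ t in a..b, ‖ρ t‖| * ‖f‖ := by
    intro f
    have h1 := intervalIntegral.norm_integral_le_abs_of_norm_le
      (f := fun t => ρ t * f (projIcc a b hab t))
      (g := fun t => ‖ρ t‖ * ‖f‖) (μ := MeasureTheory.volume) (a := a) (b := b)
      (MeasureTheory.ae_of_all _ fun t => by
        rw [norm_mul]
        exact mul_le_mul_of_nonneg_left (f.norm_coe_le_norm _) (norm_nonneg _))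
      (hρ.norm.mul_const _)
    rw [intervalIntegral.integral_mul_const, abs_mul, abs_norm] at h1
    exact h1
  let L : C(Icc a b, ℂ) →ₗ[ℂ] ℂ := ⟨⟨fun f => ∫ t in a..b, ρ t * f (projIcc a b hab t), hadd⟩, hsmul⟩
  refine ⟨⟨L, AddMonoidHomClass.continuous_of_bound L _ hbound⟩, fun f g hfg => ?_⟩
  refine intervalIntegral.integral_congr fun t ht => ?_
  rw [uIcc_of_le hab] at ht
  simp only [projIcc_of_mem hab ht, hfg]

/-- The partial derivative of a function on `ℂⁿ⁺¹`. -/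
noncomputable def pderiv {n : ℕ} (i : Fin (n + 1)) (f : (Fin (n + 1) → ℂ) → ℂ)
    (w : Fin (n + 1) → ℂ) : ℂ := fderiv ℂ f w (Pi.single i 1)

theorem hasFDerivAt_transport {n : ℕ} {μ : Fin (n + 1) → ℝ} {z w : Fin (n + 1) → ℂ} {u : ℂ}
    (h : ∀ j, ‖w j - z j‖ < ‖z j - u‖) :
    HasFDerivAt (fun w => transport μ z w u)
      (transport μ z w u • -∑ j, ((μ j : ℂ) / (w j - u)) •
        ContinuousLinearMap.proj (R := ℂ) (φ := fun _ : Fin (n + 1) => ℂ) j) w := by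
  have hd : ∀ j, ‖(w j - u) - (z j - u)‖ < ‖z j - u‖ := fun j => by
    rw [sub_sub_sub_cancel_right]; exact h j
  have h1 : ∀ j, HasFDerivAt (fun w : Fin (n + 1) → ℂ => (μ j : ℂ) * Complex.log ((w j - u) / (z j - u)))
      (((μ j : ℂ) / (w j - u)) • ContinuousLinearMap.proj (R := ℂ)
        (φ := fun _ : Fin (n + 1) => ℂ) j) w := by
    intro j
    obtain ⟨a1, a2⟩ := ne_zero_of_dist_lt (hd j)
    have h2 : HasFDerivAt (fun w : Fin (n + 1) → ℂ => (w j - u) / (z j - u))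
        ((z j - u)⁻¹ • ContinuousLinearMap.proj (R := ℂ) (φ := fun _ : Fin (n + 1) => ℂ) j) w := by
      have h3 := ((hasFDerivAt_apply (𝕜 := ℂ) j w).sub_const u).const_mul (z j - u)⁻¹
      simpa only [div_eq_inv_mul] using h3
    refine ((h2.clog (div_mem_slitPlane_of_dist_lt (hd j))).const_mul (μ j : ℂ)).congr_fderiv ?_
    rw [smul_smul, smul_smul]
    congr 1
    field_simp
  have h4 : HasFDerivAt (fun w : Fin (n + 1) → ℂ =>
      -∑ j, (μ j : ℂ) * Complex.log ((w j - u) / (z j - u)))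
      (-∑ j, ((μ j : ℂ) / (w j - u)) • ContinuousLinearMap.proj (R := ℂ)
        (φ := fun _ : Fin (n + 1) => ℂ) j) w :=
    (HasFDerivAt.fun_sum fun j _ => h1 j).fun_neg
  simp only [transport, integrand]
  exact h4.cexp

theorem pderiv_transport {n : ℕ} {μ : Fin (n + 1) → ℝ} {z w : Fin (n + 1) → ℂ} {u : ℂ}
    (h : ∀ j, ‖w j - z j‖ < ‖z j - u‖) (i : Fin (n + 1)) :
    pderiv i (fun w => transport μ z w u) w = transport μ z w u * (-(μ i : ℂ) / (w i - u)) := by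
  rw [pderiv, (hasFDerivAt_transport h).fderiv]
  simp [Pi.single_apply, neg_div]

theorem pderiv_pderiv_transport {n : ℕ} {μ : Fin (n + 1) → ℝ} {z w : Fin (n + 1) → ℂ} {u : ℂ}
    (h : ∀ j, ‖w j - z j‖ < ‖z j - u‖) {i j : Fin (n + 1)} (hij : i ≠ j) :
    pderiv j (fun w => transport μ z w u * (-(μ i : ℂ) / (w i - u))) w =
      transport μ z w u * (-(μ i : ℂ) / (w i - u)) * (-(μ j : ℂ) / (w j - u)) := by
  have hne : w i - u ≠ 0 := (ne_zero_of_dist_lt (b := z i - u) (by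
    rw [sub_sub_sub_cancel_right]; exact h i)).1
  have h1 : HasFDerivAt (fun w : Fin (n + 1) → ℂ => w i - u)
      (ContinuousLinearMap.proj (R := ℂ) (φ := fun _ : Fin (n + 1) => ℂ) i) w :=
    (hasFDerivAt_apply (𝕜 := ℂ) i w).sub_const u
  have h2 := (hasFDerivAt_transport (μ := μ) h).fun_mul (((hasDerivAt_inv hne).comp_hasFDerivAt w h1).const_mul (-(μ i : ℂ)))
  simp only [Function.comp_def, ← div_eq_mul_inv] at h2
  rw [pderiv, h2.fderiv]
  simp [Pi.single_apply, hij]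
  ring

/-- The transport T is a quotient of the integrands of w and z, so T' + T · `logCoeff μ z` = T ·
`logCoeff μ w`. Relations exact with respect to z thereby become relations for w on the same paths.
-/
theorem hasDerivAt_transport {n : ℕ} {μ : Fin (n + 1) → ℝ} {z w : Fin (n + 1) → ℂ} {u : ℂ}
    (h : ∀ j, ‖w j - z j‖ < ‖z j - u‖) :
    AnalyticAt ℂ (transport μ z w) u ∧
    deriv (transport μ z w) u = transport μ z w u * (logCoeff μ w u - logCoeff μ z u) := by
  have hd : ∀ j, ‖(w j - u) - (z j - u)‖ < ‖z j - u‖ := fun j => by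
    rw [sub_sub_sub_cancel_right]; exact h j
  have h1 : ∀ j, HasDerivAt (fun u => (μ j : ℂ) * Complex.log ((w j - u) / (z j - u)))
      ((μ j : ℂ) / (z j - u) - (μ j : ℂ) / (w j - u)) u := by
    intro j
    obtain ⟨a1, a2⟩ := ne_zero_of_dist_lt (hd j)
    have h2 := (((hasDerivAt_id u).const_sub (w j)).fun_div ((hasDerivAt_id u).const_sub (z j)) a2)
    refine ((h2.clog (div_mem_slitPlane_of_dist_lt (hd j))).const_mul (μ j : ℂ)).congr_deriv ?_
    simp only [id]
    field_simp
    ring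
  constructor
  · have h3 : ∀ j, AnalyticAt ℂ (fun u => (μ j : ℂ) * Complex.log ((w j - u) / (z j - u))) u := by
      intro j
      refine analyticAt_const.mul (AnalyticAt.clog ?_ (div_mem_slitPlane_of_dist_lt (hd j)))
      exact (analyticAt_const.sub analyticAt_id).div (analyticAt_const.sub analyticAt_id)
        (ne_zero_of_dist_lt (hd j)).2
    exact (Finset.analyticAt_fun_sum _ fun j _ => h3 j).neg.cexp'
  · have h4 : HasDerivAt (fun u => -∑ j, (μ j : ℂ) * Complex.log ((w j - u) / (z j - u)))
        (logCoeff μ w u - logCoeff μ z u) u := by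
      refine (HasDerivAt.fun_sum fun j _ => h1 j).fun_neg.congr_deriv ?_
      rw [logCoeff, logCoeff, Finset.sum_sub_distrib]
      ring
    exact h4.cexp.deriv

/-- The integral over a twisted path of the transported integrand is analytic in `w`; its
derivatives are obtained by differentiation of the integrand. -/
theorem TwistedPath.Avoids.integral_transport {n : ℕ} {μ : Fin (n + 1) → ℝ}
    {z : Fin (n + 1) → ℂ} {P : TwistedPath} (hP : P.Avoids z) :
    AnalyticAt ℂ (fun w => P.integral (transport μ z w)) z ∧
    (∀ᶠ w in 𝓝 z, (∀ t ∈ uIcc P.a P.b, ∀ j, ‖w j - z j‖ < ‖z j - P.c t‖) ∧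
      DifferentiableAt ℂ (fun w => P.integral (transport μ z w)) w ∧
      (∀ i, DifferentiableAt ℂ (pderiv i (fun w => P.integral (transport μ z w))) w) ∧
      (∀ i, pderiv i (fun w => P.integral (transport μ z w)) w =
        P.integral (fun u => transport μ z w u * (-(μ i : ℂ) / (w i - u)))) ∧
      ∀ i j, (w i - w j) * pderiv j (pderiv i (fun w => P.integral (transport μ z w))) w =
        μ j * pderiv i (fun w => P.integral (transport μ z w)) w -
        μ i * pderiv j (fun w => P.integral (transport μ z w)) w) := by
  have hle := hP.le
  have hcont := hP.cont
  have hne := hP.ne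
  rw [uIcc_of_le hle] at hcont hne ⊢
  have hnonempty : Nonempty (Icc P.a P.b) := ⟨⟨P.a, left_mem_Icc.2 hle⟩⟩
  obtain ⟨Δ, hΔ⟩ := exists_pathFunctional hle hP.int
  have hcont' : Continuous fun t : Icc P.a P.b => P.c t :=
    continuousOn_iff_continuous_domRestrict.1 hcont
  choose f hf hf' using fun j : Fin (n + 1) => exists_analyticAt_one_add_cpow (Icc P.a P.b) (-(μ j : ℂ))
  let κ : Fin (n + 1) → C(Icc P.a P.b, ℂ) := fun j =>
    ⟨fun t => (z j - P.c t)⁻¹, (continuous_const.sub hcont').inv₀ fun t => hne j t t.2⟩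
  -- The transported integrand along the path, viewed as a product of powers (1 + (wⱼ - zⱼ)κⱼ)^(-μⱼ)
  -- in the Banach algebra of continuous functions on the parameter interval. It is analytic in w
  -- with values in that algebra, so differentiation under the integral is composition with the
  -- continuous functional Δ.
  set q : (Fin (n + 1) → ℂ) → C(Icc P.a P.b, ℂ) := fun w => ∏ j, f j ((w j - z j) • κ j) with hq
  have hA : ∀ j, AnalyticAt ℂ (fun w : Fin (n + 1) → ℂ => (w j - z j) • κ j) z := by
    intro j
    let M := (ContinuousLinearMap.proj (R := ℂ) (φ := fun _ : Fin (n + 1) => ℂ) j).smulRight (κ j)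
    have h1 : (fun w : Fin (n + 1) → ℂ => (w j - z j) • κ j) = fun w => M w - M z := by
      funext w
      exact sub_smul (w j) (z j) (κ j)
    rw [h1]
    exact (M.analyticAt z).sub analyticAt_const
  have h0 : ∀ j, (z j - z j) • κ j = 0 := fun j => by
    ext t
    simp
  have hqa : AnalyticAt ℂ q z := by
    refine Finset.analyticAt_fun_prod _ fun j _ => ?_
    refine AnalyticAt.fun_comp (g := f j) ?_ (hA j)
    rw [h0]
    exact hf j
  have hsmall : ∀ᶠ w in 𝓝 z, ∀ j, ‖(w j - z j) • κ j‖ < 1 := by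
    refine eventually_all.2 fun j => ?_
    have h1 : Tendsto (fun w : Fin (n + 1) → ℂ => ‖(w j - z j) • κ j‖) (𝓝 z) (𝓝 0) := by
      have := (hA j).continuousAt.norm
      rw [ContinuousAt, h0, norm_zero] at this
      exact this
    exact h1.eventually (gt_mem_nhds one_pos)
  have hlt : ∀ w : Fin (n + 1) → ℂ, (∀ j, ‖(w j - z j) • κ j‖ < 1) → ∀ t ∈ Icc P.a P.b, ∀ j,
      ‖w j - z j‖ < ‖z j - P.c t‖ := by
    intro w hw t ht j
    have h1 := ((((w j - z j) • κ j).norm_coe_le_norm ⟨t, ht⟩)).trans_lt (hw j)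
    simp only [ContinuousMap.smul_apply, smul_eq_mul, norm_mul, κ, ContinuousMap.coe_mk,
      norm_inv] at h1
    have h2 : 0 < ‖z j - P.c t‖ := norm_pos_iff.2 (hne j t ht)
    rwa [← div_eq_mul_inv, div_lt_one h2] at h1
  have hqt : ∀ w : Fin (n + 1) → ℂ, (∀ j, ‖(w j - z j) • κ j‖ < 1) →
      ∀ t : Icc P.a P.b, q w t = transport μ z w (P.c t) := by
    intro w hw t
    rw [hq, transport, integrand, ← Finset.sum_neg_distrib, Complex.exp_sum]
    simp only [ContinuousMap.prod_apply]
    refine Finset.prod_congr rfl fun j _ => ?_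
    rw [hf' j _ (hw j)]
    have h2 := hne j t t.2
    have h3 : 1 + ((w j - z j) • κ j) t = (w j - P.c t) / (z j - P.c t) := by
      simp only [ContinuousMap.smul_apply, smul_eq_mul, κ, ContinuousMap.coe_mk]
      field_simp
      ring
    have h4 := (ne_zero_of_dist_lt (a := w j - P.c t) (b := z j - P.c t) (by
      rw [sub_sub_sub_cancel_right]; exact hlt w hw t t.2 j)).1
    rw [h3, Complex.cpow_def_of_ne_zero (div_ne_zero h4 h2)]
    congr 1
    ring
  set F : (Fin (n + 1) → ℂ) → ℂ := fun w => P.integral (transport μ z w) with hF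
  have hFΔ : F =ᶠ[𝓝 z] fun w => Δ (q w) := by
    filter_upwards [hsmall] with w hw
    exact (hΔ _ _ (hqt w hw)).symm
  have hDa : ∀ i, AnalyticAt ℂ (fun w => fderiv ℂ q w (Pi.single i 1)) z := by
    intro i
    let E := ContinuousLinearMap.apply ℂ C(Icc P.a P.b, ℂ) (Pi.single i 1 : Fin (n + 1) → ℂ)
    have h1 : AnalyticAt ℂ (fun w => E (fderiv ℂ q w)) z := (E.analyticAt _).fun_comp hqa.fderiv
    exact h1
  refine ⟨((Δ.analyticAt _).fun_comp hqa).congr hFΔ.symm, ?_⟩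
  have hS : ∀ᶠ w in 𝓝 z, (∀ j, ‖(w j - z j) • κ j‖ < 1) ∧ F w = Δ (q w) ∧ AnalyticAt ℂ q w ∧
      ∀ i, AnalyticAt ℂ (fun w => fderiv ℂ q w (Pi.single i 1)) w :=
    hsmall.and (hFΔ.and (hqa.eventually_analyticAt.and
      (eventually_all.2 fun i => (hDa i).eventually_analyticAt)))
  have hpd : ∀ᶠ w in 𝓝 z, ∀ i, pderiv i F w = Δ (fderiv ℂ q w (Pi.single i 1)) := by
    filter_upwards [hS.eventually_nhds] with w hw i
    have h1 : F =ᶠ[𝓝 w] fun w => Δ (q w) := hw.mono fun v hv => hv.2.1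
    have h2 : HasFDerivAt (fun w => Δ (q w)) (Δ.comp (fderiv ℂ q w)) w :=
      Δ.hasFDerivAt.comp w hw.self_of_nhds.2.2.1.differentiableAt.hasFDerivAt
    rw [pderiv, h1.fderiv_eq, h2.fderiv]
    rfl
  have hval : ∀ w, (∀ᶠ v in 𝓝 w, (∀ j, ‖(v j - z j) • κ j‖ < 1)) → AnalyticAt ℂ q w → ∀ i t,
      fderiv ℂ q w (Pi.single i 1) t =
        transport μ z w (P.c t) * (-(μ i : ℂ) / (w i - P.c t)) := by
    intro w hw hqw i t
    have h1 : fderiv ℂ q w (Pi.single i 1) t = pderiv i (fun v => q v t) w := by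
      have := ((ContinuousMap.evalCLM ℂ t : C(Icc P.a P.b, ℂ) →L[ℂ] ℂ).hasFDerivAt.comp w
        hqw.differentiableAt.hasFDerivAt).fderiv
      rw [pderiv]
      exact (congrArg (fun L => L (Pi.single i 1)) this).symm
    rw [h1, ← pderiv_transport (hlt w hw.self_of_nhds t t.2), pderiv, pderiv]
    congr 1
    refine Filter.EventuallyEq.fderiv_eq ?_
    filter_upwards [hw] with v hv using hqt v hv t
  filter_upwards [hS.eventually_nhds, hpd.eventually_nhds] with w hw hpw
  have hw0 := hw.self_of_nhds
  have hsm : ∀ᶠ v in 𝓝 w, (∀ j, ‖(v j - z j) • κ j‖ < 1) := hw.mono fun v hv => hv.1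
  have hder : ∀ i, HasFDerivAt (pderiv i F) (Δ.comp (fderiv ℂ
      (fun w => fderiv ℂ q w (Pi.single i 1)) w)) w := by
    intro i
    refine (Δ.hasFDerivAt.comp w (hw0.2.2.2 i).differentiableAt.hasFDerivAt).congr_of_eventuallyEq ?_
    filter_upwards [hpw] with v hv using hv i
  refine ⟨hlt w hw0.1, ?_, fun i => (hder i).differentiableAt, ?_, ?_⟩
  · have h1 : F =ᶠ[𝓝 w] fun w => Δ (q w) := hw.mono fun v hv => hv.2.1
    exact ((Δ.hasFDerivAt.comp w hw0.2.2.1.differentiableAt.hasFDerivAt).congr_of_eventuallyEq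
      h1).differentiableAt
  · intro i
    rw [hpw.self_of_nhds i]
    exact hΔ _ (fun t => transport μ z w (P.c t) * (-(μ i : ℂ) / (w i - P.c t)))
      (hval w hsm hw0.2.2.1 i)
  · intro i j
    rcases eq_or_ne i j with rfl | hij
    · ring
    rw [hpw.self_of_nhds i, hpw.self_of_nhds j, pderiv, (hder i).fderiv]
    -- The Euler-Poisson-Darboux equation already holds for the integrand at each point u of the
    -- path, by the partial fraction identity (wᵢ - wⱼ)/((wᵢ - u)(wⱼ - u)) = 1/(wⱼ - u) - 1/(wᵢ -
    -- u).
    have key : (w i - w j) • (fderiv ℂ (fun w => fderiv ℂ q w (Pi.single i 1)) w) (Pi.single j 1) =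
        (μ j : ℂ) • fderiv ℂ q w (Pi.single i 1) - (μ i : ℂ) • fderiv ℂ q w (Pi.single j 1) := by
      ext t
      have h1 : (fderiv ℂ (fun w => fderiv ℂ q w (Pi.single i 1)) w) (Pi.single j 1) t =
          pderiv j (fun v => fderiv ℂ q v (Pi.single i 1) t) w := by
        have := ((ContinuousMap.evalCLM ℂ t : C(Icc P.a P.b, ℂ) →L[ℂ] ℂ).hasFDerivAt.comp w
          (hw0.2.2.2 i).differentiableAt.hasFDerivAt).fderiv
        rw [pderiv]
        exact (congrArg (fun L => L (Pi.single j 1)) this).symm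
      have h2 : pderiv j (fun v => fderiv ℂ q v (Pi.single i 1) t) w =
          pderiv j (fun w => transport μ z w (P.c t) * (-(μ i : ℂ) / (w i - P.c t))) w := by
        rw [pderiv, pderiv]
        congr 1
        refine Filter.EventuallyEq.fderiv_eq ?_
        filter_upwards [hw.eventually_nhds] with v hv
        exact hval v (hv.mono fun _ h => h.1) hv.self_of_nhds.2.2.1 i t
      simp only [ContinuousMap.smul_apply, ContinuousMap.sub_apply, smul_eq_mul]
      rw [h1, h2, pderiv_pderiv_transport (hlt w hw0.1 t t.2) hij, hval w hsm hw0.2.2.1 i,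
        hval w hsm hw0.2.2.1 j]
      have hn : ∀ k, w k - P.c t ≠ 0 := fun k =>
        (ne_zero_of_dist_lt (b := z k - P.c t) (by
          rw [sub_sub_sub_cancel_right]; exact hlt w hw0.1 t t.2 k)).1
      have hni := hn i
      have hnj := hn j
      field_simp
      ring
    have h3 := congrArg Δ key
    rw [map_smul, map_sub, map_smul, map_smul] at h3
    exact h3

theorem TwistedPath.Avoids.intervalIntegrable {n : ℕ} {z : Fin (n + 1) → ℂ} {P : TwistedPath}
    (hP : P.Avoids z) {f : ℂ → ℂ} (hf : ContinuousOn (fun t => f (P.c t)) (uIcc P.a P.b)) :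
    IntervalIntegrable (fun t => P.ρ t * f (P.c t)) MeasureTheory.volume P.a P.b :=
  hP.int.mul_continuousOn hf

theorem TwistedPath.integral_const_mul (P : TwistedPath) (c : ℂ) (f : ℂ → ℂ) :
    P.integral (fun u => c * f u) = c * P.integral f := by
  rw [TwistedPath.integral, TwistedPath.integral, ← intervalIntegral.integral_const_mul]
  congr 1
  funext t
  ring

theorem TwistedPath.Avoids.integral_add {n : ℕ} {z : Fin (n + 1) → ℂ} {P : TwistedPath}
    (hP : P.Avoids z) {f g : ℂ → ℂ} (hf : ContinuousOn (fun t => f (P.c t)) (uIcc P.a P.b))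
    (hg : ContinuousOn (fun t => g (P.c t)) (uIcc P.a P.b)) :
    P.integral (fun u => f u + g u) = P.integral f + P.integral g := by
  rw [TwistedPath.integral, TwistedPath.integral, TwistedPath.integral,
    ← intervalIntegral.integral_add (hP.intervalIntegrable hf) (hP.intervalIntegrable hg)]
  congr 1
  funext t
  ring

theorem TwistedPath.Avoids.integral_sum {n : ℕ} {z : Fin (n + 1) → ℂ} {P : TwistedPath}
    (hP : P.Avoids z) {ι : Type*} (s : Finset ι) {f : ι → ℂ → ℂ}
    (hf : ∀ i, ContinuousOn (fun t => f i (P.c t)) (uIcc P.a P.b)) :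
    P.integral (fun u => ∑ i ∈ s, f i u) = ∑ i ∈ s, P.integral (f i) := by
  simp only [TwistedPath.integral]
  rw [← intervalIntegral.integral_finsetSum fun i _ => hP.intervalIntegrable (hf i)]
  congr 1
  funext t
  rw [Finset.mul_sum]

theorem HasArcIntegral.congr {γ γ' ψ ψ' : ℝ → ℂ} {I : ℂ} (h : HasArcIntegral γ ψ I)
    (hγ : ∀ t ∈ Ioo (0 : ℝ) 1, γ t = γ' t) (hψ : ∀ t ∈ Ioo (0 : ℝ) 1, ψ t = ψ' t) :
    HasArcIntegral γ' ψ' I := by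
  refine Tendsto.congr' ?_ h
  have h0 : ∀ᶠ s in 𝓝[>] (0 : ℝ), s ∈ Ioo (0 : ℝ) 1 := Ioo_mem_nhdsGT one_pos
  have h1 : ∀ᶠ s in 𝓝[<] (1 : ℝ), s ∈ Ioo (0 : ℝ) 1 := Ioo_mem_nhdsLT one_pos
  filter_upwards [h0.prod_mk h1] with p hp
  refine intervalIntegral.integral_congr fun t ht => ?_
  have ht' : t ∈ Ioo (0 : ℝ) 1 := ordConnected_Ioo.uIcc_subset hp.1 hp.2 ht
  have h2 : γ =ᶠ[𝓝 t] γ' := by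
    filter_upwards [Ioo_mem_nhds ht'.1 ht'.2] with s hs using hγ s hs
  simp only [hψ t ht', h2.deriv_eq]

theorem HasArcIntegral.unique {γ ψ : ℝ → ℂ} {I J : ℂ} (h : HasArcIntegral γ ψ I)
    (h' : HasArcIntegral γ ψ J) : I = J := tendsto_nhds_unique h h'

/-! ### The differential equations and their analytic continuation -/

/-- The system of differential equations satisfied by the Lauricella functions. -/
structure IsSolutionAt {n : ℕ} (μ : Fin (n + 1) → ℝ) (z : Fin (n + 1) → ℂ)
    (f : (Fin (n + 1) → ℂ) → ℂ) : Prop where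
  analytic : AnalyticAt ℂ f z
  translation : ∀ᶠ w in 𝓝 z, ∑ i, pderiv i f w = 0
  homogeneity : ∀ᶠ w in 𝓝 z, ∑ i, w i * pderiv i f w - (1 - ∑ i, (μ i : ℂ)) * f w = 0
  epd : ∀ i j, ∀ᶠ w in 𝓝 z, (w i - w j) * pderiv j (pderiv i f) w -
    (μ j * pderiv i f w - μ i * pderiv j f w) = 0

/-- With T the transport, exactness for G = T gives the translation equation. Exactness for G = uT
gives homogeneity, since ∑ wᵢμᵢ/(wᵢ - u) = |μ| + u · `logCoeff μ w u`. The remaining equations hold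
on each path separately. -/
theorem isSolutionAt_chain {n : ℕ} {μ : Fin (n + 1) → ℝ} {z : Fin (n + 1) → ℂ}
    {C : Fin 3 → TwistedPath} (hC : ∀ m, (C m).Avoids z)
    (hex : ∀ G : ℂ → ℂ, (∀ m, ∀ t ∈ uIcc (C m).a (C m).b, AnalyticAt ℂ G ((C m).c t)) →
        ∑ m, (C m).integral (fun u => deriv G u + G u * logCoeff μ z u) = 0) :
    IsSolutionAt μ z (fun w => ∑ m, (C m).integral (transport μ z w)) := by
  set f : Fin 3 → (Fin (n + 1) → ℂ) → ℂ := fun m w => (C m).integral (transport μ z w)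
  have hev := eventually_all.2 fun m => ((hC m).integral_transport (μ := μ)).2
  have hpd : ∀ᶠ w in 𝓝 z, ∀ i, pderiv i (fun w => ∑ m, f m w) w = ∑ m, pderiv i (f m) w := by
    filter_upwards [hev] with w hw i
    rw [pderiv, fderiv_fun_sum fun m _ => (hw m).2.1, _root_.sum_apply]
    rfl
  have hcont : ∀ m, ∀ w : Fin (n + 1) → ℂ, (∀ t ∈ uIcc (C m).a (C m).b, ∀ j,
      ‖w j - z j‖ < ‖z j - (C m).c t‖) → (ContinuousOn (fun t => transport μ z w ((C m).c t))
        (uIcc (C m).a (C m).b)) ∧ ∀ j, (ContinuousOn (fun t => transport μ z w ((C m).c t) *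
        (-(μ j : ℂ) / (w j - (C m).c t))) (uIcc (C m).a (C m).b)) := by
    intro m w hw
    have h1 : ContinuousOn (fun t => transport μ z w ((C m).c t)) (uIcc (C m).a (C m).b) :=
      fun t ht => (hasDerivAt_transport (hw t ht)).1.continuousAt.comp_continuousWithinAt
        ((hC m).cont t ht)
    refine ⟨h1, fun j => h1.mul (continuousOn_const.div (continuousOn_const.sub (hC m).cont)
      fun t ht => ?_)⟩
    exact (ne_zero_of_dist_lt (b := z j - (C m).c t) (by
      rw [sub_sub_sub_cancel_right]; exact hw t ht j)).1
  refine ⟨Finset.analyticAt_fun_sum _ fun m _ => (hC m).integral_transport.1, ?_, ?_, ?_⟩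
  · filter_upwards [hev, hpd] with w hw hpw
    simp only [hpw, fun m i => (hw m).2.2.2.1 i, f]
    rw [Finset.sum_comm, ← neg_eq_zero, ← hex (transport μ z w) fun m t ht =>
      (hasDerivAt_transport ((hw m).1 t ht)).1, ← Finset.sum_neg_distrib]
    refine Finset.sum_congr rfl fun m _ => ?_
    rw [← (hC m).integral_sum _ (hcont m w (hw m).1).2, neg_eq_neg_one_mul,
      ← TwistedPath.integral_const_mul]
    refine TwistedPath.integral_congr fun t ht => ?_
    rw [(hasDerivAt_transport ((hw m).1 t ht)).2, ← Finset.mul_sum]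
    simp only [logCoeff, neg_div, Finset.sum_neg_distrib]
    ring
  · filter_upwards [hev, hpd] with w hw hpw
    have hG : ∀ m, ∀ t ∈ uIcc (C m).a (C m).b, AnalyticAt ℂ (fun u => u * transport μ z w u)
        ((C m).c t) := fun m t ht => analyticAt_id.mul (hasDerivAt_transport ((hw m).1 t ht)).1
    simp only [hpw, fun m i => (hw m).2.2.2.1 i, f]
    rw [← neg_eq_zero, ← hex _ hG]
    simp only [Finset.mul_sum]
    rw [Finset.sum_comm, ← Finset.sum_sub_distrib, ← Finset.sum_neg_distrib]
    refine Finset.sum_congr rfl fun m _ => ?_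
    simp only [← TwistedPath.integral_const_mul]
    have hc := hcont m w (hw m).1
    have h1 : ∀ i, ContinuousOn (fun t => w i * (transport μ z w ((C m).c t) *
        (-(μ i : ℂ) / (w i - (C m).c t)))) (uIcc (C m).a (C m).b) :=
      fun i => continuousOn_const.mul (hc.2 i)
    have h2 := (hC m).integral_sum Finset.univ
      (f := fun i u => w i * (transport μ z w u * (-(μ i : ℂ) / (w i - u)))) h1
    have h3 := (hC m).integral_add (f := fun u => (1 - ∑ i, (μ i : ℂ)) * transport μ z w u)
      (g := fun u => (-1) * ∑ i, w i * (transport μ z w u * (-(μ i : ℂ) / (w i - u))))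
      (continuousOn_const.mul hc.1)
      (continuousOn_const.mul (continuousOn_finsetSum _ fun i _ => h1 i))
    rw [← h2, neg_sub, sub_eq_add_neg, neg_eq_neg_one_mul (TwistedPath.integral _ _),
      ← TwistedPath.integral_const_mul, ← h3]
    refine TwistedPath.integral_congr fun t ht => ?_
    have ha := hasDerivAt_transport (μ := μ) ((hw m).1 t ht)
    have hd : deriv (fun u => u * transport μ z w u) ((C m).c t) =
        1 * transport μ z w ((C m).c t) + (C m).c t * deriv (transport μ z w) ((C m).c t) :=
      ((hasDerivAt_id _).fun_mul ha.1.differentiableAt.hasDerivAt).deriv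
    have hs : ∑ i, w i * (transport μ z w ((C m).c t) * (-(μ i : ℂ) / (w i - (C m).c t))) =
        transport μ z w ((C m).c t) * (-∑ i, (μ i : ℂ) - (C m).c t * logCoeff μ w ((C m).c t)) := by
      rw [logCoeff, Finset.mul_sum, ← Finset.sum_neg_distrib, ← Finset.sum_sub_distrib,
        Finset.mul_sum]
      refine Finset.sum_congr rfl fun i _ => ?_
      have := (ne_zero_of_dist_lt (a := w i - (C m).c t) (b := z i - (C m).c t) (by
        rw [sub_sub_sub_cancel_right]; exact (hw m).1 t ht i)).1
      field_simp
      ring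
    rw [hd, hs, ha.2]
    ring
  · intro i j
    filter_upwards [hev, hpd.eventually_nhds] with w hw hpw
    have h2 : pderiv j (pderiv i (fun w => ∑ m, f m w)) w = ∑ m, pderiv j (pderiv i (f m)) w := by
      have h3 : pderiv i (fun w => ∑ m, f m w) =ᶠ[𝓝 w] fun w => ∑ m, pderiv i (f m) w :=
        hpw.mono fun v hv => hv i
      rw [pderiv, h3.fderiv_eq, fderiv_fun_sum fun m _ => (hw m).2.2.1 i,
        _root_.sum_apply]
      rfl
    rw [h2, hpw.self_of_nhds, hpw.self_of_nhds, Finset.mul_sum, Finset.mul_sum, Finset.mul_sum,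
      ← Finset.sum_sub_distrib, ← Finset.sum_sub_distrib]
    exact Finset.sum_eq_zero fun m _ => sub_eq_zero.2 ((hw m).2.2.2.2 i j)

/-- A regularization of an arc integral by integrals over twisted paths. -/
theorem IsArcIntegral.exists_chain {n : ℕ} {μ : Fin (n + 1) → ℝ} (hμ : ∀ k, μ k ∈ Ioo (0 : ℝ) 1)
    {z : Fin (n + 1) → ℂ} (hz : Function.Injective z) {γ ψ : ℝ → ℂ} {f : (Fin (n + 1) → ℂ) → ℂ}
    (h : IsArcIntegral μ z γ ψ f) :
    ∃ C : Fin 3 → TwistedPath, (∀ m, (C m).Avoids z) ∧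
      (∀ G : ℂ → ℂ, (∀ m, ∀ t ∈ uIcc (C m).a (C m).b, AnalyticAt ℂ G ((C m).c t)) →
        ∑ m, (C m).integral (fun u => deriv G u + G u * logCoeff μ z u) = 0) ∧
      (f =ᶠ[𝓝 z] fun w => ∑ m, (C m).integral (transport μ z w)) ∧
      ∀ g : ℂ → ℂ, Differentiable ℂ g →
        HasArcIntegral γ (fun t => ψ t * g (γ t)) (∑ m, (C m).integral g) := by
  obtain ⟨N, Γ, ℓ, hN, hΓ, hℓ, hrel, hexp, hγ, hψ, hf⟩ := h
  obtain ⟨C, hC, hex, hev⟩ := exists_regularization hμ hz hN hΓ hℓ hrel hexp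
  refine ⟨C, hC, hex, ?_, fun g hg => ?_⟩
  · filter_upwards [hev, hN] with w hw hwN
    have h1 := hw (fun _ => 1) (differentiable_const _)
    simp only [mul_one] at h1
    exact (hf w hwN).unique h1
  · have h1 := hev.self_of_nhds g hg
    have h2 : ∀ m, (C m).integral (fun u => transport μ z z u * g u) = (C m).integral g :=
      fun m => TwistedPath.integral_congr fun t ht => by
        rw [transport_self μ fun j => (hC m).ne j t ht, one_mul]
    simp only [h2] at h1
    exact h1.congr (fun t ht => hγ t (Ioo_subset_Icc_self ht)) fun t ht => by
      rw [hψ t ht, hγ t (Ioo_subset_Icc_self ht)]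

theorem pderiv_congr {n : ℕ} {z : Fin (n + 1) → ℂ} {f g : (Fin (n + 1) → ℂ) → ℂ}
    (h : f =ᶠ[𝓝 z] g) (i : Fin (n + 1)) : pderiv i f =ᶠ[𝓝 z] pderiv i g := by
  filter_upwards [h.fderiv (𝕜 := ℂ)] with w hw
  rw [pderiv, hw, pderiv]

theorem IsSolutionAt.congr {n : ℕ} {μ : Fin (n + 1) → ℝ} {z : Fin (n + 1) → ℂ}
    {f g : (Fin (n + 1) → ℂ) → ℂ} (hf : IsSolutionAt μ z f) (h : f =ᶠ[𝓝 z] g) :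
    IsSolutionAt μ z g := by
  have h1 := eventually_all.2 (pderiv_congr h)
  refine ⟨hf.analytic.congr h, ?_, ?_, fun i j => ?_⟩
  · filter_upwards [hf.translation, h1] with w hw hw1
    simpa only [hw1] using hw
  · filter_upwards [hf.homogeneity, h1, h] with w hw hw1 hw2
    simpa only [hw1, hw2] using hw
  · filter_upwards [hf.epd i j, h1, pderiv_congr (pderiv_congr h i) j] with w hw hw1 hw2
    simpa only [hw1, hw2] using hw

theorem IsArcIntegral.isSolutionAt {n : ℕ} {μ : Fin (n + 1) → ℝ} (hμ : ∀ k, μ k ∈ Ioo (0 : ℝ) 1)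
    {z : Fin (n + 1) → ℂ} (hz : Function.Injective z) {γ ψ : ℝ → ℂ} {f : (Fin (n + 1) → ℂ) → ℂ}
    (h : IsArcIntegral μ z γ ψ f) : IsSolutionAt μ z f := by
  obtain ⟨C, hC, hex, hf, -⟩ := h.exists_chain hμ hz
  exact (isSolutionAt_chain hC hex).congr hf.symm

theorem analyticAt_pderiv {n : ℕ} {z : Fin (n + 1) → ℂ} {f : (Fin (n + 1) → ℂ) → ℂ}
    (h : AnalyticAt ℂ f z) (i : Fin (n + 1)) : AnalyticAt ℂ (pderiv i f) z := by
  let E := ContinuousLinearMap.apply ℂ ℂ (Pi.single i 1 : Fin (n + 1) → ℂ)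
  have h1 : AnalyticAt ℂ (fun w => E (fderiv ℂ f w)) z := (E.analyticAt _).fun_comp h.fderiv
  exact h1

theorem analyticAt_coord {n : ℕ} (i : Fin (n + 1)) (z : Fin (n + 1) → ℂ) :
    AnalyticAt ℂ (fun w : Fin (n + 1) → ℂ => w i) z :=
  (ContinuousLinearMap.proj (R := ℂ) (φ := fun _ : Fin (n + 1) => ℂ) i).analyticAt z

/-- The equations propagate on a connected set. -/
theorem IsSolutionAt.propagate {n : ℕ} {μ : Fin (n + 1) → ℝ} {U : Set (Fin (n + 1) → ℂ)}
    (hU : IsPreconnected U) {f : (Fin (n + 1) → ℂ) → ℂ} (hf : ∀ w ∈ U, AnalyticAt ℂ f w)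
    (hUo : IsOpen U) {z z' : Fin (n + 1) → ℂ} (hz : z ∈ U) (hz' : z' ∈ U)
    (h : IsSolutionAt μ z f) : IsSolutionAt μ z' f := by
  have key : ∀ E : (Fin (n + 1) → ℂ) → ℂ, (∀ w ∈ U, AnalyticAt ℂ E w) →
      (∀ᶠ w in 𝓝 z, E w = 0) → ∀ᶠ w in 𝓝 z', E w = 0 := by
    intro E hE h0
    have h1 := AnalyticOnNhd.eqOn_zero_of_preconnected_of_eventuallyEq_zero (f := E) hE hU hz h0
    filter_upwards [hUo.mem_nhds hz'] with w hw using h1 hw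
  have hp : ∀ i, ∀ w ∈ U, AnalyticAt ℂ (pderiv i f) w := fun i w hw => analyticAt_pderiv (hf w hw) i
  refine ⟨hf z' hz', key _ (fun w hw => ?_) h.translation, key _ (fun w hw => ?_) h.homogeneity,
    fun i j => key _ (fun w hw => ?_) (h.epd i j)⟩
  · exact Finset.analyticAt_fun_sum _ fun i _ => hp i w hw
  · exact (Finset.analyticAt_fun_sum _ fun i _ => (analyticAt_coord i w).mul (hp i w hw)).sub
      (analyticAt_const.mul (hf w hw))
  · exact (((analyticAt_coord i w).sub (analyticAt_coord j w)).mul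
      (analyticAt_pderiv (hp i w hw) j)).sub
      ((analyticAt_const.mul (hp i w hw)).sub (analyticAt_const.mul (hp j w hw)))

/-- On a ball where F t is analytic the equations spread by the identity theorem, so the parameters
t at which they hold form a clopen subset of the unit interval; it contains 0. -/
theorem IsAnalyticContinuation.isSolutionAt {n : ℕ} {μ : Fin (n + 1) → ℝ}
    {z₀ z : Fin (n + 1) → ℂ} {f₀ f : (Fin (n + 1) → ℂ) → ℂ}
    (h : IsAnalyticContinuation z₀ f₀ z f) (h₀ : IsSolutionAt μ z₀ f₀) : IsSolutionAt μ z f := by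
  obtain ⟨p, F, hp, rfl, rfl, -, hF, hloc, h0, h1⟩ := h
  have key : ∀ t, ∀ᶠ s in 𝓝 t, (IsSolutionAt μ (p s) (F s) ↔ IsSolutionAt μ (p t) (F t)) := by
    intro t
    obtain ⟨r, hr, hball⟩ := Metric.eventually_nhds_iff_ball.1 (hF t).eventually_analyticAt
    have hmem : ∀ᶠ s in 𝓝 t, p s ∈ Metric.ball (p t) r :=
      hp.continuousAt (Metric.ball_mem_nhds _ hr)
    filter_upwards [hmem, hloc t] with s hs hst
    have hc : IsPreconnected (Metric.ball (p t) r) := (convex_ball _ _).isPreconnected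
    refine ⟨fun hsol => ?_, fun hsol => ?_⟩
    · exact (hsol.congr hst).propagate hc hball Metric.isOpen_ball hs (Metric.mem_ball_self hr)
    · exact (hsol.propagate hc hball Metric.isOpen_ball (Metric.mem_ball_self hr) hs).congr hst.symm
  have hclopen : IsClopen {t | IsSolutionAt μ (p t) (F t)} := by
    constructor
    · rw [← isOpen_compl_iff, isOpen_iff_mem_nhds]
      intro t ht
      filter_upwards [key t] with s hs using fun h => ht (hs.1 h)
    · rw [isOpen_iff_mem_nhds]
      intro t ht
      filter_upwards [key t] with s hs using hs.2 ht
  rcases isClopen_iff.1 hclopen with he | hu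
  · exact absurd (h₀.congr h0.symm) (eq_empty_iff_forall_notMem.1 he 0)
  · exact IsSolutionAt.congr (hu.symm ▸ mem_univ (1 : unitInterval) :
      (1 : unitInterval) ∈ {t | IsSolutionAt μ (p t) (F t)}) h1

/-! ### Initial values and the bound on the dimension -/

theorem hasDerivAt_comp_line {n : ℕ} {f : (Fin (n + 1) → ℂ) → ℂ} {z v : Fin (n + 1) → ℂ} {s : ℝ}
    (h : DifferentiableAt ℂ f (z + (s : ℂ) • v)) :
    HasDerivAt (fun s : ℝ => f (z + (s : ℂ) • v)) (∑ j, v j * pderiv j f (z + (s : ℂ) • v)) s := by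
  have h1 : HasDerivAt (fun s : ℝ => z + (s : ℂ) • v) v s := by
    have := ((Complex.ofRealCLM.hasDerivAt (x := s)).smul_const v).const_add z
    simpa using this
  have h2 := (h.hasFDerivAt.restrictScalars ℝ).comp_hasDerivAt s h1
  refine h2.congr_deriv ?_
  have h3 : v = ∑ j, v j • (Pi.single j 1 : Fin (n + 1) → ℂ) := by
    ext i
    simp [Pi.single_apply]
  set x := z + (s : ℂ) • v
  change fderiv ℂ f x v = ∑ j, v j * fderiv ℂ f x (Pi.single j 1)
  conv_lhs => rw [h3]
  simp

/-- A solution whose value and first derivatives vanish at a point vanishes near that point. -/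
theorem IsSolutionAt.eventually_eq_zero {n : ℕ} {μ : Fin (n + 1) → ℝ}
    (hμ : ∀ k, μ k ∈ Ioo (0 : ℝ) 1) {z : Fin (n + 1) → ℂ}
    (hz : Function.Injective z) {f : (Fin (n + 1) → ℂ) → ℂ} (h : IsSolutionAt μ z f)
    (h0 : f z = 0) (h1 : ∀ i, pderiv i f z = 0) : f =ᶠ[𝓝 z] 0 := by
  obtain ⟨d, hd, hsep⟩ := exists_separation hz
  have hev : ∀ᶠ w in 𝓝 z, AnalyticAt ℂ f w ∧ (∀ᶠ v in 𝓝 w, ∑ i, pderiv i f v = 0) ∧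
      ∀ i j, (w i - w j) * pderiv j (pderiv i f) w -
        (μ j * pderiv i f w - μ i * pderiv j f w) = 0 :=
    h.analytic.eventually_analyticAt.and (h.translation.eventually_nhds.and
      (eventually_all.2 fun i => eventually_all.2 fun j => h.epd i j))
  obtain ⟨r, hr, hball⟩ := Metric.eventually_nhds_iff_ball.1 hev
  have hmem : Metric.ball z (min r (d / 4)) ∈ 𝓝 z := Metric.ball_mem_nhds _ (by positivity)
  filter_upwards [hmem] with w hw
  have hwr : ‖w - z‖ < r := (mem_ball_iff_norm.1 hw).trans_le (min_le_left _ _)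
  have hwd : ‖w - z‖ < d / 4 := (mem_ball_iff_norm.1 hw).trans_le (min_le_right _ _)
  set v := w - z with hv
  have hline : ∀ s ∈ Icc (0 : ℝ) 1, ‖(s : ℂ) • v‖ ≤ ‖v‖ := fun s hs => by
    rw [norm_smul, Complex.norm_real, Real.norm_of_nonneg hs.1]
    exact mul_le_of_le_one_left (norm_nonneg _) hs.2
  have hpt : ∀ s ∈ Icc (0 : ℝ) 1, AnalyticAt ℂ f (z + (s : ℂ) • v) ∧
      (∀ᶠ v' in 𝓝 (z + (s : ℂ) • v), ∑ i, pderiv i f v' = 0) ∧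
      ∀ i j, ((z + (s : ℂ) • v) i - (z + (s : ℂ) • v) j) * pderiv j (pderiv i f) (z + (s : ℂ) • v) -
        (μ j * pderiv i f (z + (s : ℂ) • v) - μ i * pderiv j f (z + (s : ℂ) • v)) = 0 :=
    fun s hs => hball _ (by
      rw [mem_ball_iff_norm, add_sub_cancel_left]
      exact (hline s hs).trans_lt hwr)
  -- The value and gradient along the segment from z to w. The system yields a closed linear
  -- differential inequality for this vector.
  let φ : ℝ → ℂ × (Fin (n + 1) → ℂ) := fun s =>
    (f (z + (s : ℂ) • v), fun i => pderiv i f (z + (s : ℂ) • v))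
  let φ' : ℝ → ℂ × (Fin (n + 1) → ℂ) := fun s =>
    (∑ j, v j * pderiv j f (z + (s : ℂ) • v),
      fun i => ∑ j, v j * pderiv j (pderiv i f) (z + (s : ℂ) • v))
  have hφ : ∀ s ∈ Icc (0 : ℝ) 1, HasDerivAt φ (φ' s) s := fun s hs =>
    (hasDerivAt_comp_line (hpt s hs).1.differentiableAt).prodMk
      (hasDerivAt_pi.2 fun i => hasDerivAt_comp_line
        (analyticAt_pderiv (hpt s hs).1 i).differentiableAt)
  have hp : ∀ (s : ℝ) i, ‖pderiv i f (z + (s : ℂ) • v)‖ ≤ ‖φ s‖ := fun s i =>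
    (norm_le_pi_norm (φ s).2 i).trans (norm_snd_le (φ s))
  -- Along the segment every coordinate moves by at most d/4, so differences of coordinates stay at
  -- least d/2 and the Euler-Poisson-Darboux equation can be divided by wᵢ - wⱼ.
  have hoff : ∀ s ∈ Icc (0 : ℝ) 1, ∀ i j, i ≠ j →
      ‖pderiv j (pderiv i f) (z + (s : ℂ) • v)‖ ≤ 4 / d * ‖φ s‖ := by
    intro s hs i j hij
    have e := sub_eq_zero.1 ((hpt s hs).2.2 i j)
    have h2 : d / 2 ≤ ‖(z + (s : ℂ) • v) i - (z + (s : ℂ) • v) j‖ := by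
      have h3 : (z + (s : ℂ) • v) i - (z + (s : ℂ) • v) j =
          (z i - z j) - (((s : ℂ) • v) j - ((s : ℂ) • v) i) := by
        simp only [Pi.add_apply]
        ring
      have h4 : ∀ k, ‖((s : ℂ) • v) k‖ ≤ d / 4 := fun k =>
        (norm_le_pi_norm _ k).trans ((hline s hs).trans hwd.le)
      rw [h3]
      have h5 := norm_sub_norm_le (z i - z j) (((s : ℂ) • v) j - ((s : ℂ) • v) i)
      have h6 := norm_sub_le (((s : ℂ) • v) j) (((s : ℂ) • v) i)
      linarith [h4 i, h4 j, hsep i j hij]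
    have h3 : ‖(μ j : ℂ) * pderiv i f (z + (s : ℂ) • v) - μ i * pderiv j f (z + (s : ℂ) • v)‖ ≤
        2 * ‖φ s‖ := by
      have h4 : ∀ k l, ‖(μ k : ℂ) * pderiv l f (z + (s : ℂ) • v)‖ ≤ ‖φ s‖ := fun k l => by
        rw [norm_mul, Complex.norm_real, Real.norm_of_nonneg (hμ k).1.le]
        exact (mul_le_of_le_one_left (norm_nonneg _) (hμ k).2.le).trans (hp s l)
      have := norm_sub_le ((μ j : ℂ) * pderiv i f (z + (s : ℂ) • v))
        (μ i * pderiv j f (z + (s : ℂ) • v))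
      linarith [h4 i j, h4 j i]
    rw [← e, norm_mul] at h3
    have h4 := (mul_le_mul_of_nonneg_right h2
      (norm_nonneg (pderiv j (pderiv i f) (z + (s : ℂ) • v)))).trans h3
    rw [div_mul_eq_mul_div, le_div_iff₀ hd]
    linarith
  set M : ℝ := (n + 1) * (4 / d) with hM
  have hMpos : 0 ≤ M := by positivity
  have hall : ∀ s ∈ Icc (0 : ℝ) 1, ∀ i j,
      ‖pderiv j (pderiv i f) (z + (s : ℂ) • v)‖ ≤ M * ‖φ s‖ := by
    intro s hs i j
    have hle : 4 / d * ‖φ s‖ ≤ M * ‖φ s‖ := by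
      refine mul_le_mul_of_nonneg_right ?_ (norm_nonneg _)
      rw [hM]
      exact le_mul_of_one_le_left (by positivity) (by
        have : (0 : ℝ) ≤ n := n.cast_nonneg
        linarith)
    rcases eq_or_ne i j with rfl | hij
    -- The pure second derivative is not controlled by the Euler-Poisson-Darboux equations; it comes
    -- from the i-th derivative of the translation equation.
    · have e1 : ∑ k, pderiv i (pderiv k f) (z + (s : ℂ) • v) = 0 := by
        have e2 : (fun w => ∑ k, pderiv k f w) =ᶠ[𝓝 (z + (s : ℂ) • v)] fun _ => 0 :=
          (hpt s hs).2.1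
        have e3 := (pderiv_congr e2 i).self_of_nhds
        rw [pderiv, fderiv_fun_sum fun k _ =>
          (analyticAt_pderiv (hpt s hs).1 k).differentiableAt, _root_.sum_apply] at e3
        simpa [pderiv] using e3
      rw [← Finset.add_sum_erase _ _ (Finset.mem_univ i)] at e1
      rw [eq_neg_of_add_eq_zero_left e1, norm_neg]
      refine (norm_sum_le _ _).trans ?_
      have h3 : ∀ k ∈ Finset.univ.erase i, ‖pderiv i (pderiv k f) (z + (s : ℂ) • v)‖ ≤
          4 / d * ‖φ s‖ := fun k hk => hoff s hs k i (Finset.ne_of_mem_erase hk)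
      refine (Finset.sum_le_card_nsmul _ _ _ h3).trans ?_
      rw [Finset.card_erase_of_mem (Finset.mem_univ i), Finset.card_univ, Fintype.card_fin,
        Nat.add_sub_cancel, nsmul_eq_mul, ← mul_assoc]
      refine mul_le_mul_of_nonneg_right ?_ (norm_nonneg _)
      rw [hM]
      exact mul_le_mul_of_nonneg_right (by linarith) (by positivity)
    · exact (hoff s hs i j hij).trans hle
  have hsum : ∀ (a : Fin (n + 1) → ℂ) (B : ℝ), (∀ j, ‖a j‖ ≤ B) →
      ‖∑ j, v j * a j‖ ≤ (n + 1) * (‖v‖ * B) := by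
    intro a B ha
    refine (norm_sum_le _ _).trans ?_
    have h3 : ∀ j ∈ (Finset.univ : Finset (Fin (n + 1))), ‖v j * a j‖ ≤ ‖v‖ * B := fun j _ => by
      rw [norm_mul]
      exact mul_le_mul (norm_le_pi_norm v j) (ha j) (norm_nonneg _) (norm_nonneg _)
    refine (Finset.sum_le_card_nsmul _ _ _ h3).trans (le_of_eq ?_)
    rw [Finset.card_univ, Fintype.card_fin, nsmul_eq_mul]
    push_cast
    ring
  have hbound : ∀ s ∈ Ico (0 : ℝ) 1, ‖φ' s‖ ≤ ((n + 1) * (‖v‖ * (1 + M))) * ‖φ s‖ := by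
    intro s hs
    have hs' := Ico_subset_Icc_self hs
    have hφn := norm_nonneg (φ s)
    have hb : ∀ a : Fin (n + 1) → ℂ, (∀ j, ‖a j‖ ≤ (1 + M) * ‖φ s‖) →
        ‖∑ j, v j * a j‖ ≤ ((n + 1) * (‖v‖ * (1 + M))) * ‖φ s‖ := fun a ha =>
      (hsum a _ ha).trans (le_of_eq (by ring))
    refine norm_prod_le_iff.2 ⟨hb _ fun j => (hp s j).trans ?_, ?_⟩
    · nlinarith
    · refine (pi_norm_le_iff_of_nonneg (by positivity)).2 fun i => hb _ fun j =>
        (hall s hs' i j).trans ?_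
      nlinarith
  -- Grönwall: the norm of the derivative of φ is bounded by a constant times the norm of φ, and φ
  -- vanishes at 0.
  have hfin := eq_zero_of_abs_deriv_le_mul_abs_self_of_eq_zero_right (f := φ) (f' := φ')
    (a := 0) (b := 1) (fun s hs => (hφ s hs).continuousAt.continuousWithinAt)
    (fun s hs => (hφ s (Ico_subset_Icc_self hs)).hasDerivWithinAt)
    (by simp only [φ, Complex.ofReal_zero, zero_smul, add_zero, h0, h1]; rfl) hbound 1
    (right_mem_Icc.2 zero_le_one)
  have h7 := congrArg Prod.fst hfin
  simpa [φ, hv] using h7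

/-- The functions that solve the system of differential equations at `z`. -/
noncomputable def solutions {n : ℕ} (μ : Fin (n + 1) → ℝ) (z : Fin (n + 1) → ℂ) :
    Submodule ℂ ((Fin (n + 1) → ℂ) → ℂ) where
  carrier := {f | IsSolutionAt μ z f}
  zero_mem' := by
    have h : ∀ i, pderiv i (0 : (Fin (n + 1) → ℂ) → ℂ) = 0 := fun i => by
      funext w
      simp [pderiv]
    exact ⟨analyticAt_const, by simp [h], by simp [h], fun i j => by simp [h]⟩
  add_mem' := by
    intro f g hf hg
    have h1 : ∀ {f g : (Fin (n + 1) → ℂ) → ℂ}, AnalyticAt ℂ f z → AnalyticAt ℂ g z → ∀ i,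
        pderiv i (f + g) =ᶠ[𝓝 z] pderiv i f + pderiv i g := by
      intro f g hf hg i
      filter_upwards [hf.eventually_analyticAt, hg.eventually_analyticAt] with w hw1 hw2
      rw [pderiv, fderiv_add hw1.differentiableAt hw2.differentiableAt]
      rfl
    have h2 := h1 hf.analytic hg.analytic
    refine ⟨hf.analytic.add hg.analytic, ?_, ?_, fun i j => ?_⟩
    · filter_upwards [hf.translation, hg.translation, eventually_all.2 h2] with w a b c
      simp only [c, Pi.add_apply, Finset.sum_add_distrib, a, b, add_zero]
    · filter_upwards [hf.homogeneity, hg.homogeneity, eventually_all.2 h2] with w a b c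
      simp only [c, Pi.add_apply, mul_add, Finset.sum_add_distrib]
      linear_combination a + b
    · have h3 := (pderiv_congr (h2 i) j).trans
        (h1 (analyticAt_pderiv hf.analytic i) (analyticAt_pderiv hg.analytic i) j)
      filter_upwards [hf.epd i j, hg.epd i j, eventually_all.2 h2, h3] with w a b c e
      simp only [c, e, Pi.add_apply]
      linear_combination a + b
  smul_mem' := by
    intro κ f hf
    have h1 : ∀ {f : (Fin (n + 1) → ℂ) → ℂ}, AnalyticAt ℂ f z → ∀ i,
        pderiv i (κ • f) =ᶠ[𝓝 z] κ • pderiv i f := by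
      intro f hf i
      filter_upwards [hf.eventually_analyticAt] with w hw1
      rw [pderiv, fderiv_const_smul hw1.differentiableAt]
      rfl
    have h2 := h1 hf.analytic
    refine ⟨analyticAt_const.smul hf.analytic, ?_, ?_, fun i j => ?_⟩
    · filter_upwards [hf.translation, eventually_all.2 h2] with w a c
      simp only [c, Pi.smul_apply, smul_eq_mul, ← Finset.mul_sum, a, mul_zero]
    · filter_upwards [hf.homogeneity, eventually_all.2 h2] with w a c
      simp only [c, Pi.smul_apply, smul_eq_mul, mul_left_comm _ κ, ← Finset.mul_sum]
      linear_combination κ * a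
    · have h3 := (pderiv_congr (h2 i) j).trans (h1 (analyticAt_pderiv hf.analytic i) j)
      filter_upwards [hf.epd i j, eventually_all.2 h2, h3] with w a c e
      simp only [c, e, Pi.smul_apply, smul_eq_mul]
      linear_combination κ * a

/-- The value and the first derivatives of a solution at `z`. -/
noncomputable def initialData {n : ℕ} (μ : Fin (n + 1) → ℝ) (z : Fin (n + 1) → ℂ) :
    solutions μ z →ₗ[ℂ] ℂ × (Fin (n + 1) → ℂ) where
  toFun f := (f.1 z, fun i => pderiv i f.1 z)
  map_add' f g := by
    refine Prod.ext rfl (funext fun i => ?_)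
    change fderiv ℂ (f.1 + g.1) z _ = _
    rw [fderiv_add (IsSolutionAt.analytic f.2).differentiableAt
      (IsSolutionAt.analytic g.2).differentiableAt]
    rfl
  map_smul' κ f := by
    refine Prod.ext rfl (funext fun i => ?_)
    change fderiv ℂ (κ • f.1) z _ = _
    rw [fderiv_const_smul (IsSolutionAt.analytic f.2).differentiableAt]
    rfl

/-- The germ of a solution. -/
noncomputable def solutionGerm {n : ℕ} (μ : Fin (n + 1) → ℝ) (z : Fin (n + 1) → ℂ) :
    solutions μ z →ₗ[ℂ] Germ (𝓝 z) ℂ where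
  toFun f := (f.1 : Germ (𝓝 z) ℂ)
  map_add' _ _ := rfl
  map_smul' _ _ := rfl

/-- The linear relations between the value and the first derivatives of a solution. -/
noncomputable def initialConstraint {n : ℕ} (μ : Fin (n + 1) → ℝ) (z : Fin (n + 1) → ℂ) :
    (ℂ × (Fin (n + 1) → ℂ)) →ₗ[ℂ] ℂ × ℂ where
  toFun x := (∑ i, x.2 i, ∑ i, z i * x.2 i - (1 - ∑ i, (μ i : ℂ)) * x.1)
  map_add' x y := by
    refine Prod.ext ?_ ?_
    · simp [Finset.sum_add_distrib]
    · simp only [Prod.snd_add, Prod.fst_add, Pi.add_apply, mul_add, Finset.sum_add_distrib]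
      ring
  map_smul' κ x := by
    refine Prod.ext ?_ ?_
    · simp [Finset.mul_sum]
    · simp only [Prod.smul_snd, Prod.smul_fst, Pi.smul_apply, smul_eq_mul, mul_left_comm _ κ,
        ← Finset.mul_sum, RingHom.id_apply]
      ring

/-- The two relations on ℂ^(n+2) are independent already on gradients supported in the first and
last coordinates, because z₀ ≠ zₙ; this is where n > 0 enters. -/
theorem finrank_ker_initialConstraint {n : ℕ} (hn : 0 < n) (μ : Fin (n + 1) → ℝ)
    {z : Fin (n + 1) → ℂ} (hz : Function.Injective z) :
    Module.finrank ℂ (LinearMap.ker (initialConstraint μ z)) = n := by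
  have hsurj : LinearMap.range (initialConstraint μ z) = ⊤ := by
    rw [LinearMap.range_eq_top]
    rintro ⟨a, b⟩
    have h01 : (0 : Fin (n + 1)) ≠ Fin.last n := by
      rw [Ne, Fin.ext_iff]
      simp [hn.ne]
    have hne : z 0 - z (Fin.last n) ≠ 0 := sub_ne_zero.2 fun h => h01 (hz h)
    set y := (b - z (Fin.last n) * a) / (z 0 - z (Fin.last n)) with hy
    refine ⟨(0, y • Pi.single 0 1 + (a - y) • Pi.single (Fin.last n) 1), Prod.ext ?_ ?_⟩
    · simp [initialConstraint, Finset.sum_add_distrib, Pi.single_apply]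
    · simp only [initialConstraint, LinearMap.coe_mk, AddHom.coe_mk, Pi.add_apply, Pi.smul_apply,
        Pi.single_apply, smul_eq_mul, mul_ite, mul_one, mul_zero, mul_add, Finset.sum_add_distrib,
        Finset.sum_ite_eq', Finset.mem_univ, if_true, sub_zero]
      rw [hy]
      field_simp
      ring
  have h1 := (initialConstraint μ z).finrank_range_add_finrank_ker
  rw [hsurj, finrank_top] at h1
  simp only [Module.finrank_prod, Module.finrank_self, Module.finrank_fintype_fun_eq_card,
    Fintype.card_fin] at h1
  omega

/-- Independent solutions, `n` in number, span the germs of all solutions. -/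
theorem range_solutionGerm_le_span {n : ℕ} (hn : 0 < n) {μ : Fin (n + 1) → ℝ}
    (hμ : ∀ k, μ k ∈ Ioo (0 : ℝ) 1) {z : Fin (n + 1) → ℂ} (hz : Function.Injective z)
    {f : Fin n → (Fin (n + 1) → ℂ) → ℂ} (hf : ∀ k, IsSolutionAt μ z (f k))
    (hli : LinearIndependent ℂ fun k => (f k : Germ (𝓝 z) ℂ)) :
    LinearMap.range (solutionGerm μ z) ≤ Submodule.span ℂ (range fun k => (f k : Germ (𝓝 z) ℂ)) := by
  let F : Fin n → solutions μ z := fun k => ⟨f k, hf k⟩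
  have hker : LinearMap.ker (initialData μ z) ≤ LinearMap.ker (solutionGerm μ z) := by
    intro g hg
    have h1 : (g.1 z, fun i => pderiv i g.1 z) = (0 : ℂ × (Fin (n + 1) → ℂ)) := hg
    have h2 := IsSolutionAt.eventually_eq_zero hμ hz g.2 (congrArg Prod.fst h1)
      (congrFun (congrArg Prod.snd h1))
    exact Germ.coe_eq.2 h2
  have hcon : ∀ g, initialData μ z g ∈ LinearMap.ker (initialConstraint μ z) := fun g =>
    Prod.ext (IsSolutionAt.translation g.2).self_of_nhds
      (IsSolutionAt.homogeneity g.2).self_of_nhds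
  let Φ : solutions μ z →ₗ[ℂ] LinearMap.ker (initialConstraint μ z) :=
    (initialData μ z).codRestrict _ hcon
  -- `solutions` consists of functions rather than germs, so Φ is not injective; but Φ g = 0 forces
  -- the germ of g to vanish, which is what the dimension count needs.
  have hΦker : ∀ g, Φ g = 0 → solutionGerm μ z g = 0 := fun g hg => hker (congrArg Subtype.val hg)
  have hli' : LinearIndependent ℂ fun k => Φ (F k) := by
    rw [Fintype.linearIndependent_iff] at hli ⊢
    intro c hc
    refine hli c ?_
    have h1 : Φ (∑ k, c k • F k) = 0 := by simpa using hc
    have h2 := hΦker _ h1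
    rw [map_sum] at h2
    exact h2
  have hspan := hli'.span_eq_top_of_card_eq_finrank' (by
    rw [finrank_ker_initialConstraint hn μ hz, Fintype.card_fin])
  rintro _ ⟨g, rfl⟩
  have h1 : Φ g ∈ Submodule.span ℂ (range fun k => Φ (F k)) := hspan ▸ Submodule.mem_top
  obtain ⟨c, hc⟩ := (Submodule.mem_span_range_iff_exists_fun ℂ).1 h1
  have h2 : Φ (g - ∑ k, c k • F k) = 0 := by
    rw [map_sub, ← hc]
    simp
  have h3 := hΦker _ h2
  rw [map_sub, sub_eq_zero] at h3
  rw [h3, map_sum]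
  refine Submodule.sum_mem _ fun k _ => ?_
  rw [map_smul]
  exact Submodule.smul_mem _ _ (Submodule.subset_span ⟨k, rfl⟩)

theorem germSpace_le_range_solutionGerm {n : ℕ} {μ : Fin (n + 1) → ℝ}
    (hμ : ∀ k, μ k ∈ Ioo (0 : ℝ) 1) {z : Fin (n + 1) → ℂ} :
    germSpace μ z ≤ LinearMap.range (solutionGerm μ z) := by
  refine Submodule.span_le.2 ?_
  rintro _ ⟨f, ⟨z₀, γ, ψ, f₀, h0, h1⟩, rfl⟩
  have hz₀ : Function.Injective z₀ := by
    obtain ⟨p, F, -, hp, -, hinj, -⟩ := h1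
    exact hp ▸ hinj 0
  exact ⟨⟨f, h1.isSolutionAt (h0.isSolutionAt hμ hz₀)⟩, rfl⟩

theorem IsArcIntegral.isLauricellaAt {n : ℕ} {μ : Fin (n + 1) → ℝ}
    (hμ : ∀ k, μ k ∈ Ioo (0 : ℝ) 1) {z : Fin (n + 1) → ℂ} (hz : Function.Injective z)
    {γ ψ : ℝ → ℂ} {f : (Fin (n + 1) → ℂ) → ℂ} (h : IsArcIntegral μ z γ ψ f) :
    IsLauricellaAt μ z f :=
  ⟨z, γ, ψ, f, h, fun _ => z, fun _ => f, continuous_const, rfl, rfl, fun _ => hz,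
    fun _ => (h.isSolutionAt hμ hz).analytic, fun _ => Eventually.of_forall fun _ =>
      EventuallyEq.refl _ _, EventuallyEq.refl _ _, EventuallyEq.refl _ _⟩

/-- Independent arc integrals, `n` in number, form a basis of the space of germs. -/
theorem exists_basis {n : ℕ} (hn : 0 < n) {μ : Fin (n + 1) → ℝ}
    (hμ : ∀ k, μ k ∈ Ioo (0 : ℝ) 1) {z : Fin (n + 1) → ℂ} (hz : Function.Injective z)
    {γ ψ : Fin n → ℝ → ℂ} {f : Fin n → (Fin (n + 1) → ℂ) → ℂ}
    (hf : ∀ k, IsArcIntegral μ z (γ k) (ψ k) (f k))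
    (hli : LinearIndependent ℂ fun k => (f k : Germ (𝓝 z) ℂ)) :
    (∃ b : Module.Basis (Fin n) ℂ (germSpace μ z),
      ∀ k, (b k : Germ (𝓝 z) ℂ) = (f k : Germ (𝓝 z) ℂ)) ∧
    germSpace μ z = LinearMap.range (solutionGerm μ z) := by
  have h1 := range_solutionGerm_le_span hn hμ hz (fun k => (hf k).isSolutionAt hμ hz) hli
  have h2 := germSpace_le_range_solutionGerm (μ := μ) hμ (z := z)
  have h3 : Submodule.span ℂ (range fun k => (f k : Germ (𝓝 z) ℂ)) ≤ germSpace μ z := by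
    refine Submodule.span_le.2 ?_
    rintro _ ⟨k, rfl⟩
    exact Submodule.subset_span ⟨f k, (hf k).isLauricellaAt hμ hz, rfl⟩
  -- The inclusions span ≤ L_z ≤ germs of solutions ≤ span force equality throughout.
  refine ⟨⟨(Module.Basis.span hli).map (LinearEquiv.ofEq _ _ (le_antisymm h3 (h2.trans h1))),
    fun k => ?_⟩, le_antisymm h2 (h1.trans h3)⟩
  simp [Module.Basis.span_apply]

/-! ### Continuous logarithms and arcs that do not separate the plane -/

theorem isSimplyConnected_of_convex {E : Type*} [NormedAddCommGroup E] [NormedSpace ℝ E] {s : Set E}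
    (hs : Convex ℝ s) (hne : s.Nonempty) : IsSimplyConnected s := by
  have := hs.contractibleSpace hne
  exact SimplyConnectedSpace.ofContractible s

/-- Continuous functions without zeros on an open interval have continuous logarithms. -/
theorem exists_log_Ioo {g : ℝ → ℂ} {a b : ℝ} (hab : a < b) (hg : ContinuousOn g (Ioo a b))
    (h0 : ∀ t ∈ Ioo a b, g t ≠ 0) :
    ∃ l : ℝ → ℂ, ContinuousOn l (Ioo a b) ∧ ∀ t ∈ Ioo a b, Complex.exp (l t) = g t :=
  Complex.exists_continuousOn_eqOn_exp_comp
    (isSimplyConnected_of_convex (convex_Ioo a b) (nonempty_Ioo.2 hab)) isOpen_Ioo hg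
    (by rintro ⟨t, ht, h⟩; exact h0 t ht h)

theorem exists_log_Icc {g : ℝ → ℂ} {a b : ℝ} (hab : a ≤ b) (hg : ContinuousOn g (Icc a b))
    (h0 : ∀ t ∈ Icc a b, g t ≠ 0) :
    ∃ l : ℝ → ℂ, ContinuousOn l (Icc a b) ∧ ∀ t ∈ Icc a b, Complex.exp (l t) = g t := by
  have hc : Continuous (IccExtend hab ((Icc a b).domRestrict g)) :=
    (continuousOn_iff_continuous_domRestrict.1 hg).Icc_extend'
  obtain ⟨l, hl, h⟩ := Complex.exists_continuousOn_eqOn_exp_comp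
    (isSimplyConnected_of_convex (convex_univ (𝕜 := ℝ) (E := ℝ)) univ_nonempty) isOpen_univ
    hc.continuousOn (by
      rintro ⟨t, -, h⟩
      exact h0 _ (projIcc a b hab t).2 h)
  refine ⟨l, hl.mono (subset_univ _), fun t ht => ?_⟩
  have h1 := h (mem_univ t)
  rw [IccExtend_of_mem _ _ ht] at h1
  exact h1

/-- There is no continuous logarithm of `u - ξ` on a circle around `ξ`. -/
theorem not_exists_log_circle {ξ : ℂ} {r : ℝ} {h : ℂ → ℂ} (hc : Continuous h) :
    ¬ ∀ θ : ℝ, Complex.exp (h (ξ + r * Complex.exp (θ * Complex.I))) =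
      r * Complex.exp (θ * Complex.I) := by
  intro hexp
  have h1 : Continuous fun θ : ℝ => h (ξ + r * Complex.exp (θ * Complex.I)) := by fun_prop
  have h2 : Continuous fun θ : ℝ => θ * Complex.I + h (ξ + r) := by fun_prop
  -- Both θ ↦ h(ξ + r exp(iθ)) and θ ↦ iθ + h(ξ + r) lift the circle through the exponential and
  -- agree at 0, hence everywhere. The first has period 2π and the second does not.
  have key := Complex.isCoveringMap_exp.eq_of_comp_eq h1 h2 (by
    funext θ
    refine Subtype.ext ?_
    simp only [Function.comp_apply]
    have := hexp 0
    simp only [Complex.ofReal_zero, zero_mul, Complex.exp_zero, mul_one] at this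
    rw [hexp, Complex.exp_add, this, mul_comm]) 0 (by simp)
  have := congrFun key (2 * Real.pi)
  simp only [Complex.ofReal_mul, Complex.ofReal_ofNat, Complex.exp_two_pi_mul_I, mul_one] at this
  have h3 : (2 : ℂ) * Real.pi * Complex.I = 0 := by
    linear_combination -this
  simp [Real.pi_ne_zero] at h3

theorem isPreconnected_norm_gt {R : ℝ} (hR : 0 < R) : IsPreconnected {u : ℂ | R < ‖u‖} := by
  have h1 : {u : ℂ | R < ‖u‖} = Complex.exp '' {u : ℂ | Real.log R < u.re} := by
    ext u
    simp only [mem_ofPred_eq, mem_image]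
    constructor
    · intro h
      have h0 : u ≠ 0 := norm_pos_iff.1 (hR.trans h)
      exact ⟨Complex.log u, by rw [Complex.log_re]; exact Real.log_lt_log hR h, Complex.exp_log h0⟩
    · rintro ⟨v, hv, rfl⟩
      rw [Complex.norm_exp]
      exact (Real.log_lt_iff_lt_exp hR).1 hv
  rw [h1]
  exact (convex_halfSpace_re_gt _).isPreconnected.image _ Complex.continuous_exp.continuousOn

/-- A compact set on which all functions `u - ξ` without zeros have continuous logarithms does not
separate the plane. -/
theorem isPreconnected_compl_of_logs {A : Set ℂ} (hA : IsCompact A)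
    (hlog : ∀ ξ ∉ A, ∃ l : C(A, ℂ), ∀ u : A, Complex.exp (l u) = u - ξ) : IsPreconnected Aᶜ := by
  classical
  obtain ⟨R, hR, hAR⟩ : ∃ R > 0, A ⊆ Metric.closedBall 0 R := by
    obtain ⟨R, hR⟩ := hA.isBounded.subset_closedBall 0
    exact ⟨max R 1, by positivity, hR.trans (Metric.closedBall_subset_closedBall (le_max_left _ _))⟩
  set E : Set ℂ := {u | R < ‖u‖} with hE
  have hEA : E ⊆ Aᶜ := fun u hu huA => by
    have := mem_closedBall_zero_iff.1 (hAR huA)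
    exact absurd hu (not_lt.2 this)
  have hopen : IsOpen Aᶜ := hA.isClosed.isOpen_compl
  have hx : ((R + 1 : ℝ) : ℂ) ∈ E := by
    rw [hE, mem_ofPred_eq, Complex.norm_real, Real.norm_of_nonneg (by positivity)]
    linarith
  refine isPreconnected_of_forall ((R + 1 : ℝ) : ℂ) fun ξ hξ => ?_
  set U := connectedComponentIn Aᶜ ξ with hU
  have hξU : ξ ∈ U := mem_connectedComponentIn hξ
  refine ⟨U, connectedComponentIn_subset _ _, ?_, hξU, isPreconnected_connectedComponentIn⟩
  have hUo : IsOpen U := hopen.connectedComponentIn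
  by_contra hnot
  -- The exterior E of a large disc is connected, so a component that misses one point of E misses
  -- all of E.
  have hdisj : ∀ u ∈ E, u ∉ U := by
    intro u hu huU
    rw [hU, connectedComponentIn_eq huU] at hnot
    exact hnot ((isPreconnected_norm_gt hR).subset_connectedComponentIn hu hEA hx)
  have hfr : frontier U ⊆ A := by
    intro u hu
    by_contra huA
    have h1 : u ∉ U := by
      rw [hUo.frontier_eq] at hu
      exact hu.2
    have h2 : connectedComponentIn Aᶜ u ∈ 𝓝 u :=
      hopen.connectedComponentIn.mem_nhds (mem_connectedComponentIn huA)
    obtain ⟨v, hv, hvU⟩ := mem_closure_iff_nhds.1 (frontier_subset_closure hu) _ h2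
    rw [hU, connectedComponentIn_eq hvU, ← connectedComponentIn_eq hv] at h1
    exact h1 (mem_connectedComponentIn huA)
  obtain ⟨l, hl⟩ := hlog ξ hξ
  obtain ⟨L, hL⟩ := l.exists_restrict_eq hA.isClosed
  have hLA : ∀ u ∈ A, Complex.exp (L u) = u - ξ := fun u hu => by
    rw [← hl ⟨u, hu⟩, ← hL]
    rfl
  -- The logarithm of u - ξ on A extends continuously to L on the plane. Replacing u - ξ by exp(L)
  -- inside U removes the zero at ξ and is continuous because the frontier of U lies in A. Then g
  -- has a global logarithm, but on a large circle it equals u - ξ: a contradiction.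
  set g : ℂ → ℂ := fun u => if u ∈ U then Complex.exp (L u) else u - ξ with hg
  have hgc : Continuous g := by
    refine Continuous.if (fun u hu => hLA u (hfr hu)) ?_ ?_
    · exact Complex.continuous_exp.comp L.continuous
    · fun_prop
  have hg0 : ∀ u, g u ≠ 0 := by
    intro u
    by_cases hu : u ∈ U
    · simp [hg, hu]
    · simp only [hg, hu, if_false]
      exact sub_ne_zero.2 fun h => hu (h ▸ hξU)
  obtain ⟨h, hhc, hh⟩ := Complex.exists_continuousOn_eqOn_exp_comp
    (isSimplyConnected_of_convex (convex_univ (𝕜 := ℝ) (E := ℂ)) univ_nonempty) isOpen_univ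
    hgc.continuousOn (by
      rintro ⟨t, -, h⟩
      exact hg0 t h)
  refine not_exists_log_circle (ξ := ξ) (r := R + ‖ξ‖ + 1) (continuousOn_univ.1 hhc) fun θ => ?_
  have h1 : ξ + ((R + ‖ξ‖ + 1 : ℝ) : ℂ) * Complex.exp (θ * Complex.I) ∈ E := by
    have h2 := norm_sub_norm_le (((R + ‖ξ‖ + 1 : ℝ) : ℂ) * Complex.exp (θ * Complex.I)) (-ξ)
    rw [norm_mul, Complex.norm_exp_ofReal_mul_I, mul_one, Complex.norm_real,
      Real.norm_of_nonneg (by positivity), norm_neg, sub_neg_eq_add, add_comm _ ξ] at h2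
    rw [hE, mem_ofPred_eq]
    linarith
  have h2 := hh (mem_univ (ξ + ((R + ‖ξ‖ + 1 : ℝ) : ℂ) * Complex.exp (θ * Complex.I)))
  simp only [Function.comp_apply, hg, hdisj _ h1, if_false, add_sub_cancel_left] at h2
  exact h2

/-- An arc does not separate the plane. -/
theorem isPreconnected_compl_arc {δ : ℝ → ℂ} {a b : ℝ} (hab : a ≤ b)
    (hδ : ContinuousOn δ (Icc a b)) (hinj : InjOn δ (Icc a b)) :
    IsPreconnected (δ '' Icc a b)ᶜ := by
  refine isPreconnected_compl_of_logs (isCompact_Icc.image_of_continuousOn hδ) fun ξ hξ => ?_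
  -- Logarithms exist on the parameter interval and descend to the arc, since an injective
  -- continuous map from a compact interval is a homeomorphism onto its image.
  obtain ⟨l, hl, hexp⟩ := exists_log_Icc (g := fun t => δ t - ξ) hab (hδ.sub continuousOn_const)
    fun t ht h => hξ ⟨t, ht, sub_eq_zero.1 h⟩
  let e : Icc a b ≃ (δ '' Icc a b) := Equiv.Set.imageOfInjOn δ _ hinj
  have he : Continuous e := (continuousOn_iff_continuous_domRestrict.1 hδ).subtype_mk _
  have he' : Continuous e.symm := he.continuous_symm_of_equiv_compact_to_t2
  refine ⟨⟨fun u => l (e.symm u), (continuousOn_iff_continuous_domRestrict.1 hl).comp he'⟩,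
    fun u => ?_⟩
  have h1 := hexp _ (e.symm u).2
  have h2 : δ (e.symm u) = u := congrArg Subtype.val (e.apply_symm_apply u)
  rw [h2] at h1
  exact h1

/-! ### Cauchy transforms of measures with vanishing moments -/

/-- For |ξ| > R the geometric series of 1/(ξ - γ) converges uniformly on the arcs, and its terms
integrate to multiples of the moments. -/
theorem sum_integral_inv_sub_eq_zero_of_large {ι : Type*} [Fintype ι] {γ σ : ι → ℝ → ℂ}
    (hγ : ∀ k, ContinuousOn (γ k) (Icc 0 1))
    (hσ : ∀ k, IntervalIntegrable (σ k) MeasureTheory.volume 0 1)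
    (hmom : ∀ i : ℕ, ∑ k, ∫ t in (0 : ℝ)..1, σ k t * γ k t ^ i = 0) {R : ℝ}
    (hR : ∀ k, ∀ t ∈ Icc (0 : ℝ) 1, ‖γ k t‖ ≤ R) {ξ : ℂ} (hξ : R < ‖ξ‖) (hξ0 : ξ ≠ 0) :
    ∑ k, ∫ t in (0 : ℝ)..1, σ k t * (ξ - γ k t)⁻¹ = 0 := by
  choose Δ hΔ using fun k => exists_pathFunctional zero_le_one (hσ k)
  let y : ι → C(Icc (0 : ℝ) 1, ℂ) := fun k =>
    ⟨fun t => ξ⁻¹ * γ k t, continuous_const.mul (continuousOn_iff_continuous_domRestrict.1 (hγ k))⟩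
  have hy : ∀ k, ‖y k‖ < 1 := by
    intro k
    refine (ContinuousMap.norm_lt_iff _ one_pos).2 fun t => ?_
    change ‖ξ⁻¹ * γ k t‖ < 1
    rw [norm_mul, norm_inv, ← div_eq_inv_mul, div_lt_one (norm_pos_iff.2 hξ0)]
    exact (hR k t t.2).trans_lt hξ
  have h1 : ∀ k, ∀ t : Icc (0 : ℝ) 1, (ξ⁻¹ • ∑' i : ℕ, y k ^ i) t = (ξ - γ k t)⁻¹ := by
    intro k t
    have h2 := congrArg (fun f : C(Icc (0 : ℝ) 1, ℂ) => f t) (mul_neg_geom_series (y k) (hy k))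
    have h3 : (1 - ξ⁻¹ * γ k t) * (∑' i : ℕ, y k ^ i) t = 1 := h2
    rw [ContinuousMap.smul_apply, smul_eq_mul]
    refine eq_inv_of_mul_eq_one_left ?_
    have h4 : ξ - γ k t = ξ * (1 - ξ⁻¹ * γ k t) := by field_simp
    rw [h4]
    calc _ = (ξ⁻¹ * ξ) * ((1 - ξ⁻¹ * γ k t) * (∑' i : ℕ, y k ^ i) t) := by ring
      _ = 1 := by rw [h3, inv_mul_cancel₀ hξ0, one_mul]
  have h5 : ∀ k, HasSum (fun i : ℕ => ξ⁻¹ * (ξ⁻¹ ^ i * ∫ t in (0 : ℝ)..1, σ k t * γ k t ^ i))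
      (∫ t in (0 : ℝ)..1, σ k t * (ξ - γ k t)⁻¹) := by
    intro k
    have h6 := ((summable_geometric_of_norm_lt_one (hy k)).hasSum.const_smul
      ξ⁻¹).mapL (Δ k)
    rw [hΔ k _ (fun t => (ξ - γ k t)⁻¹) (h1 k)] at h6
    convert! h6 using 2 with i
    rw [map_smul, smul_eq_mul, hΔ k (y k ^ i) (fun t => ξ⁻¹ ^ i * γ k t ^ i) fun t => by
      rw [← mul_pow]; rfl, ← intervalIntegral.integral_const_mul]
    congr 2
    funext t
    ring
  have h7 := hasSum_sum fun k (_ : k ∈ Finset.univ) => h5 k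
  simp only [← Finset.mul_sum, hmom, mul_zero] at h7
  exact h7.unique hasSum_zero

/-- A complex measure on arcs whose moments vanish has a vanishing Cauchy transform on the
unbounded component of the complement. -/
theorem sum_integral_inv_sub_eq_zero {ι : Type*} [Fintype ι] {γ σ : ι → ℝ → ℂ}
    (hγ : ∀ k, ContinuousOn (γ k) (Icc 0 1))
    (hσ : ∀ k, IntervalIntegrable (σ k) MeasureTheory.volume 0 1)
    (hmom : ∀ i : ℕ, ∑ k, ∫ t in (0 : ℝ)..1, σ k t * γ k t ^ i = 0) {A : Set ℂ} (hA : IsCompact A)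
    (hAc : IsPreconnected Aᶜ) (hγA : ∀ k, ∀ t ∈ Icc (0 : ℝ) 1, γ k t ∈ A) {ξ : ℂ} (hξ : ξ ∉ A) :
    ∑ k, ∫ t in (0 : ℝ)..1, σ k t * (ξ - γ k t)⁻¹ = 0 := by
  choose Δ hΔ using fun k => exists_pathFunctional zero_le_one (hσ k)
  let x : ι → C(Icc (0 : ℝ) 1, ℂ) := fun k =>
    ⟨fun t => γ k t, continuousOn_iff_continuous_domRestrict.1 (hγ k)⟩
  -- The Cauchy kernel is the resolvent of γ k in the algebra of continuous functions, whose
  -- spectrum is the arc. This makes the Cauchy transform holomorphic off A, so its vanishing near a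
  -- point of large modulus extends to the connected complement.
  have hres : ∀ k, ∀ ξ ∉ A, ξ ∈ resolventSet ℂ (x k) := by
    intro k ξ hξ
    have h1 : ξ ∉ spectrum ℂ (x k) := by
      rw [ContinuousMap.spectrum_eq_range]
      rintro ⟨t, rfl⟩
      exact hξ (hγA k t t.2)
    exact not_not.1 h1
  have hval : ∀ k, ∀ ξ ∉ A, Δ k (resolvent (x k) ξ) =
      ∫ t in (0 : ℝ)..1, σ k t * (ξ - γ k t)⁻¹ := by
    intro k ξ hξ
    refine hΔ k _ (fun t => (ξ - γ k t)⁻¹) fun t => ?_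
    have h1 := Ring.inverse_mul_cancel _ (hres k ξ hξ)
    have h2 : resolvent (x k) ξ t * (ξ - γ k t) = 1 :=
      congrArg (fun f : C(Icc (0 : ℝ) 1, ℂ) => f t) h1
    exact eq_inv_of_mul_eq_one_left h2
  have hopen : IsOpen Aᶜ := hA.isClosed.isOpen_compl
  have hdiff : DifferentiableOn ℂ (fun ξ => ∑ k, Δ k (resolvent (x k) ξ)) Aᶜ := by
    refine DifferentiableOn.fun_sum fun k _ ξ hξ => ?_
    exact ((Δ k).differentiableAt.comp ξ
      (spectrum.hasDerivAt_resolvent_const_left (hres k ξ hξ)).differentiableAt).differentiableWithinAt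
  obtain ⟨R, hR, hAR⟩ : ∃ R > 0, A ⊆ Metric.closedBall 0 R := by
    obtain ⟨R, hR⟩ := hA.isBounded.subset_closedBall 0
    exact ⟨max R 1, by positivity, hR.trans (Metric.closedBall_subset_closedBall (le_max_left _ _))⟩
  have hlarge : ∀ ξ : ℂ, R < ‖ξ‖ → ξ ∉ A := fun ξ h hA => by
    have := mem_closedBall_zero_iff.1 (hAR hA)
    linarith
  have hx : R < ‖((R + 1 : ℝ) : ℂ)‖ := by
    rw [Complex.norm_real, Real.norm_of_nonneg (by positivity)]
    linarith
  have h0 : (fun ξ => ∑ k, Δ k (resolvent (x k) ξ)) =ᶠ[𝓝 ((R + 1 : ℝ) : ℂ)] 0 := by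
    filter_upwards [(isOpen_lt continuous_const continuous_norm).mem_nhds hx] with ξ hξ
    have hξ' : R < ‖ξ‖ := hξ
    simp only [hval _ ξ (hlarge ξ hξ')]
    exact sum_integral_inv_sub_eq_zero_of_large hγ hσ hmom
      (fun k t ht => mem_closedBall_zero_iff.1 (hAR (hγA k t ht))) hξ'
      (norm_pos_iff.1 (hR.trans hξ'))
  have h1 := (hdiff.analyticOnNhd hopen).eqOn_zero_of_preconnected_of_eventuallyEq_zero hAc
    (hlarge _ hx) h0 hξ
  simpa only [hval _ ξ hξ, Pi.zero_apply] using h1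

/-! ### The jump of a Cauchy transform across an arc -/

/-- The hypothesis on c covers i and -i at once. The real multiple xv has distance ‖v‖√(1 + x²) from
cv, and the perturbation costs at most a quarter of that. -/
theorem norm_sub_ge_of_close {v q c : ℂ} {x : ℝ} (hc : c ^ 2 = -1)
    (h : ‖q - x * v‖ ≤ ‖v‖ * |x| / 4) : ‖v‖ * √(1 + x ^ 2) * (3 / 4) ≤ ‖q - c * v‖ := by
  have hcc : c = Complex.I ∨ c = -Complex.I := by
    have : (c - Complex.I) * (c + Complex.I) = 0 := by
      linear_combination hc - Complex.I_sq
    rcases mul_eq_zero.1 this with h | h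
    · exact Or.inl (sub_eq_zero.1 h)
    · exact Or.inr (eq_neg_of_add_eq_zero_left h)
  have h1 : ‖(x : ℂ) * v - c * v‖ = ‖v‖ * √(1 + x ^ 2) := by
    rw [← sub_mul, norm_mul, mul_comm]
    congr 1
    rw [Complex.norm_def, Complex.normSq_apply]
    congr 1
    rcases hcc with rfl | rfl
    · simp
      ring
    · simp
      ring
  have h2 : |x| ≤ √(1 + x ^ 2) := Real.abs_le_sqrt (by linarith)
  have h3 := norm_sub_norm_le ((x : ℂ) * v - c * v) (x * v - q)
  rw [sub_sub_sub_cancel_left, norm_sub_rev (x * v) q, h1] at h3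
  have h4 := mul_le_mul_of_nonneg_left h2 (norm_nonneg v)
  have h5 : ‖q - c * v‖ = ‖q - c * v‖ := rfl
  linarith

/-- Supplies an integrable majorant, uniform in ε, for the rescaled jump kernel along a curve close
to its tangent. -/
theorem norm_inv_sub_inv_le {v q : ℂ} {x : ℝ} (hv : v ≠ 0)
    (h : ‖q - x * v‖ ≤ ‖v‖ * |x| / 4) :
    q - Complex.I * v ≠ 0 ∧ q + Complex.I * v ≠ 0 ∧
    ‖(q - Complex.I * v)⁻¹ - (q + Complex.I * v)⁻¹‖ ≤ 4 / ‖v‖ * (1 + x ^ 2)⁻¹ := by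
  have hv' : 0 < ‖v‖ := norm_pos_iff.2 hv
  have h1 := norm_sub_ge_of_close Complex.I_sq h
  have h2 := norm_sub_ge_of_close (c := -Complex.I) (by simp) h
  rw [neg_mul, sub_neg_eq_add] at h2
  have hs : 0 < √(1 + x ^ 2) := by positivity
  have hpos : 0 < ‖v‖ * √(1 + x ^ 2) * (3 / 4) := by positivity
  have n1 : q - Complex.I * v ≠ 0 := norm_pos_iff.1 (hpos.trans_le h1)
  have n2 : q + Complex.I * v ≠ 0 := norm_pos_iff.1 (hpos.trans_le h2)
  refine ⟨n1, n2, ?_⟩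
  have h3 : (q - Complex.I * v)⁻¹ - (q + Complex.I * v)⁻¹ =
      2 * Complex.I * v / ((q - Complex.I * v) * (q + Complex.I * v)) := by
    field_simp
    ring
  have h4 := mul_le_mul h1 h2 hpos.le (norm_nonneg _)
  have h5 : √(1 + x ^ 2) * √(1 + x ^ 2) = 1 + x ^ 2 := Real.mul_self_sqrt (by positivity)
  rw [h3, norm_div, norm_mul, norm_mul, norm_mul, Complex.norm_I, Complex.norm_ofNat, mul_one,
    div_le_iff₀ (by positivity)]
  calc 2 * ‖v‖ ≤ 4 / ‖v‖ * (1 + x ^ 2)⁻¹ * (‖v‖ * √(1 + x ^ 2) * (3 / 4) *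
        (‖v‖ * √(1 + x ^ 2) * (3 / 4))) := by
        have h6 : 4 / ‖v‖ * (1 + x ^ 2)⁻¹ * (‖v‖ * √(1 + x ^ 2) * (3 / 4) *
            (‖v‖ * √(1 + x ^ 2) * (3 / 4))) = 9 / 4 * ‖v‖ := by
          have h7 : (‖v‖ * √(1 + x ^ 2) * (3 / 4) * (‖v‖ * √(1 + x ^ 2) * (3 / 4))) =
            ‖v‖ ^ 2 * (√(1 + x ^ 2) * √(1 + x ^ 2)) * (9 / 16) := by ring
          rw [h7, h5]
          field_simp
          norm_num
        rw [h6]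
        linarith
    _ ≤ _ := mul_le_mul_of_nonneg_left h4 (by positivity)

/-- The difference of the Cauchy kernels of the two points at distance `ε` on the two sides of an
arc through `p` with direction `v`. -/
noncomputable def jumpKernel (p v : ℂ) (ε : ℝ) (u : ℂ) : ℂ :=
  (p + ε * (Complex.I * v) - u)⁻¹ - (p - ε * (Complex.I * v) - u)⁻¹

/-- After rescaling by ε around p the kernel depends only on the difference quotient (u - p)/ε,
which tends to xv along the curve. -/
theorem jumpKernel_eq {p v u : ℂ} {ε : ℝ} (hε : ε ≠ 0) :
    (ε : ℂ) * jumpKernel p v ε u =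
      -(((u - p) / ε - Complex.I * v)⁻¹ - ((u - p) / ε + Complex.I * v)⁻¹) := by
  have hε' : (ε : ℂ) ≠ 0 := by exact_mod_cast hε
  have h1 : p + ε * (Complex.I * v) - u = -ε * ((u - p) / ε - Complex.I * v) := by
    field_simp
    ring
  have h2 : p - ε * (Complex.I * v) - u = -ε * ((u - p) / ε + Complex.I * v) := by
    field_simp
    ring
  rw [jumpKernel, h1, h2, mul_inv, mul_inv]
  field_simp
  ring

theorem jumpKernel_far {p v u : ℂ} {ε m : ℝ} (hm : 0 < m) (hu : m ≤ ‖u - p‖) (hε : 0 < ε)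
    (hεm : ε * ‖v‖ ≤ m / 2) :
    p + ε * (Complex.I * v) - u ≠ 0 ∧ p - ε * (Complex.I * v) - u ≠ 0 ∧
    ‖jumpKernel p v ε u‖ ≤ ε * (8 * ‖v‖ / m ^ 2) := by
  have h0 : ‖(ε : ℂ) * (Complex.I * v)‖ = ε * ‖v‖ := by
    rw [norm_mul, norm_mul, Complex.norm_I, one_mul, Complex.norm_real, Real.norm_of_nonneg hε.le]
  have h1 : m / 2 ≤ ‖p + ε * (Complex.I * v) - u‖ := by
    have := norm_sub_norm_le (u - p) (ε * (Complex.I * v))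
    rw [← norm_neg (p + ε * (Complex.I * v) - u)]
    have e : -(p + ε * (Complex.I * v) - u) = u - p - ε * (Complex.I * v) := by ring
    rw [e]
    linarith
  have h2 : m / 2 ≤ ‖p - ε * (Complex.I * v) - u‖ := by
    have := norm_sub_norm_le (u - p) (-(ε * (Complex.I * v)))
    rw [← norm_neg (p - ε * (Complex.I * v) - u)]
    have e : -(p - ε * (Complex.I * v) - u) = u - p - -(ε * (Complex.I * v)) := by ring
    rw [e]
    rw [norm_neg] at this
    linarith
  have n1 : p + ε * (Complex.I * v) - u ≠ 0 := norm_pos_iff.1 (lt_of_lt_of_le (by positivity) h1)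
  have n2 : p - ε * (Complex.I * v) - u ≠ 0 := norm_pos_iff.1 (lt_of_lt_of_le (by positivity) h2)
  refine ⟨n1, n2, ?_⟩
  have h3 : jumpKernel p v ε u = -2 * (ε * (Complex.I * v)) /
      ((p + ε * (Complex.I * v) - u) * (p - ε * (Complex.I * v) - u)) := by
    rw [jumpKernel, inv_sub_inv n1 n2]
    congr 1
    ring
  have h4 := mul_le_mul h1 h2 (by positivity) (norm_nonneg _)
  rw [h3, norm_div, norm_mul (-2), norm_mul (_ - u), h0, norm_neg, Complex.norm_ofNat, div_le_iff₀ (by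
    have := norm_pos_iff.2 n1
    have := norm_pos_iff.2 n2
    positivity)]
  calc 2 * (ε * ‖v‖) = ε * (8 * ‖v‖ / m ^ 2) * (m / 2 * (m / 2)) := by
        field_simp
        ring
    _ ≤ _ := mul_le_mul_of_nonneg_left h4 (by positivity)

theorem tendsto_integral_jumpKernel_far {γ σ : ℝ → ℂ} {p v : ℂ} {a b m : ℝ} (hab : a ≤ b)
    (hσ : IntervalIntegrable σ MeasureTheory.volume a b) (hm : 0 < m)
    (hγ : ∀ t ∈ Icc a b, m ≤ ‖γ t - p‖) :
    Tendsto (fun ε : ℝ => ∫ t in a..b, σ t * jumpKernel p v ε (γ t)) (𝓝[>] 0) (𝓝 0) := by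
  have h1 : ∀ᶠ ε : ℝ in 𝓝[>] 0, ε * ‖v‖ ≤ m / 2 := by
    have : Tendsto (fun ε : ℝ => ε * ‖v‖) (𝓝[>] 0) (𝓝 (0 * ‖v‖)) :=
      (tendsto_id.mul_const _).mono_left nhdsWithin_le_nhds
    rw [zero_mul] at this
    exact this.eventually (ge_mem_nhds (by positivity))
  have h2 : Tendsto (fun ε : ℝ => ∫ t in a..b, ε * (8 * ‖v‖ / m ^ 2) * ‖σ t‖) (𝓝[>] 0) (𝓝 0) := by
    have : Tendsto (fun ε : ℝ => ε * (8 * ‖v‖ / m ^ 2) * ∫ t in a..b, ‖σ t‖) (𝓝[>] 0)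
        (𝓝 (0 * (8 * ‖v‖ / m ^ 2) * ∫ t in a..b, ‖σ t‖)) :=
      ((tendsto_id.mul_const _).mul_const _).mono_left nhdsWithin_le_nhds
    simpa only [intervalIntegral.integral_const_mul, zero_mul] using this
  refine squeeze_zero_norm' ?_ h2
  filter_upwards [h1, self_mem_nhdsWithin] with ε hε hε0
  refine intervalIntegral.norm_integral_le_of_norm_le hab (Eventually.of_forall fun t ht => ?_)
    (hσ.norm.const_mul _)
  rw [norm_mul, mul_comm]
  exact mul_le_mul_of_nonneg_right (jumpKernel_far hm (hγ t (Ioc_subset_Icc_self ht)) hε0 hε).2.2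
    (norm_nonneg _)

/-- Along the tangent line the kernel is (2i/v)/(1 + x²), a multiple of the Poisson kernel of total
mass π. -/
theorem integral_inv_sub_inv {v : ℂ} (hv : v ≠ 0) :
    ∫ x : ℝ, (((x : ℂ) * v - Complex.I * v)⁻¹ - (x * v + Complex.I * v)⁻¹) =
      2 * Real.pi * Complex.I / v := by
  have h1 : ∀ x : ℝ, ((x : ℂ) * v - Complex.I * v)⁻¹ - (x * v + Complex.I * v)⁻¹ =
      2 * Complex.I / v * (((1 + x ^ 2)⁻¹ : ℝ) : ℂ) := by
    intro x
    obtain ⟨n1, n2, -⟩ := norm_inv_sub_inv_le (q := x * v) (x := x) hv (by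
      rw [sub_self, norm_zero]; positivity)
    have h2 : (1 : ℂ) + (x : ℂ) ^ 2 ≠ 0 := by
      have : (0 : ℝ) < 1 + x ^ 2 := by positivity
      exact_mod_cast this.ne'
    have h3 : ((x : ℂ) * v - Complex.I * v) * (x * v + Complex.I * v) = v ^ 2 * (1 + x ^ 2) := by
      linear_combination (-v ^ 2) * Complex.I_sq
    rw [inv_sub_inv n1 n2, h3]
    push_cast
    field_simp
    ring
  simp only [h1]
  rw [MeasureTheory.integral_const_mul, integral_complex_ofReal, integral_univ_inv_one_add_sq]
  ring

theorem ne_zero_of_close {p v u : ℂ} {ε x : ℝ} (hv : v ≠ 0) (hε : 0 < ε)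
    (h : ‖u - p - x * v‖ ≤ ‖v‖ * |x| / 4) :
    p + ε * (Complex.I * v) - u ≠ 0 ∧ p - ε * (Complex.I * v) - u ≠ 0 := by
  have hε' : (ε : ℂ) ≠ 0 := by exact_mod_cast hε.ne'
  have h1 : ‖(u - p) / ε - (x / ε : ℝ) * v‖ ≤ ‖v‖ * |x / ε| / 4 := by
    have h2 : (u - p) / ε - (x / ε : ℝ) * v = (u - p - x * v) / ε := by
      push_cast
      field_simp
    rw [h2, norm_div, Complex.norm_real, Real.norm_of_nonneg hε.le, abs_div, abs_of_pos hε]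
    calc _ ≤ ‖v‖ * |x| / 4 / ε := div_le_div_of_nonneg_right h hε.le
      _ = _ := by ring
  obtain ⟨n1, n2, -⟩ := norm_inv_sub_inv_le hv h1
  constructor
  · intro h
    apply n1
    field_simp
    linear_combination -h
  · intro h
    apply n2
    field_simp
    linear_combination -h

/-- The substitution t = s + εx turns the integral into one over an interval growing to ℝ. Dominated
convergence against 1/(1 + x²) leaves σ(s) times the integral of the kernel of the tangent line. -/
theorem tendsto_integral_jumpKernel_near {γ σ : ℝ → ℂ} {p v : ℂ} {s η : ℝ} (hη : 0 < η)
    (hσ : IntervalIntegrable σ MeasureTheory.volume (s - η) (s + η)) (hv : v ≠ 0)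
    (hγ : HasDerivAt γ v s) (hp : γ s = p) (hσs : ContinuousAt σ s) (hγc :
      ContinuousOn γ (Icc (s - η) (s + η)))
    (hclose : ∀ t ∈ Icc (s - η) (s + η), ‖γ t - p - (t - s : ℝ) * v‖ ≤ ‖v‖ * |t - s| / 4) {S : ℝ}
    (hS : ∀ t ∈ Icc (s - η) (s + η), ‖σ t‖ ≤ S) :
    Tendsto (fun ε : ℝ => ∫ t in (s - η)..(s + η), σ t * jumpKernel p v ε (γ t)) (𝓝[>] 0)
      (𝓝 (-(2 * Real.pi * Complex.I * σ s / v))) := by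
  have hS0 : 0 ≤ S := (norm_nonneg _).trans (hS s ⟨by linarith, by linarith⟩)
  set g : ℝ → ℝ → ℂ := fun ε x => σ (s + ε * x) * ((ε : ℂ) * jumpKernel p v ε (γ (s + ε * x))) with hg
  have hsub : ∀ ε : ℝ, 0 < ε → ∫ t in (s - η)..(s + η), σ t * jumpKernel p v ε (γ t) =
      ∫ x, (Ioc (-η / ε) (η / ε)).indicator (g ε) x := by
    intro ε hε
    have h1 := intervalIntegral.smul_integral_comp_add_mul (a := -η / ε) (b := η / ε)
      (fun t => σ t * jumpKernel p v ε (γ t)) ε s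
    have h2 : s + ε * (-η / ε) = s - η := by
      field_simp
      ring
    have h3 : s + ε * (η / ε) = s + η := by field_simp
    rw [h2, h3] at h1
    rw [← h1, MeasureTheory.integral_indicator measurableSet_Ioc,
      ← intervalIntegral.integral_of_le (by
        rw [div_le_div_iff_of_pos_right hε]; linarith), ← intervalIntegral.integral_smul]
    congr 1
    funext x
    rw [hg, Complex.real_smul]
    ring
  have hmem : ∀ ε : ℝ, 0 < ε → ∀ x ∈ Ioc (-η / ε) (η / ε), s + ε * x ∈ Icc (s - η) (s + η) := by
    intro ε hε x hx
    have h1 := (div_lt_iff₀ hε).1 hx.1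
    have h2 := (le_div_iff₀ hε).1 hx.2
    constructor <;> nlinarith
  have hq : ∀ ε : ℝ, 0 < ε → ∀ x, s + ε * x ∈ Icc (s - η) (s + η) →
      ‖(γ (s + ε * x) - p) / ε - x * v‖ ≤ ‖v‖ * |x| / 4 := by
    intro ε hε x hx
    have h1 := hclose _ hx
    have hε' : (ε : ℂ) ≠ 0 := by exact_mod_cast hε.ne'
    have h2 : (γ (s + ε * x) - p) / ε - x * v =
        (γ (s + ε * x) - p - (s + ε * x - s : ℝ) * v) / ε := by
      push_cast
      field_simp
      ring
    rw [h2, norm_div, Complex.norm_real, Real.norm_of_nonneg hε.le, div_le_iff₀ hε]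
    refine h1.trans (le_of_eq ?_)
    rw [add_sub_cancel_left, abs_mul, abs_of_pos hε]
    ring
  have hlim : -(2 * Real.pi * Complex.I * σ s / v) =
      ∫ x : ℝ, σ s * -(((x : ℂ) * v - Complex.I * v)⁻¹ - (x * v + Complex.I * v)⁻¹) := by
    rw [MeasureTheory.integral_const_mul, MeasureTheory.integral_neg, integral_inv_sub_inv hv]
    ring
  rw [hlim]
  have hpos : ∀ᶠ ε : ℝ in 𝓝[>] 0, 0 < ε := self_mem_nhdsWithin
  refine Tendsto.congr' (f₁ := fun ε : ℝ => ∫ x, (Ioc (-η / ε) (η / ε)).indicator (g ε) x) ?_ ?_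
  · filter_upwards [hpos] with ε hε using (hsub ε hε).symm
  refine MeasureTheory.tendsto_integral_filter_of_dominated_convergence
    (fun x => S * (4 / ‖v‖ * (1 + x ^ 2)⁻¹)) ?_ ?_ ?_ ?_
  · filter_upwards [hpos] with ε hε
    have hint : IntervalIntegrable (fun t => σ t * jumpKernel p v ε (γ t)) MeasureTheory.volume
        (s - η) (s + η) := by
      refine hσ.mul_continuousOn ?_
      rw [uIcc_of_le (by linarith)]
      have hne : ∀ t ∈ Icc (s - η) (s + η), p + ε * (Complex.I * v) - γ t ≠ 0 ∧
          p - ε * (Complex.I * v) - γ t ≠ 0 := by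
        intro t ht
        exact ne_zero_of_close hv hε (hclose t ht)
      exact ((continuousOn_const.sub hγc).inv₀ fun t ht => (hne t ht).1).sub
        ((continuousOn_const.sub hγc).inv₀ fun t ht => (hne t ht).2)
    have h1 := (hint.comp_add_left s).comp_mul_left (c := ε)
    have h2 : (s - η - s) / ε = -η / ε := by ring
    have h3 : (s + η - s) / ε = η / ε := by ring
    rw [h2, h3] at h1
    have h4 : MeasureTheory.IntegrableOn (g ε) (Ioc (-η / ε) (η / ε)) := by
      refine (h1.1.const_mul (ε : ℂ)).congr (Eventually.of_forall fun x => ?_)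
      simp only [hg]
      ring
    exact (h4.integrable_indicator measurableSet_Ioc).aestronglyMeasurable
  · filter_upwards [hpos] with ε hε
    refine Eventually.of_forall fun x => ?_
    by_cases hx : x ∈ Ioc (-η / ε) (η / ε)
    · rw [indicator_of_mem hx, hg, norm_mul, jumpKernel_eq hε.ne', norm_neg]
      have hm := hmem ε hε x hx
      exact mul_le_mul (hS _ hm) (norm_inv_sub_inv_le hv (hq ε hε x hm)).2.2 (norm_nonneg _) hS0
    · rw [indicator_of_notMem hx, norm_zero]
      positivity
  · exact (integrable_inv_one_add_sq.const_mul _).const_mul _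
  · refine Eventually.of_forall fun x => ?_
    have hto : Tendsto (fun ε : ℝ => s + ε * x) (𝓝[>] 0) (𝓝 s) := by
      have : Tendsto (fun ε : ℝ => s + ε * x) (𝓝 0) (𝓝 (s + 0 * x)) :=
        (continuous_const.add (continuous_id.mul continuous_const)).tendsto 0
      rw [zero_mul, add_zero] at this
      exact this.mono_left nhdsWithin_le_nhds
    have hqlim : Tendsto (fun ε : ℝ => (γ (s + ε * x) - p) / ε) (𝓝[>] 0) (𝓝 (x * v)) := by
      have h1 : HasDerivAt (fun ε : ℝ => γ (s + ε * x)) ((x : ℝ) • v) 0 := by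
        have h2 : HasDerivAt (fun ε : ℝ => s + ε * x) x 0 := by
          simpa using ((hasDerivAt_id (0 : ℝ)).mul_const x).const_add s
        exact HasDerivAt.scomp (0 : ℝ) (by simpa using hγ) h2
      have h3 := h1.tendsto_slope_zero_right
      simp only [zero_add, zero_mul, add_zero, hp] at h3
      refine h3.congr fun ε => ?_
      rw [Complex.real_smul, Complex.ofReal_inv, inv_mul_eq_div]
    obtain ⟨n1, n2, -⟩ := norm_inv_sub_inv_le (q := x * v) (x := x) hv (by
      rw [sub_self, norm_zero]; positivity)
    have hl := (hσs.tendsto.comp hto).mul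
      (((hqlim.sub_const (Complex.I * v)).inv₀ n1).sub ((hqlim.add_const (Complex.I * v)).inv₀ n2)).neg
    refine hl.congr' ?_
    have hev : ∀ᶠ ε : ℝ in 𝓝[>] 0, |ε * x| < η := by
      have h1 : Tendsto (fun ε : ℝ => |ε * x|) (𝓝 0) (𝓝 |0 * x|) :=
        ((continuous_id.mul continuous_const).abs).tendsto 0
      rw [zero_mul, abs_zero] at h1
      exact (h1.mono_left nhdsWithin_le_nhds).eventually (gt_mem_nhds hη)
    filter_upwards [hpos, hev] with ε hε hεx
    have hx : x ∈ Ioc (-η / ε) (η / ε) := by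
      rw [abs_lt] at hεx
      refine ⟨(div_lt_iff₀ hε).2 ?_, (le_div_iff₀ hε).2 ?_⟩ <;> nlinarith
    rw [indicator_of_mem hx, hg]
    simp only [jumpKernel_eq hε.ne', Function.comp_apply]

/-- The jump of the Cauchy transform across an arc. -/
theorem tendsto_integral_jumpKernel {γ σ : ℝ → ℂ} {v : ℂ} {a b s : ℝ} (hs : s ∈ Ioo a b)
    (hγ : ContinuousOn γ (Icc a b)) (hinj : ∀ t ∈ Icc a b, γ t = γ s → t = s)
    (hσ : IntervalIntegrable σ MeasureTheory.volume a b) (hσs : ContinuousAt σ s)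
    (hd : HasDerivAt γ v s) (hv : v ≠ 0) :
    Tendsto (fun ε : ℝ => ∫ t in a..b, σ t * jumpKernel (γ s) v ε (γ t)) (𝓝[>] 0)
      (𝓝 (-(2 * Real.pi * Complex.I * σ s / v))) ∧
    ∀ᶠ ε : ℝ in 𝓝[>] 0, ∀ t ∈ Icc a b, γ s + ε * (Complex.I * v) - γ t ≠ 0 ∧
      γ s - ε * (Complex.I * v) - γ t ≠ 0 := by
  have hv' : 0 < ‖v‖ := norm_pos_iff.2 hv
  have hev : ∀ᶠ t in 𝓝 s, t ∈ Ioo a b ∧ ‖γ t - γ s - (t - s : ℝ) * v‖ ≤ ‖v‖ * |t - s| / 4 ∧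
      ‖σ t‖ ≤ ‖σ s‖ + 1 := by
    have h1 := (hasDerivAt_iff_isLittleO.1 hd).bound (c := ‖v‖ / 4) (by positivity)
    have h2 : ∀ᶠ t in 𝓝 s, ‖σ t‖ < ‖σ s‖ + 1 := hσs.norm.eventually (gt_mem_nhds (lt_add_one _))
    filter_upwards [Ioo_mem_nhds hs.1 hs.2, h1, h2] with t h3 h4 h5
    refine ⟨h3, ?_, h5.le⟩
    rw [Complex.real_smul, Real.norm_eq_abs] at h4
    linarith
  obtain ⟨η', hη', hball⟩ := Metric.eventually_nhds_iff_ball.1 hev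
  obtain ⟨η, hη, hηη'⟩ := exists_between hη'
  have hmem : ∀ t ∈ Icc (s - η) (s + η), t ∈ Metric.ball s η' := fun t ht => by
    rw [Metric.mem_ball, Real.dist_eq, abs_lt]
    constructor <;> linarith [ht.1, ht.2]
  have hsa : a < s - η := (hball _ (hmem _ ⟨le_rfl, by linarith⟩)).1.1
  have hsb : s + η < b := (hball _ (hmem _ ⟨by linarith, le_rfl⟩)).1.2
  -- Away from s the curve keeps a positive distance from γ(s), by injectivity there and
  -- compactness; these parts contribute O(ε).
  have hK : IsCompact (Icc a b \ Ioo (s - η) (s + η)) := isCompact_Icc.diff isOpen_Ioo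
  have hKne : (Icc a b \ Ioo (s - η) (s + η)).Nonempty :=
    ⟨a, ⟨le_rfl, (hs.1.trans hs.2).le⟩, fun h => by linarith [h.1]⟩
  obtain ⟨t₀, ht₀, hmin⟩ := hK.exists_isMinOn hKne
    ((hγ.mono sdiff_subset).sub continuousOn_const).norm (f := fun t => ‖γ t - γ s‖)
  have hm : 0 < ‖γ t₀ - γ s‖ := norm_pos_iff.2 <| sub_ne_zero.2 fun h => by
    have := hinj t₀ ht₀.1 h
    exact ht₀.2 ⟨by linarith, by linarith⟩
  have hfar : ∀ t ∈ Icc a b, t ∉ Ioo (s - η) (s + η) → ‖γ t₀ - γ s‖ ≤ ‖γ t - γ s‖ :=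
    fun t h1 h2 => hmin ⟨h1, h2⟩
  have hne : ∀ᶠ ε : ℝ in 𝓝[>] 0, ∀ t ∈ Icc a b, γ s + ε * (Complex.I * v) - γ t ≠ 0 ∧
      γ s - ε * (Complex.I * v) - γ t ≠ 0 := by
    have h1 : ∀ᶠ ε : ℝ in 𝓝[>] 0, ε * ‖v‖ ≤ ‖γ t₀ - γ s‖ / 2 := by
      have : Tendsto (fun ε : ℝ => ε * ‖v‖) (𝓝[>] 0) (𝓝 (0 * ‖v‖)) :=
        (tendsto_id.mul_const _).mono_left nhdsWithin_le_nhds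
      rw [zero_mul] at this
      exact this.eventually (ge_mem_nhds (by positivity))
    filter_upwards [h1, self_mem_nhdsWithin] with ε hε hε0 t ht
    by_cases h2 : t ∈ Ioo (s - η) (s + η)
    · exact ne_zero_of_close hv hε0 (hball t (hmem t (Ioo_subset_Icc_self h2))).2.1
    · have := jumpKernel_far hm (hfar t ht h2) hε0 hε
      exact ⟨this.1, this.2.1⟩
  refine ⟨?_, hne⟩
  have hsub : ∀ {c d : ℝ}, a ≤ c → c ≤ d → d ≤ b →
      IntervalIntegrable σ MeasureTheory.volume c d := fun h1 h2 h3 => hσ.mono_set (by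
    rw [uIcc_of_le h2, uIcc_of_le (h1.trans (h2.trans h3))]
    exact Icc_subset_Icc h1 h3)
  have T1 := tendsto_integral_jumpKernel_far (v := v) hsa.le
    (hsub le_rfl hsa.le (by linarith)) hm fun t ht => hfar t ⟨ht.1, by linarith [ht.2]⟩
      fun h => by linarith [ht.2, h.1]
  have T2 := tendsto_integral_jumpKernel_near hη (hsub hsa.le (by linarith) hsb.le) hv hd rfl hσs
    (hγ.mono (Icc_subset_Icc hsa.le hsb.le)) (fun t ht => (hball t (hmem t ht)).2.1)
    fun t ht => (hball t (hmem t ht)).2.2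
  have T3 := tendsto_integral_jumpKernel_far (v := v) hsb.le
    (hsub (by linarith) hsb.le le_rfl) hm fun t ht => hfar t ⟨by linarith [ht.1], ht.2⟩
      fun h => by linarith [ht.1, h.2]
  have T := (T1.add T2).add T3
  rw [zero_add, add_zero] at T
  refine T.congr' ?_
  filter_upwards [hne] with ε hε
  have hint : ∀ {c d : ℝ}, a ≤ c → c ≤ d → d ≤ b → IntervalIntegrable
      (fun t => σ t * jumpKernel (γ s) v ε (γ t)) MeasureTheory.volume c d := by
    intro c d h1 h2 h3
    refine (hsub h1 h2 h3).mul_continuousOn ?_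
    rw [uIcc_of_le h2]
    have hγ' := hγ.mono (Icc_subset_Icc h1 h3)
    exact ((continuousOn_const.sub hγ').inv₀ fun t ht =>
      (hε t (Icc_subset_Icc h1 h3 ht)).1).sub
      ((continuousOn_const.sub hγ').inv₀ fun t ht => (hε t (Icc_subset_Icc h1 h3 ht)).2)
  rw [intervalIntegral.integral_add_adjacent_intervals (hint le_rfl hsa.le (by linarith))
    (hint hsa.le (by linarith) hsb.le), intervalIntegral.integral_add_adjacent_intervals
    (hint le_rfl (by linarith) hsb.le) (hint (by linarith) hsb.le le_rfl)]

/-! ### A linear relation between arc integrals annihilates all moments -/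

/-- Division of u^(m+1) by zⱼ - u leaves a simple pole and a polynomial of degree m. The coefficient
of u^m in total is m + 1 - |μ|, and the lower terms are accessible to induction. -/
theorem pow_mul_logCoeff {n : ℕ} (μ : Fin (n + 1) → ℝ) {z : Fin (n + 1) → ℂ} {u : ℂ}
    (hne : ∀ j, z j - u ≠ 0) (m : ℕ) :
    deriv (fun u => u ^ (m + 1)) u + u ^ (m + 1) * logCoeff μ z u = (m + 1) * u ^ m +
      ∑ j, (μ j * z j ^ (m + 1) * (z j - u)⁻¹ +
        ∑ i ∈ Finset.range (m + 1), -(μ j * z j ^ (m - i)) * u ^ i) := by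
  have hd : deriv (fun u : ℂ => u ^ (m + 1)) u = (m + 1) * u ^ m := by simp
  rw [hd, logCoeff, Finset.mul_sum]
  congr 1
  refine Finset.sum_congr rfl fun j _ => ?_
  have hn := hne j
  have hg := geom_sum₂_mul u (z j) (m + 1)
  have e3 : ∑ i ∈ Finset.range (m + 1), -(μ j * z j ^ (m - i)) * u ^ i =
      -(μ j * ∑ i ∈ Finset.range (m + 1), u ^ i * z j ^ (m + 1 - 1 - i)) := by
    rw [Finset.mul_sum, ← Finset.sum_neg_distrib]
    refine Finset.sum_congr rfl fun i _ => ?_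
    rw [Nat.add_sub_cancel]
    ring
  rw [e3]
  field_simp
  linear_combination (-μ j : ℂ) * hg

theorem TwistedPath.Avoids.integral_pow_exact {n : ℕ} (μ : Fin (n + 1) → ℝ)
    {z : Fin (n + 1) → ℂ} {P : TwistedPath} (hP : P.Avoids z) (m : ℕ) :
    P.integral (fun u => deriv (fun u => u ^ (m + 1)) u + u ^ (m + 1) * logCoeff μ z u) =
      (m + 1) * P.integral (fun u => u ^ m) +
        ∑ j, (μ j * z j ^ (m + 1) * P.integral (fun u => (z j - u)⁻¹) +
          ∑ i ∈ Finset.range (m + 1), -(μ j * z j ^ (m - i)) * P.integral (fun u => u ^ i)) := by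
  have hcp : ∀ (a : ℂ) (i : ℕ), ContinuousOn (fun t => a * P.c t ^ i) (uIcc P.a P.b) := fun a i =>
    continuousOn_const.mul (hP.cont.pow i)
  have hcq : ∀ (a : ℂ) (j), ContinuousOn (fun t => a * (z j - P.c t)⁻¹) (uIcc P.a P.b) :=
    fun a j => continuousOn_const.mul ((continuousOn_const.sub hP.cont).inv₀ (hP.ne j))
  have hcs : ∀ j, ContinuousOn (fun t => ∑ i ∈ Finset.range (m + 1),
      -(μ j * z j ^ (m - i)) * P.c t ^ i) (uIcc P.a P.b) := fun j =>
    continuousOn_finsetSum _ fun i _ => hcp _ i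
  have hct : ∀ j, ContinuousOn (fun t => μ j * z j ^ (m + 1) * (z j - P.c t)⁻¹ +
      ∑ i ∈ Finset.range (m + 1), -(μ j * z j ^ (m - i)) * P.c t ^ i) (uIcc P.a P.b) :=
    fun j => (hcq _ j).add (hcs j)
  rw [TwistedPath.integral_congr (g := fun u => (m + 1) * u ^ m +
      ∑ j, (μ j * z j ^ (m + 1) * (z j - u)⁻¹ +
        ∑ i ∈ Finset.range (m + 1), -(μ j * z j ^ (m - i)) * u ^ i))
      fun t ht => pow_mul_logCoeff μ (fun j => hP.ne j t ht) m,
    hP.integral_add (f := fun u => (m + 1) * u ^ m)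
    (g := fun u => ∑ j, (μ j * z j ^ (m + 1) * (z j - u)⁻¹ +
      ∑ i ∈ Finset.range (m + 1), -(μ j * z j ^ (m - i)) * u ^ i)) (hcp _ m)
    (continuousOn_finsetSum _ fun j _ => hct j), TwistedPath.integral_const_mul,
    hP.integral_sum _ hct]
  congr 1
  refine Finset.sum_congr rfl fun j _ => ?_
  rw [hP.integral_add (f := fun u => μ j * z j ^ (m + 1) * (z j - u)⁻¹)
    (g := fun u => ∑ i ∈ Finset.range (m + 1), -(μ j * z j ^ (m - i)) * u ^ i) (hcq _ j) (hcs j),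
    TwistedPath.integral_const_mul, hP.integral_sum _ (f := fun i u => -(μ j * z j ^ (m - i)) * u ^ i)
      fun i => hcp _ i]
  congr 1
  exact Finset.sum_congr rfl fun i _ => TwistedPath.integral_const_mul _ _ _

/-- Strong induction through the exact differential of u^(m+1) times the integrand: the poles
contribute nothing by hypothesis, the lower moments vanish by induction, and (m + 1 - |μ|) times the
m-th moment remains. -/
theorem sum_integral_pow_eq_zero {n : ℕ} {μ : Fin (n + 1) → ℝ}
    (hsum : ∀ m : ℕ, 2 ≤ m → ∑ k, μ k ≠ (m : ℝ)) {z : Fin (n + 1) → ℂ} {κ : Type*} [Fintype κ]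
    {D : κ → TwistedPath} (hD : ∀ k, (D k).Avoids z) {c : κ → ℂ}
    (hex : ∀ G : ℂ → ℂ, Differentiable ℂ G →
      ∑ k, c k * (D k).integral (fun u => deriv G u + G u * logCoeff μ z u) = 0)
    (h1 : ∑ k, c k * (D k).integral (fun _ => 1) = 0)
    (hpole : ∀ j, ∑ k, c k * (D k).integral (fun u => (z j - u)⁻¹) = 0) (m : ℕ) :
    ∑ k, c k * (D k).integral (fun u => u ^ m) = 0 := by
  induction m using Nat.strong_induction_on with
  | _ m ih =>
  rcases Nat.eq_zero_or_pos m with rfl | hm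
  · simpa using h1
  have h0 := hex (fun u => u ^ (m + 1)) (differentiable_id.pow _)
  simp only [fun k => (hD k).integral_pow_exact μ m, mul_add, Finset.mul_sum, Finset.sum_add_distrib] at h0
  have e4 : ∑ k, ∑ j, c k * (μ j * z j ^ (m + 1) * (D k).integral (fun u => (z j - u)⁻¹)) = 0 := by
    rw [Finset.sum_comm]
    refine Finset.sum_eq_zero fun j _ => ?_
    calc _ = μ j * z j ^ (m + 1) * ∑ k, c k * (D k).integral (fun u => (z j - u)⁻¹) := by
          rw [Finset.mul_sum]
          exact Finset.sum_congr rfl fun k _ => by ring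
      _ = 0 := by rw [hpole, mul_zero]
  have e5 : ∑ k, ∑ j, ∑ i ∈ Finset.range (m + 1),
      c k * (-(μ j * z j ^ (m - i)) * (D k).integral (fun u => u ^ i)) =
      -(∑ j, (μ j : ℂ)) * ∑ k, c k * (D k).integral (fun u => u ^ m) := by
    rw [Finset.sum_comm, neg_mul, Finset.sum_mul, ← Finset.sum_neg_distrib]
    refine Finset.sum_congr rfl fun j _ => ?_
    rw [Finset.sum_comm, Finset.sum_range_succ, Finset.sum_eq_zero, zero_add, Nat.sub_self,
      pow_zero, mul_one, Finset.mul_sum, ← Finset.sum_neg_distrib]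
    · exact Finset.sum_congr rfl fun k _ => by ring
    · intro i hi
      calc _ = -(μ j * z j ^ (m - i)) * ∑ k, c k * (D k).integral (fun u => u ^ i) := by
            rw [Finset.mul_sum]
            exact Finset.sum_congr rfl fun k _ => by ring
        _ = 0 := by rw [ih i (Finset.mem_range.1 hi), mul_zero]
  have e6 : ∑ k, c k * ((m : ℂ) * (D k).integral fun u => u ^ m) +
      ∑ k, c k * (1 * (D k).integral fun u => u ^ m) =
      (m + 1) * ∑ k, c k * (D k).integral (fun u => u ^ m) := by
    rw [Finset.mul_sum, ← Finset.sum_add_distrib]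
    exact Finset.sum_congr rfl fun k _ => by ring
  have e7 : ((m : ℂ) + 1 - ∑ j, (μ j : ℂ)) * ∑ k, c k * (D k).integral (fun u => u ^ m) = 0 := by
    simp only [add_mul, mul_add, Finset.sum_add_distrib] at h0
    rw [e4, e5] at h0
    linear_combination h0 - e6
  -- The moment m = 0 is a hypothesis, so the factor m + 1 - |μ| is only needed for m ≥ 1; this is
  -- why |μ| = 1 is harmless.
  refine (mul_eq_zero.1 e7).resolve_left fun h => hsum (m + 1) (by omega) ?_
  have h2 : ((∑ k, μ k : ℝ) : ℂ) = ((m + 1 : ℕ) : ℝ) := by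
    push_cast
    linear_combination -h
  exact_mod_cast h2

theorem IsArcIntegral.branch {n : ℕ} {μ : Fin (n + 1) → ℝ} {z : Fin (n + 1) → ℂ} {γ ψ : ℝ → ℂ}
    {f : (Fin (n + 1) → ℂ) → ℂ} (h : IsArcIntegral μ z γ ψ f) :
    PiecewiseC1On γ 0 1 ∧ ∃ ℓ : Fin (n + 1) → ℝ → ℂ, (∀ k, ContinuousOn (ℓ k) (Ioo 0 1)) ∧
      (∀ k, ∀ t ∈ Ioo (0 : ℝ) 1, Complex.exp (ℓ k t) = z k - γ t) ∧
      ∀ t ∈ Ioo (0 : ℝ) 1, integrand μ (fun k => ℓ k t) = ψ t := by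
  obtain ⟨N, Γ, ℓ, hN, hΓ, hℓ, hrel, hexp, hγ, hψ, hf⟩ := h
  have hz := mem_of_mem_nhds hN
  refine ⟨?_, fun k t => ℓ k z t, fun k => ?_, fun k t ht => ?_, hψ⟩
  · obtain ⟨s, hs⟩ := (hrel z hz).piecewise
    exact ⟨s, fun c d h1 h2 h3 h4 => (hs c d h1 h2 h3 h4).congr fun t ht =>
      (hγ t (Icc_subset_Icc h1 h3 ht)).symm⟩
  · exact (hℓ k).comp (continuousOn_const.prodMk continuousOn_id) fun t ht => ⟨hz, ht⟩
  · rw [hexp z hz k t ht, hγ t (Ioo_subset_Icc_self ht)]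

/-- Injective piecewise differentiable paths have smooth points with nonzero velocity. -/
theorem PiecewiseC1On.exists_deriv_ne_zero {γ : ℝ → ℂ} (h : PiecewiseC1On γ 0 1)
    (hinj : InjOn γ (Ioo 0 1)) : ∃ t ∈ Ioo (0 : ℝ) 1, ContDiffAt ℝ 1 γ t ∧ deriv γ t ≠ 0 := by
  obtain ⟨s, hs⟩ := h.contDiffAt
  obtain ⟨d, hd0, hd1, hd⟩ := exists_gap_right s (zero_lt_one (α := ℝ))
  by_contra hcon
  push Not at hcon
  have hsm : ∀ t ∈ Ioo 0 d, ContDiffAt ℝ 1 γ t := fun t ht =>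
    hs t ⟨ht.1, ht.2.trans_le hd1⟩ fun hts => hd t hts ht
  have h0 : EqOn (deriv γ) 0 (Ioo 0 d) := fun t ht =>
    hcon t ⟨ht.1, ht.2.trans_le hd1⟩ (hsm t ht)
  have h1 := isOpen_Ioo.is_const_of_deriv_eq_zero isPreconnected_Ioo
    (fun t ht => ((hsm t ht).differentiableAt one_ne_zero).differentiableWithinAt) h0
    (x := d / 3) (y := d / 2) ⟨by positivity, by linarith⟩ ⟨by positivity, by linarith⟩
  have h2 := hinj (show d / 3 ∈ Ioo (0 : ℝ) 1 from ⟨by positivity, by linarith⟩)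
    (show d / 2 ∈ Ioo (0 : ℝ) 1 from ⟨by positivity, by linarith⟩) h1
  linarith

theorem tendsto_integral_of_intervalIntegrable {h : ℝ → ℂ}
    (hh : IntervalIntegrable h MeasureTheory.volume 0 1) :
    Tendsto (fun p : ℝ × ℝ => ∫ t in p.1..p.2, h t) (𝓝[>] 0 ×ˢ 𝓝[<] 1)
      (𝓝 (∫ t in (0 : ℝ)..1, h t)) := by
  have hc : ContinuousOn (fun x => ∫ t in (0 : ℝ)..x, h t) (Icc 0 1) := by
    have := intervalIntegral.continuousOn_primitive_interval (f := h) (a := 0) (b := 1)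
      (by rw [uIcc_of_le zero_le_one]; exact (intervalIntegrable_iff_integrableOn_Icc_of_le zero_le_one).1 hh)
    rwa [uIcc_of_le zero_le_one] at this
  have h0 : Tendsto (fun x => ∫ t in (0 : ℝ)..x, h t) (𝓝[>] 0) (𝓝 0) := by
    have h1 := (hc 0 (left_mem_Icc.2 zero_le_one)).tendsto
    rw [intervalIntegral.integral_same] at h1
    exact h1.mono_left (nhdsWithin_le_of_mem (Icc_mem_nhdsGT one_pos))
  have h1 : Tendsto (fun x => ∫ t in (0 : ℝ)..x, h t) (𝓝[<] 1) (𝓝 (∫ t in (0 : ℝ)..1, h t)) :=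
    (hc 1 (right_mem_Icc.2 zero_le_one)).tendsto.mono_left
      (nhdsWithin_le_of_mem (Icc_mem_nhdsLT one_pos))
  have h2 := (h1.comp tendsto_snd).sub (h0.comp tendsto_fst)
  rw [sub_zero] at h2
  refine h2.congr' ?_
  have m0 : ∀ᶠ s in 𝓝[>] (0 : ℝ), s ∈ Ioo (0 : ℝ) 1 := Ioo_mem_nhdsGT one_pos
  have m1 : ∀ᶠ s in 𝓝[<] (1 : ℝ), s ∈ Ioo (0 : ℝ) 1 := Ioo_mem_nhdsLT one_pos
  filter_upwards [m0.prod_mk m1] with p hp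
  have hsub : ∀ x ∈ Ioo (0 : ℝ) 1, IntervalIntegrable h MeasureTheory.volume 0 x := fun x hx =>
    hh.mono_set (by
      rw [uIcc_of_le hx.1.le, uIcc_of_le zero_le_one]
      exact Icc_subset_Icc le_rfl hx.2.le)
  exact intervalIntegral.integral_interval_sub_left (hsub _ hp.2) (hsub _ hp.1)

/-- The integrand becomes bounded after multiplication by `∏ⱼ (zⱼ - ζ)`. -/
theorem intervalIntegrable_regularized {n : ℕ} {μ : Fin (n + 1) → ℝ}
    (hμ : ∀ k, μ k ∈ Ioo (0 : ℝ) 1) {z : Fin (n + 1) → ℂ} {γ ψ : ℝ → ℂ}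
    (hγ : PiecewiseC1On γ 0 1) {ℓ : Fin (n + 1) → ℝ → ℂ} (hℓ : ∀ k, ContinuousOn (ℓ k) (Ioo 0 1))
    (hexp : ∀ k, ∀ t ∈ Ioo (0 : ℝ) 1, Complex.exp (ℓ k t) = z k - γ t)
    (hψ : ∀ t ∈ Ioo (0 : ℝ) 1, integrand μ (fun k => ℓ k t) = ψ t) :
    ContinuousOn ψ (Ioo 0 1) ∧
    IntervalIntegrable (fun t => ψ t * (∏ j, (z j - γ t)) * deriv γ t) MeasureTheory.volume 0 1 := by
  have hγc := hγ.continuousOn zero_lt_one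
  have hψc : ContinuousOn ψ (Ioo 0 1) := by
    refine ContinuousOn.congr ?_ fun t ht => (hψ t ht).symm
    exact Complex.continuous_exp.comp_continuousOn
      (continuousOn_finsetSum _ fun k _ => continuousOn_const.mul (hℓ k)).neg
  refine ⟨hψc, ?_⟩
  rw [intervalIntegrable_iff_integrableOn_Ioo_of_le zero_le_one]
  have hbound : ContinuousOn (fun t => ∏ j, ‖z j - γ t‖ ^ (1 - μ j)) (Icc 0 1) :=
    continuousOn_finsetProd _ fun j _ => (continuousOn_const.sub hγc).norm.rpow_const
      fun t _ => Or.inr (by linarith [(hμ j).2])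
  obtain ⟨B, hB⟩ := isCompact_Icc.exists_bound_of_continuousOn hbound
  have hint : MeasureTheory.IntegrableOn (deriv γ) (Ioo 0 1) :=
    hγ.integrableOn_deriv.mono_set Ioo_subset_Icc_self
  have hcont : ContinuousOn (fun t => ψ t * ∏ j, (z j - γ t)) (Ioo 0 1) :=
    hψc.mul (continuousOn_finsetProd _ fun j _ =>
      continuousOn_const.sub (hγc.mono Ioo_subset_Icc_self))
  refine hint.bdd_mul (c := B) (hcont.aestronglyMeasurable measurableSet_Ioo) ?_
  rw [MeasureTheory.ae_restrict_iff' measurableSet_Ioo]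
  refine Eventually.of_forall fun t ht => ?_
  refine le_trans (le_of_eq ?_) ((le_abs_self _).trans (hB t (Ioo_subset_Icc_self ht)))
  rw [norm_mul, ← hψ t ht, norm_integrand μ (fun j => hexp j t ht), norm_prod,
    ← Finset.prod_mul_distrib]
  refine Finset.prod_congr rfl fun j _ => ?_
  have hpos : 0 < ‖z j - γ t‖ := norm_pos_iff.2 (hexp j t ht ▸ Complex.exp_ne_zero _)
  rw [sub_eq_neg_add 1 (μ j), Real.rpow_add_one hpos.ne']

/-- A linear relation between arc integrals annihilates all moments of the regularized
integrands. -/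
theorem sum_integral_regularized_eq_zero {n : ℕ} {μ : Fin (n + 1) → ℝ}
    (hμ : ∀ k, μ k ∈ Ioo (0 : ℝ) 1) (hsum : ∀ m : ℕ, 2 ≤ m → ∑ k, μ k ≠ (m : ℝ))
    {z : Fin (n + 1) → ℂ} (hz : Function.Injective z) {ι : Type*} [Fintype ι]
    {γ ψ : ι → ℝ → ℂ} {f : ι → (Fin (n + 1) → ℂ) → ℂ}
    (hf : ∀ k, IsArcIntegral μ z (γ k) (ψ k) (f k)) {c : ι → ℂ}
    (hc : (fun w => ∑ k, c k * f k w) =ᶠ[𝓝 z] 0) (i : ℕ) :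
    ∑ k, ∫ t in (0 : ℝ)..1,
      c k * (ψ k t * (∏ j, (z j - γ k t)) * deriv (γ k) t) * γ k t ^ i = 0 := by
  choose C hC hex hCf hCg using fun k => (hf k).exists_chain hμ hz
  let D : ι × Fin 3 → TwistedPath := fun x => C x.1 x.2
  have hD : ∀ x, (D x).Avoids z := fun x => hC x.1 x.2
  have hflat : ∀ g : ι × Fin 3 → ℂ, ∑ x : ι × Fin 3, c x.1 * g x =
      ∑ k, c k * ∑ m, g (k, m) := fun g => by
    rw [Fintype.sum_prod_type]
    exact Finset.sum_congr rfl fun k _ => by rw [Finset.mul_sum]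
  have hE : (fun w => ∑ x : ι × Fin 3, c x.1 * (D x).integral (transport μ z w)) =ᶠ[𝓝 z]
      fun _ => 0 := by
    filter_upwards [hc, eventually_all.2 hCf] with w h1 h2
    rw [hflat (fun x => (D x).integral (transport μ z w))]
    refine Eq.trans ?_ h1
    exact Finset.sum_congr rfl fun k _ => by rw [h2]
  have h1 : ∑ x : ι × Fin 3, c x.1 * (D x).integral (fun _ => 1) = 0 := by
    refine Eq.trans (Finset.sum_congr rfl fun x _ => ?_) hE.self_of_nhds
    congr 1
    exact TwistedPath.integral_congr fun t ht => (transport_self μ fun j => (hD x).ne j t ht).symm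
  -- The j-th partial derivative of the relation at z is -μⱼ times the integral of 1/(zⱼ - u), and
  -- μⱼ ≠ 0.
  have hpole : ∀ j, ∑ x : ι × Fin 3, c x.1 * (D x).integral (fun u => (z j - u)⁻¹) = 0 := by
    intro j
    have h2 := (pderiv_congr hE j).self_of_nhds
    have h3 : pderiv j (fun w => ∑ x : ι × Fin 3, c x.1 * (D x).integral (transport μ z w)) z =
        ∑ x : ι × Fin 3, c x.1 * pderiv j (fun w => (D x).integral (transport μ z w)) z := by
      rw [pderiv, fderiv_fun_sum fun x _ =>
        ((hD x).integral_transport (μ := μ)).1.differentiableAt.const_mul _, _root_.sum_apply]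
      refine Finset.sum_congr rfl fun x _ => ?_
      rw [fderiv_const_mul ((hD x).integral_transport (μ := μ)).1.differentiableAt]
      rfl
    have h4 : ∀ x, pderiv j (fun w => (D x).integral (transport μ z w)) z =
        -(μ j : ℂ) * (D x).integral (fun u => (z j - u)⁻¹) := by
      intro x
      rw [((hD x).integral_transport (μ := μ)).2.self_of_nhds.2.2.2.1 j,
        ← TwistedPath.integral_const_mul]
      refine TwistedPath.integral_congr fun t ht => ?_
      rw [transport_self μ fun j => (hD x).ne j t ht, one_mul, div_eq_mul_inv]
    have h5 : pderiv j (fun _ : Fin (n + 1) → ℂ => (0 : ℂ)) z = 0 := by simp [pderiv]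
    rw [h3, h5] at h2
    simp only [h4] at h2
    have h6 : -(μ j : ℂ) * ∑ x : ι × Fin 3, c x.1 * (D x).integral (fun u => (z j - u)⁻¹) = 0 := by
      rw [← h2, Finset.mul_sum]
      exact Finset.sum_congr rfl fun x _ => by ring
    refine (mul_eq_zero.1 h6).resolve_left ?_
    rw [neg_eq_zero]
    exact_mod_cast (hμ j).1.ne'
  have hmom := sum_integral_pow_eq_zero hsum hD (c := fun x => c x.1) (fun G hG => by
    rw [hflat (fun x => (D x).integral (fun u => deriv G u + G u * logCoeff μ z u))]
    refine Finset.sum_eq_zero fun k _ => ?_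
    rw [hex k G fun m t _ => hG.analyticAt _, mul_zero]) h1 hpole
  -- The factor ∏ (zⱼ - u) makes the integrand bounded up to the ends, so the regularized integral
  -- of q is an ordinary integral along the arc.
  let q : Polynomial ℂ := (∏ j, (Polynomial.C (z j) - Polynomial.X)) * Polynomial.X ^ i
  have hq : ∀ u, q.eval u = (∏ j, (z j - u)) * u ^ i := fun u => by
    simp [q, Polynomial.eval_prod]
  have hqmom : ∑ x : ι × Fin 3, c x.1 * (D x).integral (fun u => q.eval u) = 0 := by
    have h2 : ∀ x, (D x).integral (fun u => q.eval u) =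
        ∑ d ∈ Finset.range (q.natDegree + 1), q.coeff d * (D x).integral (fun u => u ^ d) := by
      intro x
      simp only [Polynomial.eval_eq_sum_range]
      rw [(hD x).integral_sum _ (f := fun d u => q.coeff d * u ^ d) fun d =>
        continuousOn_const.mul ((hD x).cont.pow d)]
      exact Finset.sum_congr rfl fun d _ => TwistedPath.integral_const_mul _ _ _
    simp only [h2, Finset.mul_sum]
    rw [Finset.sum_comm]
    refine Finset.sum_eq_zero fun d _ => ?_
    calc _ = q.coeff d * ∑ x : ι × Fin 3, c x.1 * (D x).integral (fun u => u ^ d) := by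
          rw [Finset.mul_sum]
          exact Finset.sum_congr rfl fun x _ => by ring
      _ = 0 := by rw [hmom d, mul_zero]
  rw [hflat (fun x => (D x).integral (fun u => q.eval u))] at hqmom
  refine Eq.trans (Finset.sum_congr rfl fun k _ => ?_) hqmom
  obtain ⟨hγ, ℓ, hℓ, hexp, hψ⟩ := (hf k).branch
  have h3 := (intervalIntegrable_regularized hμ hγ hℓ hexp hψ).2
  have h4 : IntervalIntegrable (fun t => ψ k t * q.eval (γ k t) * deriv (γ k) t)
      MeasureTheory.volume 0 1 := by
    have := h3.mul_continuousOn (g := fun t => γ k t ^ i) (by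
      rw [uIcc_of_le zero_le_one]
      exact (hγ.continuousOn zero_lt_one).pow i)
    refine this.congr fun t _ => ?_
    simp only [hq]
    ring
  have h5 : HasArcIntegral (γ k) (fun t => ψ k t * q.eval (γ k t))
      (∫ t in (0 : ℝ)..1, ψ k t * q.eval (γ k t) * deriv (γ k) t) :=
    tendsto_integral_of_intervalIntegrable h4
  have h6 := (hCg k (fun u => q.eval u) q.differentiable).unique h5
  change _ = c k * ∑ m, (C k m).integral _
  rw [h6, ← intervalIntegral.integral_const_mul]
  congr 1
  funext t
  rw [hq]
  ring

/-! ### Linear independence of arc integrals -/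

/-- Arc integrals along disjoint arcs whose union does not separate the plane are linearly
independent. -/
theorem linearIndependent_arcIntegrals {n : ℕ} {μ : Fin (n + 1) → ℝ}
    (hμ : ∀ k, μ k ∈ Ioo (0 : ℝ) 1) (hsum : ∀ m : ℕ, 2 ≤ m → ∑ k, μ k ≠ (m : ℝ))
    {z : Fin (n + 1) → ℂ} (hz : Function.Injective z) {ι : Type*} [Fintype ι]
    {γ ψ : ι → ℝ → ℂ} {f : ι → (Fin (n + 1) → ℂ) → ℂ}
    (hf : ∀ k, IsArcIntegral μ z (γ k) (ψ k) (f k))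
    (hconn : IsPreconnected (⋃ k, γ k '' Icc 0 1)ᶜ)
    (hdisj : ∀ k, ∀ t ∈ Ioo (0 : ℝ) 1, ∀ k', ∀ t' ∈ Icc (0 : ℝ) 1, γ k' t' = γ k t →
      k' = k ∧ t' = t) :
    LinearIndependent ℂ fun k => (f k : Germ (𝓝 z) ℂ) := by
  classical
  rw [Fintype.linearIndependent_iff]
  intro c hc k
  have hc' : (fun w => ∑ k, c k * f k w) =ᶠ[𝓝 z] 0 := by
    have h1 : ((fun w => ∑ k, c k * f k w : (Fin (n + 1) → ℂ) → ℂ) : Germ (𝓝 z) ℂ) =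
        ∑ k, c k • (f k : Germ (𝓝 z) ℂ) := by
      have h2 : (fun w => ∑ k, c k * f k w) = ∑ k, c k • f k := by
        funext w
        simp
      rw [h2]
      exact map_sum (Germ.coeAddHom (𝓝 z)) _ _
    exact Germ.coe_eq.1 (h1.trans hc)
  have hmom := sum_integral_regularized_eq_zero hμ hsum hz hf hc'
  have hγ : ∀ k, PiecewiseC1On (γ k) 0 1 := fun k => (hf k).branch.1
  have hγc : ∀ k, ContinuousOn (γ k) (Icc 0 1) := fun k => (hγ k).continuousOn zero_lt_one
  set σ : ι → ℝ → ℂ := fun k t => c k * (ψ k t * (∏ j, (z j - γ k t)) * deriv (γ k) t) with hσdef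
  have hσ : ∀ k, IntervalIntegrable (σ k) MeasureTheory.volume 0 1 := fun k => by
    obtain ⟨hγ, ℓ, hℓ, hexp, hψ⟩ := (hf k).branch
    exact (intervalIntegrable_regularized hμ hγ hℓ hexp hψ).2.const_mul _
  have hA : IsCompact (⋃ k, γ k '' Icc 0 1) :=
    isCompact_iUnion fun k => isCompact_Icc.image_of_continuousOn (hγc k)
  have hcauchy : ∀ ξ, (∀ k, ∀ t ∈ Icc (0 : ℝ) 1, ξ - γ k t ≠ 0) →
      ∑ k, ∫ t in (0 : ℝ)..1, σ k t * (ξ - γ k t)⁻¹ = 0 := fun ξ hξ =>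
    sum_integral_inv_sub_eq_zero hγc hσ hmom hA hconn
      (fun k t ht => mem_iUnion.2 ⟨k, t, ht, rfl⟩) fun h => by
        obtain ⟨k, t, ht, rfl⟩ := mem_iUnion.1 h
        exact hξ k t ht (sub_self _)
  -- A smooth point with nonzero velocity on the k-th arc, at which the jump of the Cauchy transform
  -- is evaluated.
  obtain ⟨s, hs, hsm, hv⟩ := (hγ k).exists_deriv_ne_zero fun t ht t' ht' h =>
    (hdisj k t' ht' k t (Ioo_subset_Icc_self ht) h).2
  obtain ⟨-, ℓ, hℓ, hexp, hψ⟩ := (hf k).branch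
  have hψc := (intervalIntegrable_regularized hμ (hγ k) hℓ hexp hψ).1
  have hIoo : Ioo (0 : ℝ) 1 ∈ 𝓝 s := Ioo_mem_nhds hs.1 hs.2
  have hσs : ContinuousAt (σ k) s := by
    have h1 : ContinuousAt (deriv (γ k)) s :=
      (hsm.derivWithin (m := 0) (by norm_num)).continuousAt
    have h2 : ContinuousAt (fun t => ∏ j, (z j - γ k t)) s :=
      tendsto_finsetProd _ fun j _ => (continuousAt_const.sub hsm.continuousAt)
    exact continuousAt_const.mul (((hψc.continuousAt hIoo).mul h2).mul h1)
  set v := deriv (γ k) s with hvdef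
  obtain ⟨T, hne⟩ := tendsto_integral_jumpKernel hs (hγc k)
    (fun t ht h => (hdisj k s hs k t ht h).2) (hσ k) hσs
    (hsm.differentiableAt one_ne_zero).hasDerivAt hv
  have hfar : ∀ k', k' ≠ k → ∃ m > 0, ∀ t ∈ Icc (0 : ℝ) 1, m ≤ ‖γ k' t - γ k s‖ := by
    intro k' hk'
    obtain ⟨t₀, ht₀, hmin⟩ := isCompact_Icc.exists_isMinOn (nonempty_Icc.2 zero_le_one)
      ((hγc k').sub continuousOn_const).norm (f := fun t => ‖γ k' t - γ k s‖)
    refine ⟨‖γ k' t₀ - γ k s‖, norm_pos_iff.2 (sub_ne_zero.2 fun h => ?_), fun t ht => hmin ht⟩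
    exact hk' (hdisj k s hs k' t₀ ht₀ h).1
  have hne' : ∀ k', ∀ᶠ ε : ℝ in 𝓝[>] 0, ∀ t ∈ Icc (0 : ℝ) 1,
      γ k s + ε * (Complex.I * v) - γ k' t ≠ 0 ∧ γ k s - ε * (Complex.I * v) - γ k' t ≠ 0 := by
    intro k'
    rcases eq_or_ne k' k with rfl | hk'
    · exact hne
    · obtain ⟨m, hm, hmin⟩ := hfar k' hk'
      have h1 : ∀ᶠ ε : ℝ in 𝓝[>] 0, ε * ‖v‖ ≤ m / 2 := by
        have : Tendsto (fun ε : ℝ => ε * ‖v‖) (𝓝[>] 0) (𝓝 (0 * ‖v‖)) :=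
          (tendsto_id.mul_const _).mono_left nhdsWithin_le_nhds
        rw [zero_mul] at this
        exact this.eventually (ge_mem_nhds (by positivity))
      filter_upwards [h1, self_mem_nhdsWithin] with ε hε hε0 t ht
      have := jumpKernel_far hm (hmin t ht) hε0 hε
      exact ⟨this.1, this.2.1⟩
  -- The point γₖ(s) has positive distance from all other arcs, so only the k-th one contributes to
  -- the limit. For small ε > 0 the kernel is a difference of Cauchy transforms off the arcs, which
  -- vanishes.
  have hT : Tendsto (fun ε : ℝ => ∑ k', ∫ t in (0 : ℝ)..1,
      σ k' t * jumpKernel (γ k s) v ε (γ k' t)) (𝓝[>] 0)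
      (𝓝 (∑ k', if k' = k then -(2 * Real.pi * Complex.I * σ k s / v) else 0)) := by
    refine tendsto_finsetSum _ fun k' _ => ?_
    rcases eq_or_ne k' k with rfl | hk'
    · simpa using T
    · obtain ⟨m, hm, hmin⟩ := hfar k' hk'
      simpa [hk'] using tendsto_integral_jumpKernel_far (v := v) zero_le_one (hσ k') hm hmin
  have hzero : (fun ε : ℝ => ∑ k', ∫ t in (0 : ℝ)..1,
      σ k' t * jumpKernel (γ k s) v ε (γ k' t)) =ᶠ[𝓝[>] 0] fun _ => 0 := by
    filter_upwards [eventually_all.2 hne'] with ε hε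
    have h1 : ∀ k', ∫ t in (0 : ℝ)..1, σ k' t * jumpKernel (γ k s) v ε (γ k' t) =
        (∫ t in (0 : ℝ)..1, σ k' t * (γ k s + ε * (Complex.I * v) - γ k' t)⁻¹) -
        ∫ t in (0 : ℝ)..1, σ k' t * (γ k s - ε * (Complex.I * v) - γ k' t)⁻¹ := by
      intro k'
      rw [← intervalIntegral.integral_sub]
      · congr 1
        funext t
        rw [jumpKernel]
        ring
      · refine (hσ k').mul_continuousOn ?_
        rw [uIcc_of_le zero_le_one]
        exact (continuousOn_const.sub (hγc k')).inv₀ fun t ht => (hε k' t ht).1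
      · refine (hσ k').mul_continuousOn ?_
        rw [uIcc_of_le zero_le_one]
        exact (continuousOn_const.sub (hγc k')).inv₀ fun t ht => (hε k' t ht).2
    simp only [h1, Finset.sum_sub_distrib]
    rw [hcauchy _ fun k t ht => (hε k t ht).1, hcauchy _ fun k t ht => (hε k t ht).2, sub_zero]
  have hlim := tendsto_nhds_unique (hT.congr' hzero) tendsto_const_nhds
  rw [Finset.sum_ite_eq' Finset.univ k, if_pos (Finset.mem_univ k), neg_eq_zero] at hlim
  have hσ0 : σ k s ≠ 0 → False := fun h => by
    have : (2 * Real.pi * Complex.I * σ k s / v : ℂ) ≠ 0 := by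
      refine div_ne_zero (mul_ne_zero ?_ h) hv
      simp [Real.pi_ne_zero]
    exact this hlim
  by_contra hck
  -- Every factor of σₖ(s) other than cₖ is nonzero: the integrand, the product of the zⱼ - γₖ(s),
  -- and the velocity.
  refine hσ0 (mul_ne_zero hck (mul_ne_zero (mul_ne_zero ?_ ?_) hv))
  · rw [← hψ s hs]
    exact integrand_ne_zero _ _
  · exact Finset.prod_ne_zero_iff.2 fun j _ => hexp j s hs ▸ Complex.exp_ne_zero _

/-! ### Convergence of arc integrals and deformation of arcs -/

theorem exists_hasArcIntegral {n : ℕ} {μ : Fin (n + 1) → ℝ} (hμ : ∀ k, μ k ∈ Ioo (0 : ℝ) 1)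
    {w : Fin (n + 1) → ℂ} (hw : Function.Injective w) {γ : ℝ → ℂ} (hγ : IsRelativeArc w γ)
    {ℓ : Fin (n + 1) → ℝ → ℂ} (hℓ : ∀ j, ContinuousOn (ℓ j) (Ioo 0 1))
    (hexp : ∀ j, ∀ t ∈ Ioo (0 : ℝ) 1, Complex.exp (ℓ j t) = w j - γ t) :
    ∃ I, HasArcIntegral γ (fun t => integrand μ (fun j => ℓ j t)) I := by
  obtain ⟨d, hd, hsep⟩ := exists_separation hw
  obtain ⟨a, ha⟩ := hγ.source
  obtain ⟨b, hb⟩ := hγ.target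
  have hγc := hγ.piecewise.continuousOn zero_lt_one
  obtain ⟨t₀, ht₀, ht₀', hγ₀⟩ : ∃ t₀ : ℝ, 0 < t₀ ∧ t₀ ≤ 1 / 4 ∧
      ∀ t ∈ Icc 0 t₀, γ t ∈ Metric.ball (w a) d := by
    obtain ⟨δ, hδ, h⟩ := Metric.continuousWithinAt_iff.1 (hγc 0 (left_mem_Icc.2 zero_le_one)) d hd
    refine ⟨min (δ / 2) (1 / 4), by positivity, min_le_right _ _, fun t ht => ?_⟩
    have h1 := ht.2.trans (min_le_left _ _)
    have h2 := ht.2.trans (min_le_right _ _)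
    have h3 := h (x := t) ⟨ht.1, by linarith⟩ (by
      rw [Real.dist_eq, sub_zero, abs_of_nonneg ht.1]; linarith)
    rwa [← ha] at h3
  obtain ⟨t₁, ht₁, ht₁', hγ₁⟩ : ∃ t₁ : ℝ, t₁ < 1 ∧ 3 / 4 ≤ t₁ ∧
      ∀ t ∈ Icc t₁ 1, γ t ∈ Metric.ball (w b) d := by
    obtain ⟨δ, hδ, h⟩ := Metric.continuousWithinAt_iff.1 (hγc 1 (right_mem_Icc.2 zero_le_one)) d hd
    have hmin : 0 < min (δ / 2) (1 / 4) := by positivity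
    have hml := min_le_left (δ / 2) (1 / 4)
    have hmr := min_le_right (δ / 2) (1 / 4)
    refine ⟨1 - min (δ / 2) (1 / 4), by linarith, by linarith, fun t ht => ?_⟩
    have h3 := h (x := t) ⟨by linarith [ht.1], ht.2⟩ (by
      rw [Real.dist_eq, abs_of_nonpos (by linarith [ht.2])]; linarith [ht.1])
    rwa [← hb] at h3
  have hg : Differentiable ℂ fun _ : ℂ => (1 : ℂ) := differentiable_const _
  obtain ⟨A, hA, hA0, hAg⟩ := exists_end_primitive (μ := μ) a (hμ a).2
    (fun j hj => hsep j a hj) (hg.differentiableOn.analyticOnNhd Metric.isOpen_ball)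
  obtain ⟨B, hB, hB0, hBg⟩ := exists_end_primitive (μ := μ) b (hμ b).2
    (fun j hj => hsep j b hj) (hg.differentiableOn.analyticOnNhd Metric.isOpen_ball)
  have h := hasArcIntegral_of_ends hw (fun k => (hμ k).2) hγ.piecewise hℓ hexp ha.symm hb.symm ht₀
    (by linarith : t₀ ≤ t₁) ht₁ hγ₀ hγ₁ hg hA hA0 hAg hB hB0 hBg
  exact ⟨_, h.congr (fun _ _ => rfl) fun t _ => mul_one _⟩

theorem exists_eval_sub_eq_mul (p : Polynomial ℂ) (a : ℂ) :
    ∃ q : Polynomial ℂ, ∀ u, p.eval a - p.eval u = (a - u) * q.eval u := by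
  obtain ⟨q, hq⟩ := Polynomial.X_sub_C_dvd_sub_C_eval (p := p) (a := a)
  refine ⟨q, fun u => ?_⟩
  have := congrArg (Polynomial.eval u) hq
  simp only [Polynomial.eval_sub, Polynomial.eval_C, Polynomial.eval_mul, Polynomial.eval_X] at this
  linear_combination -this

/-- A relative arc and a determination of the integrand along it can be deformed with the
branch points. -/
theorem exists_isArcIntegral {n : ℕ} {μ : Fin (n + 1) → ℝ} (hμ : ∀ k, μ k ∈ Ioo (0 : ℝ) 1)
    {z : Fin (n + 1) → ℂ} (hz : Function.Injective z) {γ : ℝ → ℂ} (hγ : IsRelativeArc z γ)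
    {ℓ : Fin (n + 1) → ℝ → ℂ} (hℓ : ∀ j, ContinuousOn (ℓ j) (Ioo 0 1))
    (hexp : ∀ j, ∀ t ∈ Ioo (0 : ℝ) 1, Complex.exp (ℓ j t) = z j - γ t) {ψ : ℝ → ℂ}
    (hψ : ∀ t ∈ Ioo (0 : ℝ) 1, ψ t = integrand μ (fun j => ℓ j t)) :
    ∃ f, IsArcIntegral μ z γ ψ f := by
  have hγc := hγ.piecewise.continuousOn zero_lt_one
  -- The Lagrange basis at the nodes zⱼ gives a polynomial map φ w, near the identity on the arc for
  -- w near z, that moves each zⱼ to wⱼ. The image of γ need not be embedded, since relative arcs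
  -- are not required to be.
  let p : Fin (n + 1) → Polynomial ℂ := fun i => Lagrange.basis Finset.univ z i
  have hp1 : ∀ i, (p i).eval (z i) = 1 := fun i =>
    Lagrange.eval_basis_self hz.injOn (Finset.mem_univ i)
  have hp0 : ∀ i j, i ≠ j → (p i).eval (z j) = 0 := fun i j hij =>
    Lagrange.eval_basis_of_ne hij (Finset.mem_univ j)
  choose q hq using fun j i => exists_eval_sub_eq_mul (p i) (z j)
  let φ : (Fin (n + 1) → ℂ) → ℂ → ℂ := fun w u => u + ∑ i, (w i - z i) * (p i).eval u
  -- The quotient (wⱼ - φ w u)/(zⱼ - u), which is a polynomial in u and close to 1 on the arc. Its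
  -- principal logarithm carries the given branch along and remains continuous at the ends.
  let r : Fin (n + 1) → (Fin (n + 1) → ℂ) → ℂ → ℂ := fun j w u =>
    1 + ∑ i, (w i - z i) * (q j i).eval u
  have hφz : ∀ w j, φ w (z j) = w j := by
    intro w j
    simp only [φ]
    rw [Finset.sum_eq_single j (fun i _ hij => by rw [hp0 i j hij, mul_zero])
      (fun h => absurd (Finset.mem_univ j) h), hp1]
    ring
  have hφr : ∀ w j u, w j - φ w u = (z j - u) * r j w u := by
    intro w j u
    rw [← hφz w j]
    simp only [φ, r, mul_add, mul_one, Finset.mul_sum]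
    have h1 : ∀ i, (z j - u) * ((w i - z i) * (q j i).eval u) =
        (w i - z i) * (p i).eval (z j) - (w i - z i) * (p i).eval u := fun i => by
      linear_combination (-(w i - z i)) * hq j i u
    simp only [h1, Finset.sum_sub_distrib]
    ring
  have hqc : ∀ j i, ContinuousOn (fun t => (q j i).eval (γ t)) (Icc 0 1) := fun j i =>
    (q j i).continuous.comp_continuousOn hγc
  choose M hM using fun j i => isCompact_Icc.exists_bound_of_continuousOn (hqc j i)
  have hev : ∀ᶠ w in 𝓝 z, (∀ j, ∑ i, ‖w i - z i‖ * M j i < 1) ∧ Function.Injective w := by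
    refine (eventually_all.2 fun j => ?_).and ?_
    · have h1 : Tendsto (fun w : Fin (n + 1) → ℂ => ∑ i, ‖w i - z i‖ * M j i) (𝓝 z)
          (𝓝 (∑ i, ‖z i - z i‖ * M j i)) := by
        refine Continuous.tendsto ?_ z
        fun_prop
      simp only [sub_self, norm_zero, zero_mul, Finset.sum_const_zero] at h1
      exact h1.eventually (gt_mem_nhds one_pos)
    · have h1 : ∀ᶠ w in 𝓝 z, ∀ i j, i ≠ j → w i ≠ w j :=
        eventually_all.2 fun i => eventually_all.2 fun j => by
          rcases eq_or_ne i j with rfl | hij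
          · exact Eventually.of_forall fun _ h => absurd rfl h
          · have h2 : Tendsto (fun w : Fin (n + 1) → ℂ => w i - w j) (𝓝 z) (𝓝 (z i - z j)) :=
              Continuous.tendsto (by fun_prop) z
            filter_upwards [h2.eventually_ne (sub_ne_zero.2 fun h => hij (hz h))] with w hw _
            exact sub_ne_zero.1 hw
      filter_upwards [h1] with w hw i j hij
      by_contra h
      exact hw i j h hij
  set N := {w : Fin (n + 1) → ℂ | (∀ j, ∑ i, ‖w i - z i‖ * M j i < 1) ∧ Function.Injective w}
  have hr : ∀ w ∈ N, ∀ j, ∀ t ∈ Icc (0 : ℝ) 1, r j w (γ t) ∈ Complex.slitPlane := by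
    intro w hw j t ht
    refine Complex.mem_slitPlane_of_norm_lt_one (lt_of_le_of_lt ?_ (hw.1 j))
    refine (norm_sum_le _ _).trans (Finset.sum_le_sum fun i _ => ?_)
    rw [norm_mul]
    exact mul_le_mul_of_nonneg_left (hM j i t ht) (norm_nonneg _)
  have hγ2 : ContinuousOn (fun x : (Fin (n + 1) → ℂ) × ℝ => γ x.2) (N ×ˢ Icc 0 1) :=
    hγc.comp continuousOn_snd fun x hx => hx.2
  have hpoly : ∀ s : Polynomial ℂ, ContinuousOn (fun x : (Fin (n + 1) → ℂ) × ℝ => s.eval (γ x.2))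
      (N ×ˢ Icc 0 1) := fun s => s.continuous.comp_continuousOn hγ2
  have hexp' : ∀ w ∈ N, ∀ j, ∀ t ∈ Ioo (0 : ℝ) 1,
      Complex.exp (ℓ j t + Complex.log (r j w (γ t))) = w j - φ w (γ t) := by
    intro w hw j t ht
    rw [Complex.exp_add, hexp j t ht,
      Complex.exp_log (Complex.slitPlane_ne_zero (hr w hw j t (Ioo_subset_Icc_self ht))), hφr]
  have hrel : ∀ w ∈ N, IsRelativeArc w (fun t => φ w (γ t)) := by
    intro w hw
    obtain ⟨s, hs⟩ := hγ.piecewise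
    obtain ⟨a, ha⟩ := hγ.source
    obtain ⟨b, hb⟩ := hγ.target
    refine ⟨⟨s, fun c d h1 h2 h3 h4 => ?_⟩, ⟨a, ?_⟩, ⟨b, ?_⟩, fun t ht => ?_⟩
    · have h5 := hs c d h1 h2 h3 h4
      refine h5.add (ContDiffOn.sum fun i _ => contDiffOn_const.mul ?_)
      have h6 : ContDiff ℝ 1 fun u : ℂ => (p i).eval u :=
        (p i).differentiable.contDiff.restrict_scalars ℝ
      exact h6.comp_contDiffOn h5
    · rw [← ha, hφz]
    · rw [← hb, hφz]
    · rintro ⟨j, hj⟩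
      have h5 := hexp' w hw j t ht
      simp only [hj, sub_self] at h5
      exact Complex.exp_ne_zero _ h5
  have hlc : ∀ k, ContinuousOn (fun x : (Fin (n + 1) → ℂ) × ℝ =>
      ℓ k x.2 + Complex.log (r k x.1 (γ x.2))) (N ×ˢ Ioo 0 1) := by
    intro k
    refine ((hℓ k).comp continuousOn_snd fun x hx => hx.2).add (ContinuousOn.clog ?_ fun x hx =>
      hr x.1 hx.1 k x.2 (Ioo_subset_Icc_self hx.2))
    refine ContinuousOn.mono (s := N ×ˢ Icc 0 1) ?_ (prod_mono_right Ioo_subset_Icc_self)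
    exact continuousOn_const.add (continuousOn_finsetSum _ fun i _ =>
      ContinuousOn.mul (by fun_prop) (hpoly _))
  have hint : ∀ w, ∃ I, w ∈ N → HasArcIntegral (fun t => φ w (γ t))
      (fun t => integrand μ (fun k => ℓ k t + Complex.log (r k w (γ t)))) I := by
    intro w
    by_cases hw : w ∈ N
    · obtain ⟨I, hI⟩ := exists_hasArcIntegral (ℓ := fun k t => ℓ k t + Complex.log (r k w (γ t)))
        hμ hw.2 (hrel w hw)
        (fun k => (hlc k).comp (f := fun t => (w, t)) (by fun_prop) fun t ht => ⟨hw, ht⟩)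
        (hexp' w hw)
      exact ⟨I, fun _ => hI⟩
    · exact ⟨0, fun h => absurd h hw⟩
  choose f hf using hint
  refine ⟨f, N, fun w t => φ w (γ t), fun k w t => ℓ k t + Complex.log (r k w (γ t)), hev, ?_, hlc,
    hrel, fun w hw k t ht => hexp' w hw k t ht, fun t _ => ?_, fun t ht => ?_, fun w hw => hf w hw⟩
  · exact hγ2.add (continuousOn_finsetSum _ fun i _ =>
      ContinuousOn.mul (by fun_prop) (hpoly _))
  · simp [φ]
  · rw [hψ t ht]
    simp [r]

/-! ### The logarithms attached to an L-arc system and their limits from the left -/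

/-- Two continuous logarithms of functions with a constant ratio differ by a constant. -/
theorem sub_eq_sub_of_exp_eq {X : Type*} [TopologicalSpace X] {S : Set X} (hS : IsPreconnected S)
    {g₁ g₂ : X → ℂ} (h₁ : ContinuousOn g₁ S) (h₂ : ContinuousOn g₂ S) {a : ℂ}
    (h : ∀ x ∈ S, Complex.exp (g₁ x) = a * Complex.exp (g₂ x)) {x y : X} (hx : x ∈ S) (hy : y ∈ S) :
    g₁ x - g₂ x = g₁ y - g₂ y := by
  have ha : Complex.exp (g₁ y - g₂ y) = a := by
    rw [Complex.exp_sub, h y hy, mul_div_cancel_right₀ _ (Complex.exp_ne_zero _)]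
  have key := Complex.isCoveringMap_exp.eqOn_of_comp_eqOn hS h₁
    (g₂ := fun x => g₂ x + (g₁ y - g₂ y)) (h₂.add continuousOn_const) (fun x hx => by
      refine Subtype.ext ?_
      simp only [Function.comp_apply]
      rw [Complex.exp_add, ha, h x hx, mul_comm]) hy (by ring)
  have := key hx
  rw [this]
  ring

/-- For Re x > 0 a quarter turn in either direction stays off the cut of the principal logarithm.
The two quarter turns add up to the shift πi in the limit from the left. -/
theorem log_I_mul {x : ℂ} (hx : 0 < x.re) :
    Complex.log (Complex.I * x) = Complex.log x + Real.pi / 2 * Complex.I ∧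
    Complex.log (-Complex.I * x) = Complex.log x - Real.pi / 2 * Complex.I := by
  have hx0 : x ≠ 0 := fun h => by simp [h] at hx
  have harg := Complex.abs_arg_lt_pi_div_two_iff.2 (Or.inl hx)
  rw [abs_lt] at harg
  have hpi := Real.pi_pos
  have h1 : Complex.exp (Real.pi / 2 * Complex.I) = Complex.I := by
    rw [Complex.exp_mul_I, ← Complex.ofReal_ofNat, ← Complex.ofReal_div, ← Complex.ofReal_cos,
      ← Complex.ofReal_sin]
    simp
  constructor
  · refine eq_of_exp_eq_of_abs_im_lt ?_ ?_
    · rw [Complex.exp_add, Complex.exp_log hx0, Complex.exp_log (mul_ne_zero Complex.I_ne_zero hx0),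
        h1, mul_comm]
    · have h2 := Complex.neg_pi_lt_arg (Complex.I * x)
      have h3 := Complex.arg_le_pi (Complex.I * x)
      have h4 : (Complex.log x + Real.pi / 2 * Complex.I).im = x.arg + Real.pi / 2 := by
        rw [Complex.add_im, Complex.log_im, ← Complex.ofReal_ofNat, ← Complex.ofReal_div]
        simp
      rw [Complex.sub_im, Complex.log_im, h4, abs_lt]
      constructor <;> linarith
  · refine eq_of_exp_eq_of_abs_im_lt ?_ ?_
    · rw [Complex.exp_sub, Complex.exp_log hx0,
        Complex.exp_log (mul_ne_zero (neg_ne_zero.2 Complex.I_ne_zero) hx0), h1, Complex.div_I]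
      ring
    · have h2 := Complex.neg_pi_lt_arg (-Complex.I * x)
      have h3 := Complex.arg_le_pi (-Complex.I * x)
      have h4 : (Complex.log x - Real.pi / 2 * Complex.I).im = x.arg - Real.pi / 2 := by
        rw [Complex.sub_im, Complex.log_im, ← Complex.ofReal_ofNat, ← Complex.ofReal_div]
        simp
      rw [Complex.sub_im, Complex.log_im, h4, abs_lt]
      constructor <;> linarith

theorem abs_re_div_sub_le {v d : ℂ} {x : ℝ} (hv : v ≠ 0) (h : ‖d - x * v‖ ≤ ‖v‖ * |x| / 4) :
    |(d / v).re - x| ≤ |x| / 4 := by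
  have hv' : 0 < ‖v‖ := norm_pos_iff.2 hv
  have h1 : d / v - x = (d - x * v) / v := by field_simp
  have h2 : ‖d / v - x‖ ≤ |x| / 4 := by
    rw [h1, norm_div, div_le_iff₀ hv']
    linarith
  have h3 := Complex.abs_re_le_norm (d / v - x)
  rw [Complex.sub_re, Complex.ofReal_re] at h3
  exact h3.trans h2

theorem re_div_pos_of_close {v d : ℂ} {x : ℝ} (hv : v ≠ 0) (hx : 0 < x)
    (h : ‖d - x * v‖ ≤ ‖v‖ * |x| / 4) : 0 < (d / v).re := by
  have := abs_le.1 (abs_re_div_sub_le hv h)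
  rw [abs_of_pos hx] at this
  linarith [this.1]

/-- The quotient equals i(d/v) + ε. Its imaginary part is nonzero if x ≠ 0, and if x = 0 then d = 0
and it is the positive number ε. -/
theorem mem_slitPlane_of_close {v d : ℂ} {x ε : ℝ} (hv : v ≠ 0) (hxε : x ≠ 0 ∨ 0 < ε)
    (h : ‖d - x * v‖ ≤ ‖v‖ * |x| / 4) :
    (d - ε * (Complex.I * v)) / (-(Complex.I * v)) ∈ Complex.slitPlane := by
  have h1 : (d - ε * (Complex.I * v)) / (-(Complex.I * v)) = Complex.I * (d / v) + ε := by
    have hI := Complex.I_ne_zero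
    field_simp
    linear_combination (-d) * Complex.I_sq
  rw [h1, Complex.mem_slitPlane_iff]
  rcases eq_or_ne x 0 with rfl | hx
  · have hd : d = 0 := by
      have : ‖d‖ ≤ 0 := by simpa using h
      exact norm_le_zero_iff.1 this
    left
    simpa [hd] using hxε
  · right
    have h2 := abs_re_div_sub_le hv h
    have h3 : 0 < |x| := abs_pos.2 hx
    simp only [Complex.add_im, Complex.mul_im, Complex.I_re, Complex.I_im, zero_mul, one_mul,
      Complex.ofReal_im, add_zero, zero_add]
    intro h4
    rw [h4, zero_sub, abs_neg] at h2
    linarith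

theorem IsLArcSystem.continuousOn {n : ℕ} {z : Fin (n + 1) → ℂ} {δ : ℝ → ℂ}
    (h : IsLArcSystem z δ) : ContinuousOn δ (Ici 0) := by
  intro t ht
  have ht' : (0 : ℝ) ≤ t := ht
  have h1 := (h.piecewise (t + 1)).continuousOn (by linarith) t ⟨ht', by linarith⟩
  refine h1.mono_of_mem_nhdsWithin ?_
  exact mem_nhdsWithin.2 ⟨Iio (t + 1), isOpen_Iio, by simp, fun s hs => ⟨hs.2, hs.1.le⟩⟩

/-- Points off a closed part of an `L`-arc system have positive distance from it. -/
theorem IsLArcSystem.exists_dist {n : ℕ} {z : Fin (n + 1) → ℂ} {δ : ℝ → ℂ}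
    (h : IsLArcSystem z δ) {B : Set ℝ} (hB : IsClosed B) (hB0 : B ⊆ Ici 0) {ζ : ℂ}
    (hζ : ζ ∉ δ '' B) : ∃ m > 0, ∀ t ∈ B, m ≤ ‖δ t - ζ‖ := by
  obtain ⟨T, hT⟩ := eventually_atTop.1 (h.tendsto.eventually_ge_atTop (ζ.re + 1))
  have hK : IsCompact (B ∩ Icc 0 T) := isCompact_Icc.inter_left hB
  obtain ⟨m, hm, hm'⟩ := hK.exists_forall_le' (f := fun t => ‖δ t - ζ‖) (a := 0)
    ((h.continuousOn.mono fun t ht => hB0 ht.1).sub continuousOn_const).norm fun t ht =>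
      norm_pos_iff.2 (sub_ne_zero.2 fun h => hζ ⟨t, ht.1, h⟩)
  refine ⟨min m 1, by positivity, fun t ht => ?_⟩
  rcases le_total t T with htT | htT
  · exact (min_le_left _ _).trans (hm' t ⟨ht, hB0 ht, htT⟩)
  · refine (min_le_right _ _).trans ?_
    have h1 := (Complex.re_le_norm (δ t - ζ))
    rw [Complex.sub_re] at h1
    linarith [hT t htT]

/-- The points of an `L`-arc system `δ` and their logarithms: `F s ζ` is a logarithm of `δ s - ζ`
that depends continuously on `s` and on `ζ`, where `ζ` does not lie on `δ` after the time `s`. -/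
theorem IsLArcSystem.exists_log {n : ℕ} {z : Fin (n + 1) → ℂ} {δ : ℝ → ℂ} (h : IsLArcSystem z δ) :
    ∃ (T R : ℝ) (F : ℝ → ℂ → ℂ), (n : ℝ) ≤ T ∧ (∀ t ≥ 0, R ≤ (δ t).re) ∧
      ContinuousOn (fun x : ℝ × ℂ => F x.1 x.2) {x | x.1 ∈ Icc 0 T ∧ x.2 ∉ δ '' Ici x.1} ∧
      (∀ s ∈ Icc 0 T, ∀ ζ ∉ δ '' Ici s, Complex.exp (F s ζ) = δ s - ζ) ∧
      ∀ s ∈ Icc 0 T, ∀ ζ : ℂ, ζ.re < R → F s ζ = Complex.log (δ s - ζ) := by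
  classical
  obtain ⟨T₀, hT₀⟩ := eventually_atTop.1 h.real
  set T := max T₀ n with hTdef
  have hTn : (n : ℝ) ≤ T := le_max_right _ _
  have hT0 : 0 ≤ T := n.cast_nonneg.trans hTn
  have hreal : ∀ t ≥ T, (δ t).im = 0 := fun t ht => hT₀ t ((le_max_left _ _).trans ht)
  have hc := h.continuousOn
  obtain ⟨R, hR⟩ : ∃ R, ∀ t ≥ 0, R ≤ (δ t).re := by
    obtain ⟨T₁, hT₁⟩ := eventually_atTop.1 (h.tendsto.eventually_ge_atTop 0)
    obtain ⟨B, hB⟩ := (isCompact_Icc (a := 0) (b := T₁)).exists_bound_of_continuousOn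
      (hc.mono fun t ht => ht.1)
    refine ⟨min (-B) 0, fun t ht => ?_⟩
    rcases le_total t T₁ with htT | htT
    · have h1 := (Complex.abs_re_le_norm (δ t)).trans (hB t ⟨ht, htT⟩)
      exact (min_le_left _ _).trans (abs_le.1 h1).1
    · exact (min_le_right _ _).trans (hT₁ t htT)
  -- From time T on, the arc runs on the real axis and, by the intermediate value theorem, covers
  -- the half line to the right of δ(T). So δ(T) - ζ avoids the cut when ζ is off this part.
  have hslit : ∀ ζ ∉ δ '' Ici T, δ T - ζ ∈ Complex.slitPlane := by
    intro ζ hζ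
    rw [Complex.mem_slitPlane_iff]
    by_contra hcon
    push Not at hcon
    obtain ⟨h1, h2⟩ := hcon
    rw [Complex.sub_re] at h1
    rw [Complex.sub_im, hreal T le_rfl, zero_sub, neg_eq_zero] at h2
    obtain ⟨T₁, hT₁, hT₁'⟩ := ((h.tendsto.eventually_ge_atTop ζ.re).and
      (eventually_ge_atTop T)).exists
    have hcre : ContinuousOn (fun t => (δ t).re) (Icc T T₁) :=
      Complex.continuous_re.comp_continuousOn (hc.mono fun t ht => hT0.trans ht.1)
    obtain ⟨t, ht, hteq⟩ := intermediate_value_Icc hT₁' hcre ⟨by linarith, hT₁⟩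
    exact hζ ⟨t, ht.1, Complex.ext hteq (by rw [hreal t ht.1, h2])⟩
  -- On S the path from δ(T) - ζ back along the arc to δ(s) - ζ avoids 0. It is lifted through the
  -- exponential, starting at the principal logarithm; homotopy lifting gives joint continuity in
  -- (s, ζ).
  let S : Set (ℝ × ℂ) := {x | x.1 ∈ Icc 0 T ∧ x.2 ∉ δ '' Ici x.1}
  have hmem : ∀ (σ : unitInterval) (x : S), T + σ * (x.1.1 - T) ∈ Icc x.1.1 T := by
    intro σ x
    have h1 := σ.2.1
    have h2 := σ.2.2
    have h3 := x.2.1.2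
    constructor <;> nlinarith
  have hne : ∀ (σ : unitInterval) (x : S), δ (T + σ * (x.1.1 - T)) - x.1.2 ≠ 0 := fun σ x h0 =>
    x.2.2 ⟨_, (hmem σ x).1, sub_eq_zero.1 h0⟩
  have hHc : Continuous fun y : unitInterval × S => δ (T + y.1 * (y.2.1.1 - T)) - y.2.1.2 := by
    refine Continuous.sub ?_ (by fun_prop)
    exact hc.comp_continuous (by fun_prop) fun y => y.2.2.1.1.trans (hmem y.1 y.2).1
  let H : C(unitInterval × S, {w : ℂ // w ≠ 0}) :=
    ⟨fun y => ⟨_, hne y.1 y.2⟩, hHc.subtype_mk _⟩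
  have hTS : ∀ x : S, x.1.2 ∉ δ '' Ici T := fun x hx => x.2.2 (image_mono (Ici_subset_Ici.2 x.2.1.2) hx)
  let f : C(S, ℂ) := ⟨fun x => Complex.log (δ T - x.1.2),
    Continuous.clog (by fun_prop) fun x => hslit _ (hTS x)⟩
  have hH0 : ∀ x, H (0, x) = ⟨Complex.exp (f x), Complex.exp_ne_zero _⟩ := by
    intro x
    refine Subtype.ext ?_
    change δ (T + (0 : ℝ) * (x.1.1 - T)) - x.1.2 = Complex.exp (Complex.log (δ T - x.1.2))
    rw [Complex.exp_log (Complex.slitPlane_ne_zero (hslit _ (hTS x))), zero_mul, add_zero]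
  let L := Complex.isCoveringMap_exp.liftHomotopy H f hH0
  have hL : ∀ σ x, Complex.exp (L (σ, x)) = δ (T + σ * (x.1.1 - T)) - x.1.2 := fun σ x =>
    congrArg Subtype.val (congrFun (Complex.isCoveringMap_exp.liftHomotopy_lifts H f hH0) (σ, x))
  have hL0 : ∀ x, L (0, x) = f x := Complex.isCoveringMap_exp.liftHomotopy_zero H f hH0
  -- The end value of the lift. Outside S the value is arbitrary and plays no role.
  let F : ℝ → ℂ → ℂ := fun s ζ => if hx : (s, ζ) ∈ S then L (1, ⟨(s, ζ), hx⟩) else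
    Complex.log (δ s - ζ)
  have hFL : ∀ x : S, F x.1.1 x.1.2 = L (1, x) := fun x => dif_pos x.2
  have hFc : ContinuousOn (fun x : ℝ × ℂ => F x.1 x.2) S := by
    rw [continuousOn_iff_continuous_domRestrict]
    have h1 : Continuous fun x : S => L (1, x) := by fun_prop
    exact h1.congr fun x => (hFL x).symm
  have hFe : ∀ s ∈ Icc 0 T, ∀ ζ ∉ δ '' Ici s, Complex.exp (F s ζ) = δ s - ζ := by
    intro s hs ζ hζ
    rw [hFL ⟨(s, ζ), hs, hζ⟩, hL]
    simp
  refine ⟨T, R, F, hTn, hR, hFc, hFe, fun s hs ζ hζ => ?_⟩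
  have hoff : ∀ t ≥ 0, ζ ∉ δ '' Ici t := by
    rintro t ht ⟨t', ht', rfl⟩
    exact absurd (hR t' (ht.trans ht')) (not_le.2 hζ)
  -- For ζ to the left of the whole arc, every δ(t) - ζ has positive real part, so the lift is the
  -- principal logarithm all the way from T to s.
  have hre : ∀ t ≥ 0, δ t - ζ ∈ Complex.slitPlane := fun t ht => by
    rw [Complex.mem_slitPlane_iff, Complex.sub_re]
    exact Or.inl (by linarith [hR t ht])
  have hTval : F T ζ = Complex.log (δ T - ζ) := by
    have h1 : (T, ζ) ∈ S := ⟨⟨hT0, le_rfl⟩, hoff T hT0⟩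
    have h0 : L (0, ⟨(T, ζ), h1⟩) = Complex.log (δ T - ζ) := hL0 ⟨(T, ζ), h1⟩
    rw [hFL ⟨(T, ζ), h1⟩, ← h0]
    have h2 : Continuous fun σ : unitInterval => L (σ, ⟨(T, ζ), h1⟩) := by fun_prop
    have h3 := sub_eq_sub_of_exp_eq (isPreconnected_univ (α := unitInterval)) h2.continuousOn
      (continuousOn_const (c := Complex.log (δ T - ζ))) (a := 1) (fun σ _ => by
        rw [hL, one_mul, Complex.exp_log (Complex.slitPlane_ne_zero (hre T hT0))]
        simp) (mem_univ 1) (mem_univ 0)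
    linear_combination h3
  have h1 := sub_eq_sub_of_exp_eq (isPreconnected_Icc (a := 0) (b := T))
    (g₁ := fun s => F s ζ) (g₂ := fun s => Complex.log (δ s - ζ))
    (hFc.comp (f := fun s : ℝ => (s, ζ)) (by fun_prop) fun s hs => ⟨hs, hoff s hs.1⟩)
    (ContinuousOn.clog ((hc.mono fun t ht => ht.1).sub continuousOn_const) fun t ht => hre t ht.1)
    (a := 1) (fun t ht => by
      rw [one_mul, hFe t ht ζ (hoff t ht.1),
        Complex.exp_log (Complex.slitPlane_ne_zero (hre t ht.1))]) hs ⟨hT0, le_rfl⟩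
  simp only [hTval, sub_self] at h1
  exact sub_eq_zero.1 h1

/-- The limit from the left of the logarithm of `δ j - ζ` at a point that `δ` passes after the
time `j`. -/
theorem IsLArcSystem.tendsto_log_left {n : ℕ} {z : Fin (n + 1) → ℂ} {δ : ℝ → ℂ}
    (h : IsLArcSystem z δ) {T : ℝ} {F : ℝ → ℂ → ℂ}
    (hFc : ContinuousOn (fun x : ℝ × ℂ => F x.1 x.2) {x | x.1 ∈ Icc 0 T ∧ x.2 ∉ δ '' Ici x.1})
    (hFe : ∀ s ∈ Icc 0 T, ∀ ζ ∉ δ '' Ici s, Complex.exp (F s ζ) = δ s - ζ)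
    {j s₀ : ℝ} (hj : 0 ≤ j) (hjs : j < s₀) (hsT : s₀ < T) (hsm : ContDiffAt ℝ 1 δ s₀)
    (hv : deriv δ s₀ ≠ 0) :
    Tendsto (fun ε : ℝ => F j (δ s₀ + ε * (Complex.I * deriv δ s₀))) (𝓝[>] 0)
      (𝓝 (F s₀ (δ j) - Real.pi * Complex.I)) := by
  set v := deriv δ s₀ with hvdef
  set p := δ s₀ with hp
  have hv' : 0 < ‖v‖ := norm_pos_iff.2 hv
  have hc := h.continuousOn
  have hstrict : HasStrictDerivAt δ v s₀ := hsm.hasStrictDerivAt one_ne_zero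
  -- Strict differentiability is used, because chords between two arbitrary points near s₀, not only
  -- chords from s₀, must be compared with v.
  obtain ⟨η, hη, hjη, hηT, hclose⟩ : ∃ η > 0, j < s₀ - η ∧ s₀ + η < T ∧
      ∀ s ∈ Icc (s₀ - η) (s₀ + η), ∀ s' ∈ Icc (s₀ - η) (s₀ + η),
        ‖δ s - δ s' - (s - s' : ℝ) * v‖ ≤ ‖v‖ * |s - s'| / 4 := by
    have h1 := hstrict.hasStrictFDerivAt.isLittleO.bound (c := ‖v‖ / 4) (by positivity)
    obtain ⟨r, hr, hball⟩ := Metric.eventually_nhds_iff_ball.1 h1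
    obtain ⟨η, hη, hηr⟩ := exists_between (show 0 < min r (min (s₀ - j) (T - s₀)) by
      refine lt_min hr (lt_min ?_ ?_) <;> linarith)
    have hr1 := hηr.trans_le (min_le_left _ _)
    have hr2 := hηr.trans_le ((min_le_right _ _).trans (min_le_left _ _))
    have hr3 := hηr.trans_le ((min_le_right _ _).trans (min_le_right _ _))
    refine ⟨η, hη, by linarith, by linarith, fun s hs s' hs' => ?_⟩
    have hm : ∀ s ∈ Icc (s₀ - η) (s₀ + η), dist s s₀ < r := fun s hs => by
      rw [Real.dist_eq, abs_lt]
      constructor <;> linarith [hs.1, hs.2]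
    have h2 := hball (s, s') (by
      rw [Metric.mem_ball, Prod.dist_eq]
      exact max_lt (hm s hs) (hm s' hs'))
    rw [ContinuousLinearMap.toSpanSingleton_apply, Complex.real_smul, Real.norm_eq_abs] at h2
    linarith
  have hm₀ : s₀ ∈ Icc (s₀ - η) (s₀ + η) := ⟨by linarith, by linarith⟩
  have hml : s₀ - η ∈ Icc (s₀ - η) (s₀ + η) := ⟨le_rfl, by linarith⟩
  have hmr : s₀ + η ∈ Icc (s₀ - η) (s₀ + η) := ⟨by linarith, le_rfl⟩
  have hclose₀ : ∀ s ∈ Icc (s₀ - η) (s₀ + η), ‖δ s - p - (s - s₀ : ℝ) * v‖ ≤ ‖v‖ * |s - s₀| / 4 :=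
    fun s hs => hclose s hs s₀ hm₀
  have hpos : ∀ s ∈ Icc (s₀ - η) (s₀ + η), 0 ≤ s := fun s hs => by linarith [hs.1]
  have hnot : ∀ {s s' : ℝ}, 0 ≤ s' → s' < s → δ s' ∉ δ '' Ici s := by
    rintro s s' hs' hss' ⟨t, ht, hts⟩
    have ht' : s ≤ t := ht
    have := h.injOn (show t ∈ Ici (0 : ℝ) from hs'.trans (hss'.le.trans ht')) hs' hts
    linarith
  obtain ⟨m, hm, hfar⟩ := h.exists_dist (B := Ici 0 \ Ioo (s₀ - η) (s₀ + η))
    (isClosed_Ici.sdiff isOpen_Ioo) sdiff_subset (ζ := p) (by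
      rintro ⟨t, ht, htp⟩
      have := h.injOn ht.1 (hpos s₀ hm₀) htp
      exact ht.2 ⟨by linarith, by linarith⟩)
  have hεm : ∀ᶠ ε : ℝ in 𝓝[>] 0, ε * ‖v‖ ≤ m / 2 := by
    have : Tendsto (fun ε : ℝ => ε * ‖v‖) (𝓝[>] 0) (𝓝 (0 * ‖v‖)) :=
      (tendsto_id.mul_const _).mono_left nhdsWithin_le_nhds
    rw [zero_mul] at this
    exact this.eventually (ge_mem_nhds (by positivity))
  have hoff : ∀ᶠ ε : ℝ in 𝓝[>] 0, ∀ s ≥ 0, p + ε * (Complex.I * v) ∉ δ '' Ici s := by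
    filter_upwards [hεm, self_mem_nhdsWithin] with ε hε hε0 s hs
    rintro ⟨t, ht, hte⟩
    have ht' : s ≤ t := ht
    by_cases htη : t ∈ Ioo (s₀ - η) (s₀ + η)
    · exact (ne_zero_of_close hv hε0 (hclose₀ t (Ioo_subset_Icc_self htη))).1
        (sub_eq_zero.2 hte.symm)
    · exact (jumpKernel_far hm (hfar t ⟨hs.le.trans ht', htη⟩) hε0 hε).1 (sub_eq_zero.2 hte.symm)
  -- the logarithm near the diagonal
  set xp := (δ (s₀ + η) - p) / v with hxp
  set xm := (p - δ (s₀ - η)) / v with hxm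
  have hxp0 : 0 < xp.re := re_div_pos_of_close hv hη (by
    have := hclose₀ _ hmr
    rwa [add_sub_cancel_left] at this)
  have hxm0 : 0 < xm.re := re_div_pos_of_close hv hη (by
    have := hclose _ hm₀ _ hml
    rwa [sub_sub_cancel] at this)
  -- On the convex triangle s' < s near s₀, both F s (δ s') and the principal logarithm of (δ s - δ
  -- s')/v are continuous, so they differ by a constant. It is evaluated at the corners (s₀ + η, s₀)
  -- and (s₀, s₀ - η).
  have E1 : F (s₀ + η) p - Complex.log xp = F s₀ (δ (s₀ - η)) - Complex.log xm := by
    set D : Set (ℝ × ℝ) := {x | s₀ - η ≤ x.2 ∧ x.2 < x.1 ∧ x.1 ≤ s₀ + η} with hD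
    have hDc : Convex ℝ D := by
      intro x hx y hy a b ha hb hab
      obtain ⟨x1, x2, x3⟩ := hx
      obtain ⟨y1, y2, y3⟩ := hy
      have hb' : b = 1 - a := by linarith
      subst hb'
      refine ⟨?_, ?_, ?_⟩ <;>
        simp only [Prod.snd_add, Prod.fst_add, Prod.smul_snd, Prod.smul_fst, smul_eq_mul]
      · nlinarith
      · rcases ha.eq_or_lt with rfl | ha'
        · linarith
        · nlinarith
      · nlinarith
    have hD1 : ∀ x ∈ D, x.1 ∈ Icc (s₀ - η) (s₀ + η) ∧ x.2 ∈ Icc (s₀ - η) (s₀ + η) ∧ x.2 < x.1 :=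
      fun x hx => ⟨⟨hx.1.trans hx.2.1.le, hx.2.2⟩, ⟨hx.1, hx.2.1.le.trans hx.2.2⟩, hx.2.1⟩
    have hDδ1 : ContinuousOn (fun x : ℝ × ℝ => δ x.1) D :=
      hc.comp continuousOn_fst fun x hx => hpos _ (hD1 x hx).1
    have hDδ2 : ContinuousOn (fun x : ℝ × ℝ => δ x.2) D :=
      hc.comp continuousOn_snd fun x hx => hpos _ (hD1 x hx).2.1
    have hDre : ∀ x ∈ D, 0 < ((δ x.1 - δ x.2) / v).re := fun x hx =>
      re_div_pos_of_close hv (sub_pos.2 (hD1 x hx).2.2) (hclose _ (hD1 x hx).1 _ (hD1 x hx).2.1)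
    refine sub_eq_sub_of_exp_eq hDc.isPreconnected (a := v)
      (g₁ := fun x : ℝ × ℝ => F x.1 (δ x.2)) (g₂ := fun x => Complex.log ((δ x.1 - δ x.2) / v))
      (hFc.comp (continuousOn_fst.prodMk hDδ2) fun x hx => ⟨⟨hpos _ (hD1 x hx).1,
        by linarith [hx.2.2]⟩, hnot (hpos _ (hD1 x hx).2.1) hx.2.1⟩)
      (((hDδ1.sub hDδ2).div_const v).clog fun x hx => Or.inl (hDre x hx)) (fun x hx => ?_)
      (x := (s₀ + η, s₀)) (y := (s₀, s₀ - η)) ⟨by show s₀ - η ≤ s₀; linarith,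
        by show s₀ < s₀ + η; linarith, le_rfl⟩
      ⟨le_rfl, by simp [hη], by simp [hη.le]⟩
    rw [hFe _ ⟨hpos _ (hD1 x hx).1, by linarith [hx.2.2]⟩ _ (hnot (hpos _ (hD1 x hx).2.1) hx.2.1),
      Complex.exp_log (Complex.slitPlane_ne_zero (Or.inl (hDre x hx)))]
    field_simp
  set ζ : ℝ → ℂ := fun ε => p + ε * (Complex.I * v) with hζ
  set lg : ℝ → ℝ → ℂ := fun s ε =>
    Complex.log ((δ s - p - ε * (Complex.I * v)) / (-(Complex.I * v))) with hlg
  have hIv : -(Complex.I * v) ≠ 0 := neg_ne_zero.2 (mul_ne_zero Complex.I_ne_zero hv)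
  -- For fixed ε the time s crosses s₀. Because the point lies on the left, (δ(s) - ζ)/(-iv) passes
  -- the real axis on the positive side and its principal logarithm is continuous.
  have E2 : ∀ᶠ ε : ℝ in 𝓝[>] 0,
      F (s₀ - η) (ζ ε) - lg (s₀ - η) ε = F (s₀ + η) (ζ ε) - lg (s₀ + η) ε := by
    filter_upwards [hoff, self_mem_nhdsWithin] with ε hε hε0
    have hsl : ∀ s ∈ Icc (s₀ - η) (s₀ + η),
        (δ s - p - ε * (Complex.I * v)) / (-(Complex.I * v)) ∈ Complex.slitPlane := fun s hs =>
      mem_slitPlane_of_close hv (Or.inr hε0) (hclose₀ s hs)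
    refine sub_eq_sub_of_exp_eq (isPreconnected_Icc (a := s₀ - η) (b := s₀ + η))
      (g₁ := fun s => F s (ζ ε)) (g₂ := fun s => lg s ε) (a := -(Complex.I * v))
      (hFc.comp (f := fun s : ℝ => (s, ζ ε)) (by fun_prop) fun s hs =>
        ⟨⟨hpos s hs, by linarith [hs.2]⟩, hε s (hpos s hs)⟩)
      (ContinuousOn.clog ((((hc.mono hpos).sub continuousOn_const).sub
        continuousOn_const).div_const _) hsl) (fun s hs => ?_) hml hmr
    rw [hFe s ⟨hpos s hs, by linarith [hs.2]⟩ _ (hε s (hpos s hs)), hlg,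
      Complex.exp_log (Complex.slitPlane_ne_zero (hsl s hs)), mul_div_cancel₀ _ hIv]
    ring
  have hsub : Icc j (s₀ - η) ⊆ Ici 0 \ Ioo (s₀ - η) (s₀ + η) := fun s hs =>
    ⟨hj.trans hs.1, fun h => by linarith [hs.2, h.1]⟩
  set lf : ℝ → ℝ → ℂ := fun s ε =>
    Complex.log (1 + -(ε * (Complex.I * v) / (δ s - p))) with hlf
  -- From j to s₀ - η the logarithm of δ(s) - ζ is compared with that of p - δ(s): the ratio is -1
  -- up to a factor tending to 1, whose logarithm is `lf`.
  have E3 : ∀ᶠ ε : ℝ in 𝓝[>] 0, F j (ζ ε) - (F s₀ (δ j) + lf j ε) =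
      F (s₀ - η) (ζ ε) - (F s₀ (δ (s₀ - η)) + lf (s₀ - η) ε) := by
    filter_upwards [hoff, hεm, self_mem_nhdsWithin] with ε hε hε1 hε0
    have hε0' : 0 < ε := hε0
    have hne : ∀ s ∈ Icc j (s₀ - η), δ s - p ≠ 0 := fun s hs =>
      norm_pos_iff.1 (hm.trans_le (hfar s (hsub hs)))
    have hsl : ∀ s ∈ Icc j (s₀ - η),
        1 + -(ε * (Complex.I * v) / (δ s - p)) ∈ Complex.slitPlane := fun s hs => by
      refine Complex.mem_slitPlane_of_norm_lt_one ?_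
      have h1 := hfar s (hsub hs)
      rw [norm_neg, norm_div, norm_mul, norm_mul, Complex.norm_I, one_mul, Complex.norm_real,
        Real.norm_of_nonneg hε0'.le, div_lt_one (hm.trans_le h1)]
      linarith
    have hcj : ContinuousOn δ (Icc j (s₀ - η)) := hc.mono fun s hs => hj.trans hs.1
    have hT : ∀ s ∈ Icc j (s₀ - η), s ∈ Icc 0 T := fun s hs =>
      ⟨hj.trans hs.1, by linarith [hs.2]⟩
    have hs₀T : s₀ ∈ Icc 0 T := ⟨by linarith, hsT.le⟩
    have hlt : ∀ s ∈ Icc j (s₀ - η), δ s ∉ δ '' Ici s₀ := fun s hs =>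
      hnot (hj.trans hs.1) (by linarith [hs.2])
    refine sub_eq_sub_of_exp_eq (isPreconnected_Icc (a := j) (b := s₀ - η))
      (g₁ := fun s => F s (ζ ε)) (g₂ := fun s => F s₀ (δ s) + lf s ε) (a := -1)
      (hFc.comp (f := fun s : ℝ => (s, ζ ε)) (by fun_prop) fun s hs => ⟨hT s hs, hε s (hT s hs).1⟩)
      (ContinuousOn.add (hFc.comp (f := fun s : ℝ => (s₀, δ s)) (continuousOn_const.prodMk hcj)
        fun s hs => ⟨hs₀T, hlt s hs⟩) (ContinuousOn.clog (continuousOn_const.add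
          (continuousOn_const.div (hcj.sub continuousOn_const) hne).neg) hsl)) (fun s hs => ?_)
      ⟨le_rfl, hjη.le⟩ ⟨hjη.le, le_rfl⟩
    rw [hFe s (hT s hs) _ (hε s (hT s hs).1), Complex.exp_add, hFe s₀ hs₀T _ (hlt s hs), hlf,
      Complex.exp_log (Complex.slitPlane_ne_zero (hsl s hs)), ← hp]
    have := hne s hs
    field_simp
    ring
  -- passage to the limit
  have hζ0 : Tendsto ζ (𝓝[>] 0) (𝓝 p) := by
    have h1 : Continuous ζ := by fun_prop
    have h2 := h1.tendsto 0
    simp only [hζ, Complex.ofReal_zero, zero_mul, add_zero] at h2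
    exact h2.mono_left nhdsWithin_le_nhds
  have hT1 : Tendsto (fun ε => F (s₀ + η) (ζ ε)) (𝓝[>] 0) (𝓝 (F (s₀ + η) p)) := by
    have hmem : ((s₀ + η, p) : ℝ × ℂ) ∈ {x : ℝ × ℂ | x.1 ∈ Icc 0 T ∧ x.2 ∉ δ '' Ici x.1} :=
      ⟨⟨hpos _ hmr, hηT.le⟩, hnot (hpos _ hm₀) (by linarith)⟩
    refine (hFc _ hmem).tendsto.comp (tendsto_nhdsWithin_iff.2
      ⟨tendsto_const_nhds.prodMk_nhds hζ0, ?_⟩)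
    filter_upwards [hoff] with ε hε
    exact ⟨⟨hpos _ hmr, hηT.le⟩, hε _ (hpos _ hmr)⟩
  have hTf : ∀ s, Tendsto (lf s) (𝓝[>] 0) (𝓝 0) := by
    intro s
    have h1 : ContinuousAt (lf s) 0 := by
      refine ContinuousAt.clog (by fun_prop) ?_
      simp
    have h2 := h1.tendsto
    simp only [hlf, Complex.ofReal_zero, zero_mul, zero_div, neg_zero, add_zero,
      Complex.log_one] at h2
    exact h2.mono_left nhdsWithin_le_nhds
  have hTg : ∀ s ∈ Icc (s₀ - η) (s₀ + η), s ≠ s₀ → Tendsto (lg s) (𝓝[>] 0)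
      (𝓝 (Complex.log ((δ s - p) / (-(Complex.I * v))))) := by
    intro s hs hss
    have h1 : ContinuousAt (lg s) 0 := by
      refine ContinuousAt.clog (by fun_prop) ?_
      exact mem_slitPlane_of_close hv (Or.inl (sub_ne_zero.2 hss)) (hclose₀ s hs)
    have h2 := h1.tendsto
    simp only [hlg, Complex.ofReal_zero, zero_mul, sub_zero] at h2
    exact h2.mono_left nhdsWithin_le_nhds
  have hlim := ((hT1.sub (hTg _ hmr (by linarith))).add (hTg _ hml (by linarith))).sub
    ((tendsto_const_nhds (x := F s₀ (δ (s₀ - η)))).add (hTf (s₀ - η)))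
  have hlim' := hlim.add ((tendsto_const_nhds (x := F s₀ (δ j))).add (hTf j))
  have e1 : (δ (s₀ + η) - p) / (-(Complex.I * v)) = Complex.I * xp := by
    rw [hxp]
    have hI := Complex.I_ne_zero
    field_simp
    linear_combination (-(δ (s₀ + η) - p)) * Complex.I_sq
  have e2 : (δ (s₀ - η) - p) / (-(Complex.I * v)) = -Complex.I * xm := by
    rw [hxm]
    have hI := Complex.I_ne_zero
    field_simp
    linear_combination (p - δ (s₀ - η)) * Complex.I_sq
  rw [e1, e2, (log_I_mul hxp0).1, (log_I_mul hxm0).2, add_zero, add_zero] at hlim'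
  -- The logarithms of the two chords cancel by `E1`, and the two quarter turns leave -πi.
  have e3 : F (s₀ + η) p - (Complex.log xp + Real.pi / 2 * Complex.I) +
      (Complex.log xm - Real.pi / 2 * Complex.I) - F s₀ (δ (s₀ - η)) + F s₀ (δ j) =
      F s₀ (δ j) - Real.pi * Complex.I := by
    linear_combination E1
  rw [e3] at hlim'
  refine hlim'.congr' ?_
  filter_upwards [E2, E3] with ε h2 h3
  linear_combination -h3 - h2

theorem continuous_integrand {n : ℕ} (μ : Fin (n + 1) → ℝ) : Continuous (integrand μ) := by
  unfold integrand
  fun_prop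

/-! ### The pieces of an arc and their determinations -/

theorem PiecewiseC1On.piece {n : ℕ} {δ : ℝ → ℂ} (h : PiecewiseC1On δ 0 n) {k : ℕ} (hk : k < n) :
    PiecewiseC1On (piece δ k) 0 1 := by
  classical
  obtain ⟨s, hs⟩ := h
  have hk' : (k : ℝ) + 1 ≤ n := by exact_mod_cast hk
  have hk0 : (0 : ℝ) ≤ k := k.cast_nonneg
  refine ⟨s.image fun x => x - k, fun c d hc hcd hd hno => ?_⟩
  have h1 := hs (k + c) (k + d) (by linarith) (by linarith) (by linarith) fun x hx hxm =>
    hno (x - k) (Finset.mem_image_of_mem _ hx) ⟨by linarith [hxm.1], by linarith [hxm.2]⟩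
  exact h1.comp (f := fun t : ℝ => (k : ℝ) + t) (by fun_prop) fun t ht =>
    ⟨by linarith [ht.1], by linarith [ht.2]⟩

/-- The pieces of an embedded arc that passes through the points `zₖ` at integer times are relative
arcs. -/
theorem isRelativeArc_piece {n : ℕ} {z : Fin (n + 1) → ℂ} {δ : ℝ → ℂ}
    (hp : PiecewiseC1On δ 0 n) (hinj : InjOn δ (Icc 0 n)) {σ : Equiv.Perm (Fin (n + 1))}
    (hδ : ∀ k : Fin (n + 1), δ ((k : ℕ) : ℝ) = z (σ k)) (k : Fin n) :
    IsRelativeArc z (piece δ k) := by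
  have hk' : ((k : ℕ) : ℝ) + 1 ≤ n := by exact_mod_cast k.2
  have hk0 : (0 : ℝ) ≤ (k : ℕ) := Nat.cast_nonneg _
  refine ⟨hp.piece k.2, ⟨σ k.castSucc, ?_⟩, ⟨σ k.succ, ?_⟩, ?_⟩
  · rw [← hδ]
    simp [piece]
  · rw [← hδ]
    simp [piece]
  · rintro t ht ⟨i, hi⟩
    obtain ⟨j, rfl⟩ := σ.surjective i
    have hj : ((j : ℕ) : ℝ) ≤ n := by exact_mod_cast Nat.lt_succ_iff.1 j.2
    rw [← hδ] at hi
    have h1 := hinj ⟨Nat.cast_nonneg _, hj⟩ ⟨by linarith [ht.1], by linarith [ht.2]⟩ hi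
    have h2 : (k : ℕ) < (j : ℕ) := by
      have : ((k : ℕ) : ℝ) < (j : ℕ) := by linarith [ht.1]
      exact_mod_cast this
    have h3 : (j : ℕ) < (k : ℕ) + 1 := by
      have : ((j : ℕ) : ℝ) < (k : ℕ) + 1 := by linarith [ht.2]
      exact_mod_cast this
    omega

/-- The integrals along the pieces of an embedded arc through the points `zₖ` are independent. -/
theorem linearIndependent_pieces {n : ℕ} (hn : 0 < n) {μ : Fin (n + 1) → ℝ}
    (hμ : ∀ k, μ k ∈ Ioo (0 : ℝ) 1)
    (hsum : ∀ m : ℕ, 2 ≤ m → ∑ k, μ k ≠ (m : ℝ)) {z : Fin (n + 1) → ℂ}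
    (hz : Function.Injective z) {δ : ℝ → ℂ} (hp : PiecewiseC1On δ 0 n) (hinj : InjOn δ (Icc 0 n))
    {ψ : Fin n → ℝ → ℂ} {f : Fin n → (Fin (n + 1) → ℂ) → ℂ}
    (hf : ∀ k : Fin n, IsArcIntegral μ z (piece δ k) (ψ k) (f k)) :
    LinearIndependent ℂ fun k => (f k : Germ (𝓝 z) ℂ) := by
  have hn' : (0 : ℝ) < n := by exact_mod_cast hn
  have hmem : ∀ k : Fin n, ∀ t ∈ Icc (0 : ℝ) 1, ((k : ℕ) : ℝ) + t ∈ Icc (0 : ℝ) n := fun k t ht => by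
    have hk' : ((k : ℕ) : ℝ) + 1 ≤ n := by exact_mod_cast k.2
    have hk0 : (0 : ℝ) ≤ (k : ℕ) := Nat.cast_nonneg _
    exact ⟨by linarith [ht.1], by linarith [ht.2]⟩
  have hun : ⋃ k : Fin n, piece δ k '' Icc 0 1 = δ '' Icc 0 n := by
    apply Subset.antisymm
    · rintro _ ⟨_, ⟨k, rfl⟩, t, ht, rfl⟩
      exact ⟨_, hmem k t ht, rfl⟩
    · rintro _ ⟨t, ht, rfl⟩
      rcases ht.2.eq_or_lt with rfl | htn
      -- The end point t = n belongs to the last piece at parameter 1, since its integer part is not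
      -- an index of a piece.
      · refine mem_iUnion.2 ⟨⟨n - 1, by omega⟩, 1, by simp, ?_⟩
        simp only [piece]
        congr 1
        exact_mod_cast Nat.sub_add_cancel hn
      · have h1 := Nat.floor_le ht.1
        have h2 := Nat.lt_floor_add_one t
        refine mem_iUnion.2 ⟨⟨⌊t⌋₊, (Nat.floor_lt ht.1).2 htn⟩, t - ⌊t⌋₊,
          ⟨by linarith, by linarith⟩, ?_⟩
        simp [piece]
  refine linearIndependent_arcIntegrals hμ hsum hz hf ?_ ?_
  · rw [hun]
    exact isPreconnected_compl_arc hn'.le (hp.continuousOn hn') hinj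
  · intro k t ht k' t' ht' he
    have h1 := hinj (hmem k' t' ht') (hmem k t (Ioo_subset_Icc_self ht)) he
    have h2 : (k' : ℕ) ≤ (k : ℕ) := by
      have : ((k' : ℕ) : ℝ) < (k : ℕ) + 1 := by linarith [ht.2, ht'.1]
      exact Nat.lt_succ_iff.1 (by exact_mod_cast this)
    have h3 : (k : ℕ) ≤ (k' : ℕ) := by
      have : ((k : ℕ) : ℝ) < (k' : ℕ) + 1 := by linarith [ht.1, ht'.2]
      exact Nat.lt_succ_iff.1 (by exact_mod_cast this)
    have h4 : (k' : ℕ) = k := le_antisymm h2 h3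
    refine ⟨Fin.ext h4, ?_⟩
    rw [h4] at h1
    linarith

/-- The determination from the left exists. -/
theorem IsLArcSystem.exists_isLeftDetermination {n : ℕ} (μ : Fin (n + 1) → ℝ)
    {z : Fin (n + 1) → ℂ} {δ : ℝ → ℂ} (h : IsLArcSystem z δ) (k : Fin n) :
    ∃ ψ, IsLeftDetermination μ z δ k ψ := by
  obtain ⟨T, R, F, hnT, hR, hFc, hFe, hFR⟩ := h.exists_log
  have hk' : ((k : ℕ) : ℝ) + 1 ≤ n := by exact_mod_cast k.2
  have hk0 : (0 : ℝ) ≤ (k : ℕ) := Nat.cast_nonneg _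
  have hjT : ∀ j : Fin (n + 1), ((j : ℕ) : ℝ) ∈ Icc 0 T := fun j =>
    ⟨Nat.cast_nonneg _, hnT.trans' (by exact_mod_cast Nat.lt_succ_iff.1 j.2)⟩
  have hkT : ∀ t ∈ Ioo (0 : ℝ) 1, (k : ℕ) + t ∈ Icc 0 T := fun t ht =>
    ⟨by linarith [ht.1], by linarith [ht.2]⟩
  have hnot : ∀ {s s' : ℝ}, 0 ≤ s' → s' < s → δ s' ∉ δ '' Ici s := by
    rintro s s' hs' hss' ⟨t, ht, hts⟩
    have ht' : s ≤ t := ht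
    have := h.injOn (show t ∈ Ici (0 : ℝ) from hs'.trans (hss'.le.trans ht')) hs' hts
    linarith
  have hsub : ∀ s : ℝ, 0 ≤ s → ∀ ζ ∈ (δ '' Ici 0)ᶜ, ζ ∉ δ '' Ici s := fun s hs ζ hζ hm =>
    hζ (image_mono (Ici_subset_Ici.2 hs) hm)
  have hcp : ContinuousOn (fun t : ℝ => δ ((k : ℕ) + t)) (Ioo 0 1) :=
    h.continuousOn.comp (by fun_prop) fun t ht => (hkT t ht).1
  have hgt : ∀ j : Fin (n + 1), (k : ℕ) < (j : ℕ) → ∀ t ∈ Ioo (0 : ℝ) 1,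
      δ ((k : ℕ) + t) ∉ δ '' Ici ((j : ℕ) : ℝ) := fun j hj t ht => by
    have : ((k : ℕ) : ℝ) + 1 ≤ (j : ℕ) := by exact_mod_cast hj
    exact hnot (hkT t ht).1 (by linarith [ht.2])
  have hle : ∀ j : Fin (n + 1), ¬ (k : ℕ) < (j : ℕ) → ∀ t ∈ Ioo (0 : ℝ) 1,
      ((j : ℕ) : ℝ) < (k : ℕ) + t := fun j hj t ht => by
    have : ((j : ℕ) : ℝ) ≤ (k : ℕ) := by exact_mod_cast not_lt.1 hj
    linarith [ht.1]
  -- For j > k the point zⱼ is passed later, so the k-th piece lies off the cut of F j, which is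
  -- continuous there. For j ≤ k the piece lies on the cut, and the value is the limit from the left
  -- computed in `tendsto_log_left`.
  set ℓ : Fin (n + 1) → ℝ → ℂ := fun j t => if (k : ℕ) < (j : ℕ) then F (j : ℕ) (δ ((k : ℕ) + t))
    else F ((k : ℕ) + t) (δ (j : ℕ)) - Real.pi * Complex.I with hℓ
  refine ⟨fun t => integrand μ fun j => ℓ j t, ⟨ℓ, fun j => ?_, fun j t ht => ?_, fun t _ => rfl⟩,
    fun ζ => integrand μ fun j => F (j : ℕ) ζ,
    ⟨fun j ζ => F (j : ℕ) ζ, fun j => ?_, fun j ζ hζ => ?_, ⟨R, fun j ζ hζ => ?_⟩, fun ζ _ => rfl⟩,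
    fun t ht hsm hv => ?_⟩
  · by_cases hj : (k : ℕ) < (j : ℕ)
    · simp only [hℓ, hj, if_true]
      exact hFc.comp (f := fun t : ℝ => (((j : ℕ) : ℝ), δ ((k : ℕ) + t)))
        (continuousOn_const.prodMk hcp) fun t ht => ⟨hjT j, hgt j hj t ht⟩
    · simp only [hℓ, hj, if_false]
      refine ContinuousOn.sub (hFc.comp (f := fun t : ℝ => (((k : ℕ) : ℝ) + t, δ (j : ℕ)))
        (by fun_prop) fun t ht => ⟨hkT t ht, hnot (hjT j).1 (hle j hj t ht)⟩) continuousOn_const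
  · by_cases hj : (k : ℕ) < (j : ℕ)
    · simp only [hℓ, hj, if_true]
      rw [hFe _ (hjT j) _ (hgt j hj t ht), h.passes]
      rfl
    · simp only [hℓ, hj, if_false]
      rw [Complex.exp_sub, Complex.exp_pi_mul_I, hFe _ (hkT t ht) _ (hnot (hjT j).1 (hle j hj t ht)),
        h.passes, div_neg, div_one, neg_sub]
      rfl
  · exact hFc.comp (f := fun ζ : ℂ => (((j : ℕ) : ℝ), ζ)) (by fun_prop) fun ζ hζ =>
      ⟨hjT j, hsub _ (hjT j).1 ζ hζ⟩
  · simp only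
    rw [hFe _ (hjT j) _ (hsub _ (hjT j).1 ζ hζ), h.passes]
  · simp only
    rw [hFR _ (hjT j) _ hζ, h.passes]
  · have hsm' : ContDiffAt ℝ 1 δ ((k : ℕ) + t) := by
      have h1 : ContDiffAt ℝ 1 (fun s : ℝ => piece δ k (s - (k : ℕ))) ((k : ℕ) + t) :=
        ContDiffAt.comp (g := piece δ k) (f := fun s : ℝ => s - (k : ℕ)) ((k : ℕ) + t)
          (by rwa [add_sub_cancel_left]) (by fun_prop)
      simpa [piece] using h1
    have hd : deriv (piece δ k) t = deriv δ ((k : ℕ) + t) := deriv_comp_const_add _ _ _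
    rw [hd] at hv ⊢
    refine ((continuous_integrand μ).tendsto _).comp (tendsto_pi_nhds.2 fun j => ?_)
    by_cases hj : (k : ℕ) < (j : ℕ)
    · simp only [hℓ, hj, if_true]
      have hopen : (δ '' Ici ((j : ℕ) : ℝ))ᶜ ∈ 𝓝 (δ ((k : ℕ) + t)) := by
        obtain ⟨m, hm, hm'⟩ := h.exists_dist (B := Ici ((j : ℕ) : ℝ)) isClosed_Ici
          (Ici_subset_Ici.2 (hjT j).1) (hgt j hj t ht)
        filter_upwards [Metric.ball_mem_nhds _ hm]
        rintro ζ hζ ⟨s, hs, rfl⟩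
        rw [Metric.mem_ball, dist_eq_norm] at hζ
        exact absurd (hm' s hs) (not_le.2 hζ)
      have h1 : ContinuousAt (fun ζ => F (j : ℕ) ζ) (δ ((k : ℕ) + t)) := by
        refine ContinuousOn.continuousAt ?_ hopen
        exact hFc.comp (f := fun ζ : ℂ => (((j : ℕ) : ℝ), ζ)) (by fun_prop) fun ζ hζ => ⟨hjT j, hζ⟩
      refine h1.tendsto.comp ?_
      have h2 : Continuous fun ε : ℝ => piece δ k t + ε * (Complex.I * deriv δ ((k : ℕ) + t)) := by
        fun_prop
      have h3 := h2.tendsto 0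
      simp only [Complex.ofReal_zero, zero_mul, add_zero] at h3
      exact h3.mono_left nhdsWithin_le_nhds
    · simp only [hℓ, hj, if_false]
      exact h.tendsto_log_left hFc hFe (hjT j).1 (hle j hj t ht) (by linarith [ht.2]) hsm' hv

/-- The integrals along the pieces of an `L`-arc system exist. -/
theorem IsLArcSystem.exists_isPieceIntegral {n : ℕ} {μ : Fin (n + 1) → ℝ}
    (hμ : ∀ k, μ k ∈ Ioo (0 : ℝ) 1) {z : Fin (n + 1) → ℂ} (hz : Function.Injective z) {δ : ℝ → ℂ}
    (h : IsLArcSystem z δ) (k : Fin n) : ∃ f, IsPieceIntegral μ z δ k f := by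
  obtain ⟨ψ, hψ⟩ := h.exists_isLeftDetermination μ k
  obtain ⟨ℓ, hℓ, hexp, hψℓ⟩ := hψ.1
  obtain ⟨f, hf⟩ := exists_isArcIntegral hμ hz
    (isRelativeArc_piece (h.piecewise n) (h.injOn.mono fun t ht => ht.1) (σ := Equiv.refl _)
      h.passes k) hℓ hexp hψℓ
  exact ⟨f, ψ, hψ, hf⟩

/-! ### Embedded polygonal arcs through given points -/

/-- The polygonal path that passes through `y₀, …, yₙ` at the times `0, …, n`. -/
noncomputable def polygon (y : ℕ → ℂ) (n : ℕ) (t : ℝ) : ℂ :=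
  y 0 + ∑ k ∈ Finset.range n, ((max 0 (min 1 (t - k)) : ℝ) : ℂ) * (y (k + 1) - y k)

theorem polygon_natCast (y : ℕ → ℂ) {n k : ℕ} (hk : k ≤ n) : polygon y n k = y k := by
  have h1 : ∀ i ∈ Finset.range n, ((max 0 (min 1 ((k : ℝ) - i)) : ℝ) : ℂ) * (y (i + 1) - y i) =
      if i < k then y (i + 1) - y i else 0 := by
    intro i _
    split_ifs with hik
    · have : (i : ℝ) + 1 ≤ k := by exact_mod_cast hik
      rw [min_eq_left (by linarith), max_eq_right zero_le_one, Complex.ofReal_one, one_mul]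
    · have : (k : ℝ) ≤ i := by exact_mod_cast not_lt.1 hik
      rw [max_eq_left ((min_le_right _ _).trans (by linarith)), Complex.ofReal_zero, zero_mul]
  have h2 : (Finset.range n).filter (· < k) = Finset.range k := by
    ext i
    simp only [Finset.mem_filter, Finset.mem_range]
    omega
  rw [polygon, Finset.sum_congr rfl h1, ← Finset.sum_filter, h2, Finset.sum_range_sub]
  ring

theorem piecewiseC1On_polygon (y : ℕ → ℂ) (n : ℕ) (a b : ℝ) : PiecewiseC1On (polygon y n) a b := by
  classical
  refine ⟨(Finset.range (n + 1)).image fun k : ℕ => (k : ℝ), fun c d _ hcd _ hno => ?_⟩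
  have hno' : ∀ k ≤ n, (k : ℝ) ≤ c ∨ d ≤ k := fun k hk => by
    by_contra! hcon
    exact hno _ (Finset.mem_image_of_mem _ (Finset.mem_range.2 (Nat.lt_succ_of_le hk))) hcon
  refine contDiffOn_const.add (ContDiffOn.sum fun k hk => ContDiffOn.mul ?_ contDiffOn_const)
  refine Complex.ofRealCLM.contDiff.comp_contDiffOn ?_
  have hk' := Finset.mem_range.1 hk
  rcases hno' k hk'.le with h1 | h1
  · rcases hno' (k + 1) hk' with h2 | h2
    · refine (contDiffOn_const (c := (1 : ℝ))).congr fun t ht => ?_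
      push_cast at h2
      show max (0 : ℝ) (min 1 (t - k)) = 1
      rw [min_eq_left (by linarith [ht.1]), max_eq_right zero_le_one]
    · refine (contDiff_id.sub (contDiff_const (c := (k : ℝ)))).contDiffOn.congr fun t ht => ?_
      push_cast at h2
      show max (0 : ℝ) (min 1 (t - k)) = t - k
      rw [min_eq_right (by linarith [ht.2]), max_eq_right (by linarith [ht.1])]
  · refine (contDiffOn_const (c := (0 : ℝ))).congr fun t ht => ?_
    exact max_eq_left ((min_le_right _ _).trans (by linarith [ht.2]))

/-- A polygonal path whose vertices increase with respect to a real linear functional is embedded. -/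
theorem injOn_polygon {y : ℕ → ℂ} {n : ℕ} (φ : ℂ →ₗ[ℝ] ℝ) (h : ∀ k < n, φ (y k) < φ (y (k + 1))) :
    InjOn (polygon y n) (Icc 0 n) := by
  have hφ : ∀ t, φ (polygon y n t) =
      φ (y 0) + ∑ k ∈ Finset.range n, max 0 (min 1 (t - k)) * (φ (y (k + 1)) - φ (y k)) := by
    intro t
    rw [polygon, map_add, map_sum]
    congr 1
    refine Finset.sum_congr rfl fun k _ => ?_
    rw [← Complex.real_smul, map_smul, map_sub, smul_eq_mul]
  have hmono : StrictMonoOn (fun t => φ (polygon y n t)) (Icc 0 n) := by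
    intro s hs t ht hst
    have h0 := Nat.floor_le hs.1
    have h1 := Nat.lt_floor_add_one s
    simp only [hφ]
    -- All summands are weakly increasing in the parameter, and the one of index ⌊s⌋ is strictly
    -- increasing just after s.
    refine add_lt_add_right (Finset.sum_lt_sum (fun k hk => ?_) ⟨⌊s⌋₊, ?_, ?_⟩) _
    · have := h k (Finset.mem_range.1 hk)
      gcongr
    · exact Finset.mem_range.2 ((Nat.floor_lt hs.1).2 (hst.trans_le ht.2))
    · have := h ⌊s⌋₊ ((Nat.floor_lt hs.1).2 (hst.trans_le ht.2))
      refine mul_lt_mul_of_pos_right ?_ (by linarith)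
      rw [min_eq_right (by linarith), max_eq_right (by linarith)]
      exact lt_max_of_lt_right (lt_min (by linarith) (by linarith))
  exact fun s hs t ht hst => hmono.injOn hs ht (congrArg φ hst)

/-- Some real linear functional separates finitely many points of the plane. -/
theorem exists_linearMap_injective {ι : Type*} [Finite ι] {z : ι → ℂ} (hz : Function.Injective z) :
    ∃ φ : ℂ →ₗ[ℝ] ℝ, Function.Injective (φ ∘ z) := by
  -- The functional Re + c · Im identifies two points only for one value of c per pair. Pairs with
  -- equal imaginary parts contribute the default value 0, which only excludes c = 0 needlessly.
  have hfin : (range fun x : ι × ι => -(z x.1 - z x.2).re / (z x.1 - z x.2).im).Finite :=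
    finite_range _
  obtain ⟨c, hc⟩ := hfin.infinite_compl.nonempty
  refine ⟨Complex.reLm + c • Complex.imLm, fun i j hij => ?_⟩
  have h1 : (z i - z j).re + c * (z i - z j).im = 0 := by
    have : (z i).re + c * (z i).im = (z j).re + c * (z j).im := hij
    rw [Complex.sub_re, Complex.sub_im]
    linarith
  by_cases him : (z i - z j).im = 0
  · rw [him, mul_zero, add_zero] at h1
    exact hz (sub_eq_zero.1 (Complex.ext h1 him))
  · refine absurd ⟨(i, j), ?_⟩ hc
    simp only
    rw [div_eq_iff him]
    linarith

/-- Pairwise distinct points are the vertices of an embedded piecewise differentiable arc. -/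
theorem exists_embedded_arc {n : ℕ} {z : Fin (n + 1) → ℂ} (hz : Function.Injective z) :
    ∃ (δ : ℝ → ℂ) (σ : Equiv.Perm (Fin (n + 1))), PiecewiseC1On δ 0 n ∧ InjOn δ (Icc 0 n) ∧
      ∀ k : Fin (n + 1), δ ((k : ℕ) : ℝ) = z (σ k) := by
  obtain ⟨φ, hφ⟩ := exists_linearMap_injective hz
  set σ := Tuple.sort (φ ∘ z)
  have hmono : StrictMono ((φ ∘ z) ∘ σ) :=
    (Tuple.monotone_sort (φ ∘ z)).strictMono_of_injective (hφ.comp σ.injective)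
  set y : ℕ → ℂ := fun k => z (σ (Fin.ofNat (n + 1) k)) with hy
  refine ⟨polygon y n, σ, piecewiseC1On_polygon _ _ _ _, injOn_polygon φ fun k hk => ?_, fun k => ?_⟩
  · refine hmono (a := Fin.ofNat (n + 1) k) (b := Fin.ofNat (n + 1) (k + 1)) ?_
    rw [Fin.lt_def]
    simp only [Fin.val_ofNat]
    rw [Nat.mod_eq_of_lt (by omega), Nat.mod_eq_of_lt (by omega)]
    omega
  · rw [polygon_natCast y (Nat.lt_succ_iff.1 k.2)]
    simp [hy]

/-! ### The dimension of the space and the constant functions -/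

/-- The space `L_z` has a basis of `n` elements and consists of the germs of all solutions of the
system of differential equations. -/
theorem nonempty_basis_germSpace {n : ℕ} (hn : 0 < n) {μ : Fin (n + 1) → ℝ}
    (hμ : ∀ k, μ k ∈ Ioo (0 : ℝ) 1) (hsum : ∀ m : ℕ, 2 ≤ m → ∑ k, μ k ≠ (m : ℝ))
    {z : Fin (n + 1) → ℂ} (hz : Function.Injective z) :
    Nonempty (Module.Basis (Fin n) ℂ (germSpace μ z)) ∧
      germSpace μ z = LinearMap.range (solutionGerm μ z) := by
  -- For the dimension any embedded arc through the points, in any order and with any determination,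
  -- suffices; no L-arc system has to be constructed.
  obtain ⟨δ, σ, hp, hinj, hδ⟩ := exists_embedded_arc hz
  have hk : ∀ k : Fin n, ∃ ψ f, IsArcIntegral μ z (piece δ k) ψ f := by
    intro k
    have hγ := isRelativeArc_piece hp hinj hδ k
    have hγc := hγ.piecewise.continuousOn zero_lt_one
    choose ℓ hℓ hexp using fun j => exists_log_Ioo zero_lt_one
      ((continuousOn_const (c := z j)).sub (hγc.mono Ioo_subset_Icc_self))
      (fun t ht => sub_ne_zero.2 fun h => hγ.interior t ht ⟨j, h⟩)
    exact ⟨_, exists_isArcIntegral hμ hz hγ hℓ hexp fun t _ => rfl⟩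
  choose ψ f hf using hk
  obtain ⟨⟨b, _⟩, h⟩ := exists_basis hn hμ hz hf (linearIndependent_pieces hn hμ hsum hz hp hinj hf)
  exact ⟨⟨b⟩, h⟩

theorem isSolutionAt_const {n : ℕ} {μ : Fin (n + 1) → ℝ} (hsum : ∑ k, μ k = 1)
    (z : Fin (n + 1) → ℂ) (c : ℂ) : IsSolutionAt μ z (fun _ => c) := by
  have h : ∀ (i) (c : ℂ), pderiv i (fun _ : Fin (n + 1) → ℂ => c) = fun _ => 0 := fun i c => by
    funext w
    simp [pderiv]
  have h1 : ∑ k, (μ k : ℂ) = 1 := by rw [← Complex.ofReal_sum, hsum, Complex.ofReal_one]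
  exact ⟨analyticAt_const, by simp [h], by simp [h, h1], fun i j => by simp [h]⟩

/-- The function `1` is a solution only if the exponents have the sum `1`. -/
theorem IsSolutionAt.sum_eq_one {n : ℕ} {μ : Fin (n + 1) → ℝ} {z : Fin (n + 1) → ℂ}
    (h : IsSolutionAt μ z (fun _ => 1)) : ∑ k, μ k = 1 := by
  have h1 := h.homogeneity.self_of_nhds
  have h2 : ∀ i, pderiv i (fun _ : Fin (n + 1) → ℂ => (1 : ℂ)) z = 0 := fun i => by simp [pderiv]
  simp only [h2, mul_zero, Finset.sum_const_zero, mul_one, zero_sub, neg_eq_zero] at h1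
  have h3 : ((∑ k, μ k : ℝ) : ℂ) = 1 := by
    rw [Complex.ofReal_sum]
    exact (sub_eq_zero.1 h1).symm
  exact_mod_cast h3

end Lauricella

theorem mainTheorem7 (n : ℕ) (hn : 0 < n) (μ : Fin (n + 1) → ℝ) (hμ : ∀ k, μ k ∈ Set.Ioo (0 : ℝ) 1)
    (z : Fin (n + 1) → ℂ) (hz : Function.Injective z) :
    ((∀ m : ℕ, 2 ≤ m → ∑ k, μ k ≠ (m : ℝ)) →
      (∀ δ : ℝ → ℂ, Lauricella.IsLArcSystem z δ →
        (∀ k : Fin n, ∃ f : (Fin (n + 1) → ℂ) → ℂ, Lauricella.IsPieceIntegral μ z δ k f) ∧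
        ∀ f : Fin n → (Fin (n + 1) → ℂ) → ℂ,
          (∀ k : Fin n, Lauricella.IsPieceIntegral μ z δ k (f k)) →
          ∃ b : Module.Basis (Fin n) ℂ (Lauricella.germSpace μ z),
            ∀ k, (b k : Filter.Germ (𝓝 z) ℂ) = (f k : Filter.Germ (𝓝 z) ℂ)) ∧
      Module.finrank ℂ (Lauricella.germSpace μ z) = n) ∧
    ((∀ c : ℂ, ((fun _ => c : (Fin (n + 1) → ℂ) → ℂ) : Filter.Germ (𝓝 z) ℂ) ∈
        Lauricella.germSpace μ z) ↔ ∑ k, μ k = 1) := by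
  refine ⟨fun hsum => ⟨fun δ hδ => ⟨fun k => hδ.exists_isPieceIntegral hμ hz k, fun f hf => ?_⟩, ?_⟩,
    fun hc => ?_, fun hsum c => ?_⟩
  · choose ψ _ hψ using hf
    exact (Lauricella.exists_basis hn hμ hz hψ (Lauricella.linearIndependent_pieces hn hμ hsum hz
      (hδ.piecewise n) (hδ.injOn.mono fun t ht => ht.1) hψ)).1
  · obtain ⟨⟨b⟩, _⟩ := Lauricella.nonempty_basis_germSpace hn hμ hsum hz
    rw [Module.finrank_eq_card_basis b, Fintype.card_fin]
  -- Only the inclusion of L_z in the germs of solutions is used here, so integers |μ| ≥ 2 are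
  -- covered.
  · obtain ⟨f, hf⟩ := Lauricella.germSpace_le_range_solutionGerm hμ (hc 1)
    have h1 : f.1 =ᶠ[𝓝 z] fun _ => (1 : ℂ) := Germ.coe_eq.1 hf
    exact (Lauricella.IsSolutionAt.congr f.2 h1).sum_eq_one
  -- |μ| = 1 is not an integer ≥ 2, so L_z contains the germs of all solutions, in particular the
  -- constants.
  · rw [(Lauricella.nonempty_basis_germSpace hn hμ (fun m hm h => by
      rw [hsum] at h
      have h1 : (2 : ℝ) ≤ m := by exact_mod_cast hm
      linarith) hz).2]
    exact ⟨⟨fun _ => c, Lauricella.isSolutionAt_const hsum z c⟩, rfl⟩
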